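/- Let $\lambda\neq 0$ be a real number. For a switching function $f:\mathbb{R}^3\to\mathbb{R}$ and real polynomials $P_\ell^{+},P_\ell^{-}$ ($\ell=1,2,3$) of degree at most $2$ in $(x,y,z)$, consider the piecewise quadratic system $$(\dot x,\dot y,\dot z)=\bigl(-y,\;x,\;\lambda(x^2+y^2-z)\bigr)+\varepsilon\,\bigl(P_1,P_2,P_3\bigr)(x,y,z),\qquad P_\ell=\begin{cases}P_\ell^+ & \text{if } f(x,y,z)>0,\\ P_\ell^- & \text{if } f(x,y,z)<0.\end{cases}\tag{$*$}$$ For $\varepsilon=0$ the paraboloid $\mathcal S=\{z=x^2+y^2\}$ is invariant and its orbits other than the origin are $2\pi$-periodic. A point of $\Sigma=f^{-1}(0)$ is a crossing point if the Lie derivatives of $f$ along the two vector fields (that of $f>0$ and that of $f<0$) are both positive or both negative there; a crossing periodic orbit is a periodic orbit that meets $\Sigma$, and only at crossing points; a limit cycle is a crossing periodic orbit having a neighbourhood that contains no other periodic orbit. Let $(f,n)$ be one of $(y,4)$, $(y-z,6)$, $(y-x^2,8)$. Then there are polynomials $P_\ell^\pm$ of degree at most $2$ and $n$ distinct crossing periodic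 orbits $\Gamma_1,\dots,\Gamma_n\subset\mathcal S$ of the unperturbed system ($\varepsilon=0$) such that, for every sufficiently small $\varepsilon\neq0$, the system $(*)$ has at least $n$ limit cycles $\Gamma_1^\varepsilon,\dots,\Gamma_n^\varepsilon$, pairwise distinct, and $\Gamma_i^\varepsilon\to\Gamma_i$ in the Hausdorff distance as $\varepsilon\to0$ for each $i$. -/

import Mathlib

open Filter Topology

/-- The phase space `ℝ³`, with coordinates `(x, y, z) = (p 0, p 1, p 2)`. -/
abbrev Space : Type := Fin 3 → ℝ

/-- The Lie derivative `X f (p)` of the function `f` at `p` in the direction of the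
vector field `X`. -/
noncomputable def lieDeriv (X : Space → Space) (f : Space → ℝ) (p : Space) : ℝ :=
  fderiv ℝ f p (X p)

/-- A piecewise smooth vector field with two zones: `Xp` on `f > 0` and `Xm` on `f < 0`;
the switching manifold is `f = 0`. -/
structure PiecewiseField where
  /-- the switching function -/
  f : Space → ℝ
  /-- the vector field on `f > 0` -/
  Xp : Space → Space
  /-- the vector field on `f < 0` -/
  Xm : Space → Space

namespace PiecewiseField

/-- At `p` both fields cross the switching manifold transversally towards `f > 0`. -/
def CrossesUp (Z : PiecewiseField) (p : Space) : Prop :=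
  Z.f p = 0 ∧ 0 < lieDeriv Z.Xp Z.f p ∧ 0 < lieDeriv Z.Xm Z.f p

/-- At `p` both fields cross the switching manifold transversally towards `f < 0`. -/
def CrossesDown (Z : PiecewiseField) (p : Space) : Prop :=
  Z.f p = 0 ∧ lieDeriv Z.Xp Z.f p < 0 ∧ lieDeriv Z.Xm Z.f p < 0

/-- Complete trajectories of the piecewise smooth field: continuous curves that follow `Xp`
on `f > 0` and `Xm` on `f < 0`, and that go from one zone to the other at the crossing points
of the switching manifold. Nothing is prescribed at the other points of the switching
manifold (sliding, escaping or tangency points), so that the trajectories in the sense of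
any convention for those points (for instance Filippov's) are trajectories in this sense. -/
structure IsTrajectory (Z : PiecewiseField) (γ : ℝ → Space) : Prop where
  continuous : Continuous γ
  pos : ∀ t, 0 < Z.f (γ t) → HasDerivAt γ (Z.Xp (γ t)) t
  neg : ∀ t, Z.f (γ t) < 0 → HasDerivAt γ (Z.Xm (γ t)) t
  up : ∀ t, Z.CrossesUp (γ t) →
    HasDerivWithinAt γ (Z.Xm (γ t)) (Set.Iic t) t ∧
    HasDerivWithinAt γ (Z.Xp (γ t)) (Set.Ici t) t
  down : ∀ t, Z.CrossesDown (γ t) →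
    HasDerivWithinAt γ (Z.Xp (γ t)) (Set.Iic t) t ∧
    HasDerivWithinAt γ (Z.Xm (γ t)) (Set.Ici t) t

/-- `Γ` is the orbit of a nonconstant periodic trajectory. -/
def IsPeriodicOrbit (Z : PiecewiseField) (Γ : Set Space) : Prop :=
  Γ.Nontrivial ∧
    ∃ γ : ℝ → Space, ∃ T : ℝ, 0 < T ∧ Z.IsTrajectory γ ∧ Function.Periodic γ T ∧
      Set.range γ = Γ

/-- A crossing periodic orbit: a periodic orbit that meets the switching manifold, and only at
crossing points. -/
def IsCrossingPeriodicOrbit (Z : PiecewiseField) (Γ : Set Space) : Prop :=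
  Z.IsPeriodicOrbit Γ ∧ (∃ p ∈ Γ, Z.f p = 0) ∧
    ∀ p ∈ Γ, Z.f p = 0 → Z.CrossesUp p ∨ Z.CrossesDown p

/-- A (crossing) limit cycle: a crossing periodic orbit that is isolated among all periodic
orbits, that is, some neighbourhood of it contains no other periodic orbit. -/
def IsLimitCycle (Z : PiecewiseField) (Γ : Set Space) : Prop :=
  Z.IsCrossingPeriodicOrbit Γ ∧
    ∃ U : Set Space, IsOpen U ∧ Γ ⊆ U ∧
      ∀ Γ' : Set Space, Z.IsPeriodicOrbit Γ' → Γ' ⊆ U → Γ' = Γ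

end PiecewiseField

/-- The unperturbed vector field `(-y, x, lam (x² + y² - z))`. -/
def unperturbedField (lam : ℝ) (p : Space) : Space :=
  ![-p 1, p 0, lam * (p 0 ^ 2 + p 1 ^ 2 - p 2)]

/-- The vector field `(-y, x, lam (x² + y² - z)) + ε (P₁, P₂, P₃)`. -/
noncomputable def perturbedField (lam ε : ℝ) (P : Fin 3 → MvPolynomial (Fin 3) ℝ)
    (p : Space) : Space :=
  fun i => unperturbedField lam p i + ε * MvPolynomial.eval p (P i)

/-- The piecewise polynomial system with switching function `f`, in which the perturbation is
given by `Pp` on `f > 0` and by `Pm` on `f < 0`. -/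
noncomputable def perturbedSystem (lam ε : ℝ) (f : Space → ℝ)
    (Pp Pm : Fin 3 → MvPolynomial (Fin 3) ℝ) : PiecewiseField where
  f := f
  Xp := perturbedField lam ε Pp
  Xm := perturbedField lam ε Pm

/-- The invariant paraboloid `z = x² + y²`. -/
def paraboloid : Set Space := {p | p 2 = p 0 ^ 2 + p 1 ^ 2}

/-- For the switching function `f`, some piecewise quadratic perturbation has, for every
sufficiently small `ε ≠ 0`, at least `n` limit cycles, which converge in the Hausdorff distance
as `ε → 0` to `n` distinct crossing periodic orbits of the unperturbed system contained in the
paraboloid. -/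
def AtLeastLimitCyclesBifurcate (lam : ℝ) (f : Space → ℝ) (n : ℕ) : Prop :=
  ∃ Pp Pm : Fin 3 → MvPolynomial (Fin 3) ℝ,
    (∀ i, (Pp i).totalDegree ≤ 2) ∧ (∀ i, (Pm i).totalDegree ≤ 2) ∧
    ∃ Γ : Fin n → Set Space, Function.Injective Γ ∧
      (∀ i, (perturbedSystem lam 0 f Pp Pm).IsCrossingPeriodicOrbit (Γ i) ∧
        Γ i ⊆ paraboloid) ∧
      ∃ ε₀ > 0, ∃ C : ℝ → Fin n → Set Space,
        (∀ ε : ℝ, ε ≠ 0 → |ε| < ε₀ →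
          Function.Injective (C ε) ∧
          ∀ i, (perturbedSystem lam ε f Pp Pm).IsLimitCycle (C ε i)) ∧
        ∀ i, Tendsto (fun ε => Metric.hausdorffEDist (C ε i) (Γ i)) (𝓝[≠] 0) (𝓝 0)

/-! Put R = x² + y² and s = x² + y² - z. The unperturbed flow keeps R fixed and multiplies s by
exp(-λt). Near a circle of the paraboloid that crosses the switching manifold transversally at
exactly two points, the return map on upward crossings, written in the coordinates (R, s), therefore
has the form (R, s) ↦ (R + ε a(R, s, ε), b(R, s, ε)). At the circle and ε = 0 one has ∂b/∂R = 0 and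
∂b/∂s = exp(-2πλ) ≠ 1, and a(R, 0, 0) is the first-order averaged function `melnikov`. At a simple
zero of it the equations a = 0, b = s can be solved by the implicit function theorem, which gives a
fixed point for each small ε. Since the linear part is triangular and hyperbolic once the factor ε
is taken out, no other periodic sequence of the map stays in a neighbourhood independent of ε
(`eq_zero_of_periodic_of_recursion`, `exists_fixedPoint_of_hyperbolic`).

The return map comes from a shooting problem whose unknowns are the initial point, the two durations
and ε. `exists_solutionMap` makes the solution paths strictly differentiable in these data, by the
implicit function theorem for the integral equation on C([0, 1], ℝ)³. `Shooting.exists_chart_deriv`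
shows that R, s, ε and the values of f at the three crossing points are local coordinates on the
shooting parameters, and `Shooting.hyperbolic` computes the derivatives above. The limit cycle must
be isolated among all periodic orbits, including those that wind several times: an orbit near the
circle rotates about the third axis, so it crosses upwards, and its successive crossings form a
periodic sequence of the return map (`Shooting.eq_orbit_of_forall_isTubePoint`). This yields
`IsSimpleCrossingCircle.exists_isLimitCycle`.

It remains to find perturbations whose averaged function has n simple zeros. On the paraboloid z =
r², so quadratic perturbations produce terms up to r⁴. For f = y the crossing angle is 0 and any
quartic in r can be realised. For the other two surfaces the circles are parametrised by the
crossing angle t, with r = sin t and r = sin t / cos² t. The averaged functions then span spaces of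
dimensions 7 and 9, and n + 1 independent differentiable functions on an interval, one of them
positive, have a combination with n simple zeros (`exists_simple_zeros`). -/

/-! ### Path space and Volterra operators -/

/-- Paths in phase space parametrised by the unit interval, as triples of elements of the Banach
algebra `C([0, 1], ℝ)`. -/
abbrev PathSpace : Type := Fin 3 → C(unitInterval, ℝ)

namespace PathSpace

/-- The point of a path at the parameter `s`. -/
noncomputable def at' (s : unitInterval) : PathSpace →L[ℝ] Space :=
  ContinuousLinearMap.pi fun i => (ContinuousMap.evalCLM ℝ s).comp (ContinuousLinearMap.proj i)

@[simp] theorem at'_apply (s : unitInterval) (u : PathSpace) (i : Fin 3) : at' s u i = u i s := rfl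

theorem norm_at'_le (s : unitInterval) (u : PathSpace) : ‖at' s u‖ ≤ ‖u‖ := by
  rw [pi_norm_le_iff_of_nonneg (norm_nonneg _)]
  intro i
  exact ((u i).norm_coe_le_norm s).trans (norm_le_pi_norm u i)

theorem norm_le_of_forall_at' {u : PathSpace} {C : ℝ} (hC : 0 ≤ C) (h : ∀ s, ‖at' s u‖ ≤ C) :
    ‖u‖ ≤ C := by
  rw [pi_norm_le_iff_of_nonneg hC]
  intro i
  rw [ContinuousMap.norm_le _ hC]
  intro s
  exact (norm_le_pi_norm (at' s u) i).trans (h s)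

theorem ext_at' {u v : PathSpace} (h : ∀ s, at' s u = at' s v) : u = v := by
  ext i s
  exact congrFun (h s) i

theorem continuous_at' : Continuous fun q : unitInterval × PathSpace => at' q.1 q.2 := by
  refine continuous_pi fun i => ?_
  change Continuous fun q : unitInterval × PathSpace => (q.2 i) q.1
  fun_prop

end PathSpace

open PathSpace

theorem continuous_iccExtend (g : C(unitInterval, ℝ)) :
    Continuous (Set.IccExtend (zero_le_one' ℝ) g) := g.continuous.Icc_extend'

/-- The primitive vanishing at `0`, as an operator on `C([0, 1], ℝ)`. -/
noncomputable def primitive : C(unitInterval, ℝ) →L[ℝ] C(unitInterval, ℝ) :=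
  LinearMap.mkContinuous
    { toFun := fun g =>
        ⟨fun s => ∫ x in (0 : ℝ)..s, Set.IccExtend (zero_le_one' ℝ) g x,
          (intervalIntegral.continuous_primitive
            (fun a b => (continuous_iccExtend g).intervalIntegrable a b) 0).comp
              continuous_subtype_val⟩
      map_add' := fun g h => by
        ext s
        simp only [ContinuousMap.coe_mk, ContinuousMap.add_apply]
        rw [← intervalIntegral.integral_add ((continuous_iccExtend g).intervalIntegrable _ _)
          ((continuous_iccExtend h).intervalIntegrable _ _)]
        rfl
      map_smul' := fun c g => by
        ext s
        simp only [ContinuousMap.coe_mk, ContinuousMap.smul_apply, RingHom.id_apply]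
        rw [← intervalIntegral.integral_smul]
        rfl } 1 (by
    intro g
    rw [one_mul, ContinuousMap.norm_le _ (norm_nonneg _)]
    intro s
    have h := intervalIntegral.norm_integral_le_of_norm_le_const (a := 0) (b := (s : ℝ))
      (f := Set.IccExtend (zero_le_one' ℝ) g) (C := ‖g‖)
      (fun x _ => g.norm_coe_le_norm _)
    refine h.trans ?_
    have : |(s : ℝ) - 0| ≤ 1 := by
      rw [sub_zero, abs_of_nonneg s.2.1]; exact s.2.2
    nlinarith [norm_nonneg g])

theorem primitive_apply (g : C(unitInterval, ℝ)) (s : unitInterval) :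
    primitive g s = ∫ x in (0 : ℝ)..s, Set.IccExtend (zero_le_one' ℝ) g x := rfl

/-- Each integration gains a factor s / (n + 1). Iterated, this produces the factorial that makes
Volterra operators quasinilpotent. -/
theorem abs_primitive_le {g : C(unitInterval, ℝ)} {C : ℝ} {n : ℕ}
    (h : ∀ x, |g x| ≤ C * (x : ℝ) ^ n) (s : unitInterval) :
    |primitive g s| ≤ C * (s : ℝ) ^ (n + 1) / (n + 1) := by
  rw [primitive_apply]
  have h1 := intervalIntegral.norm_integral_le_of_norm_le (a := 0) (b := (s : ℝ))
    (f := Set.IccExtend (zero_le_one' ℝ) g) (g := fun x => C * x ^ n) (μ := MeasureTheory.volume)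
    s.2.1 (by
      refine Eventually.of_forall fun x hx => ?_
      have hx' : x ∈ Set.Icc (0 : ℝ) 1 := ⟨hx.1.le, hx.2.trans s.2.2⟩
      rw [Set.IccExtend_of_mem _ _ hx']
      exact h ⟨x, hx'⟩)
    (by apply Continuous.intervalIntegrable; fun_prop)
  refine h1.trans (le_of_eq ?_)
  rw [intervalIntegral.integral_const_mul, integral_pow]
  simp
  ring

/-- Operators of Volterra type are quasinilpotent, so that `1 - V` is invertible. -/
theorem isUnit_one_sub_of_volterra {V : PathSpace →L[ℝ] PathSpace} {K : ℝ}
    (hV : ∀ (h : PathSpace) (C : ℝ) (n : ℕ), (∀ x, ‖at' x h‖ ≤ C * (x : ℝ) ^ n) →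
      ∀ s, ‖at' s (V h)‖ ≤ K * (C * (s : ℝ) ^ (n + 1) / (n + 1))) :
    IsUnit (1 - V) := by
  have hK : ∀ (n : ℕ) (h : PathSpace) (s : unitInterval),
      ‖at' s ((V ^ n) h)‖ ≤ K ^ n / n.factorial * ‖h‖ * (s : ℝ) ^ n := by
    intro n
    induction n with
    | zero => intro h s; simpa using norm_at'_le s h
    | succ n ih =>
      intro h s
      have := hV ((V ^ n) h) (K ^ n / n.factorial * ‖h‖) n (ih h) s
      rw [pow_succ']
      refine this.trans (le_of_eq ?_)
      rw [Nat.factorial_succ]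
      push_cast
      have : (n.factorial : ℝ) ≠ 0 := by positivity
      field_simp
      ring
  have hlim := FloorSemiring.tendsto_pow_div_factorial_atTop (|K|)
  obtain ⟨n, hn⟩ := (hlim.eventually (gt_mem_nhds (one_pos))).exists
  have hVn : ‖V ^ n‖ < 1 := by
    refine lt_of_le_of_lt (ContinuousLinearMap.opNorm_le_bound _ (by positivity) fun h => ?_) hn
    refine norm_le_of_forall_at' (by positivity) fun s => (hK n h s).trans ?_
    have h1 : (s : ℝ) ^ n ≤ 1 := pow_le_one₀ s.2.1 s.2.2
    have h2 : K ^ n ≤ |K| ^ n := by rw [← abs_pow]; exact le_abs_self _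
    have h3 : 0 ≤ (s : ℝ) ^ n := pow_nonneg s.2.1 n
    calc K ^ n / n.factorial * ‖h‖ * (s : ℝ) ^ n
        ≤ |K| ^ n / n.factorial * ‖h‖ * (s : ℝ) ^ n := by gcongr
      _ ≤ |K| ^ n / n.factorial * ‖h‖ * 1 := by gcongr
      _ = _ := mul_one _
  have hu : IsUnit (1 - V ^ n) := isUnit_one_sub_of_norm_lt_one (x := V ^ n) hVn
  -- The unit 1 - Vⁿ is the product of 1 - V and a geometric sum commuting with it, so both factors
  -- are units.
  rw [← mul_neg_geom_sum] at hu
  have hc : Commute (1 - V) (∑ i ∈ Finset.range n, V ^ i) := by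
    refine Commute.sum_right _ _ _ fun i _ => ?_
    exact (Commute.one_left _).sub_left ((Commute.refl V).pow_right i)
  exact (hc.isUnit_mul_iff.1 hu).1

/-! ### Differentiable dependence of solutions on initial point, duration and ε -/

/-- The superposition operator of the unperturbed field. -/
noncomputable def unperturbedOp (lam : ℝ) (u : PathSpace) : PathSpace :=
  ![-u 1, u 0, lam • (u 0 ^ 2 + u 1 ^ 2 - u 2)]

/-- The superposition operator of the perturbed field. -/
noncomputable def fieldOp (lam ε : ℝ) (P : Fin 3 → MvPolynomial (Fin 3) ℝ) (u : PathSpace) :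
    PathSpace :=
  unperturbedOp lam u + ε • fun i => MvPolynomial.aeval u (P i)

theorem aeval_apply (u : PathSpace) (P : MvPolynomial (Fin 3) ℝ) (s : unitInterval) :
    (MvPolynomial.aeval u P) s = MvPolynomial.eval (at' s u) P := by
  induction P using MvPolynomial.induction_on with
  | C a => simp [Algebra.algebraMap_eq_smul_one]
  | add p q hp hq => simp [hp, hq]
  | mul_X p i hp => simp [hp]

theorem at'_fieldOp (lam ε : ℝ) (P : Fin 3 → MvPolynomial (Fin 3) ℝ) (u : PathSpace)
    (s : unitInterval) : at' s (fieldOp lam ε P u) = perturbedField lam ε P (at' s u) := by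
  ext i
  simp only [at'_apply, fieldOp, perturbedField, Pi.add_apply, Pi.smul_apply,
    ContinuousMap.add_apply, ContinuousMap.smul_apply, aeval_apply, smul_eq_mul]
  congr 1
  fin_cases i <;> simp [unperturbedOp, unperturbedField]

/-- Substituting a path into a polynomial is a polynomial operation in the Banach algebra C([0, 1],
ℝ), hence smooth. -/
theorem contDiff_aeval {n : WithTop ℕ∞} (P : MvPolynomial (Fin 3) ℝ) :
    ContDiff ℝ n fun u : PathSpace => MvPolynomial.aeval u P := by
  induction P using MvPolynomial.induction_on with
  | C a => simpa using contDiff_const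
  | add p q hp hq => simpa using hp.add hq
  | mul_X p i hp => simpa using hp.mul (contDiff_apply ℝ _ i)

theorem contDiff_unperturbedOp {n : WithTop ℕ∞} (lam : ℝ) : ContDiff ℝ n (unperturbedOp lam) := by
  have h : ∀ i : Fin 3, ContDiff ℝ n fun u : PathSpace => u i := fun i => contDiff_apply ℝ _ i
  refine contDiff_pi.2 fun i => ?_
  fin_cases i
  · exact (h 1).neg
  · exact h 0
  · exact ((((h 0).pow 2).add ((h 1).pow 2)).sub (h 2)).const_smul lam

/-- The primitive vanishing at `0`, componentwise. -/
noncomputable def pathPrimitive : PathSpace →L[ℝ] PathSpace :=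
  ContinuousLinearMap.pi fun i => primitive.comp (ContinuousLinearMap.proj i)

/-- The constant path. -/
noncomputable def constPath : Space →L[ℝ] PathSpace :=
  ContinuousLinearMap.pi fun i =>
    (ContinuousLinearMap.proj (R := ℝ) (φ := fun _ : Fin 3 => ℝ) i).smulRight (1 : C(unitInterval, ℝ))

@[simp] theorem at'_constPath (s : unitInterval) (p : Space) : at' s (constPath p) = p := by
  ext i; simp [constPath]

/-- The path `u` is, up to the time change `t = T s`, the solution starting at `p`, on the time
interval `[0, T]`, of the perturbed field. -/
def IsSolutionPath (lam : ℝ) (P : Fin 3 → MvPolynomial (Fin 3) ℝ) (q : Space × ℝ × ℝ)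
    (u : PathSpace) : Prop :=
  u - constPath q.1 - q.2.1 • pathPrimitive (fieldOp lam q.2.2 P u) = 0

theorem norm_at'_pathPrimitive_le {g : PathSpace} {C : ℝ} {n : ℕ}
    (h : ∀ x, ‖at' x g‖ ≤ C * (x : ℝ) ^ n) (s : unitInterval) :
    ‖at' s (pathPrimitive g)‖ ≤ C * (s : ℝ) ^ (n + 1) / (n + 1) := by
  have hC : 0 ≤ C := by
    have := (norm_nonneg _).trans (h 1)
    simpa using this
  rw [pi_norm_le_iff_of_nonneg (by have := s.2.1; positivity)]
  exact fun i => abs_primitive_le (fun x => (norm_le_pi_norm (at' x g) i).trans (h x)) s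

/-- The linearisation of the unperturbed superposition operator. -/
noncomputable def unperturbedOpDeriv (lam : ℝ) (u : PathSpace) : PathSpace →L[ℝ] PathSpace :=
  let π : Fin 3 → PathSpace →L[ℝ] C(unitInterval, ℝ) := ContinuousLinearMap.proj
  ContinuousLinearMap.pi ![-π 1, π 0, lam • (((2 : ℝ) • u 0) • π 0 + ((2 : ℝ) • u 1) • π 1 - π 2)]

theorem hasFDerivAt_unperturbedOp (lam : ℝ) (u : PathSpace) :
    HasFDerivAt (unperturbedOp lam) (unperturbedOpDeriv lam u) u := by
  have h : ∀ i : Fin 3, HasFDerivAt (fun u : PathSpace => u i)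
      (ContinuousLinearMap.proj (R := ℝ) (φ := fun _ : Fin 3 => C(unitInterval, ℝ)) i) u :=
    fun i => hasFDerivAt_apply i u
  refine hasFDerivAt_pi.2 fun i => ?_
  fin_cases i
  · exact (h 1).neg
  · exact h 0
  · refine (((((h 0).pow 2).add ((h 1).pow 2)).sub (h 2)).const_smul lam).congr_fderiv ?_
    ext v s
    simp [two_smul]

/-- The linearisation acts pointwise in s. A bound at each s, rather than in the sup norm, is what
preserves the powers of s in the Volterra estimate. -/
theorem norm_at'_unperturbedOpDeriv_le (lam : ℝ) (u h : PathSpace) (s : unitInterval) :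
    ‖at' s (unperturbedOpDeriv lam u h)‖ ≤ (1 + |lam| * (4 * ‖u‖ + 1)) * ‖at' s h‖ := by
  have hh : ∀ i, |h i s| ≤ ‖at' s h‖ := fun i => norm_le_pi_norm (at' s h) i
  have hu : ∀ i, |u i s| ≤ ‖u‖ := fun i =>
    (norm_le_pi_norm (at' s u) i).trans (norm_at'_le s u)
  have h0 := norm_nonneg (at' s h)
  have hM : 0 ≤ |lam| * (4 * ‖u‖ + 1) := by positivity
  rw [pi_norm_le_iff_of_nonneg (by positivity)]
  intro i
  fin_cases i
  · simp [unperturbedOpDeriv]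
    nlinarith [hh 1]
  · simp [unperturbedOpDeriv]
    nlinarith [hh 0]
  · simp [unperturbedOpDeriv]
    have h1 : |2 * (u 0 s * h 0 s) + 2 * (u 1 s * h 1 s) - h 2 s| ≤ (4 * ‖u‖ + 1) * ‖at' s h‖ := by
      have e0 := mul_le_mul (hu 0) (hh 0) (abs_nonneg _) (norm_nonneg _)
      have e1 := mul_le_mul (hu 1) (hh 1) (abs_nonneg _) (norm_nonneg _)
      rw [← abs_mul] at e0 e1
      have a0 := abs_le.1 e0
      have a1 := abs_le.1 e1
      have a2 := abs_le.1 (hh 2)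
      rw [abs_le]
      constructor <;> nlinarith
    have h2 := mul_le_mul_of_nonneg_left h1 (abs_nonneg lam)
    nlinarith

/-- The unperturbed solution starting at `p`, on the time interval `[0, T]`. -/
noncomputable def unperturbedFlow (lam : ℝ) (t : ℝ) (p : Space) : Space :=
  ![p 0 * Real.cos t - p 1 * Real.sin t, p 0 * Real.sin t + p 1 * Real.cos t,
    p 0 ^ 2 + p 1 ^ 2 + (p 2 - (p 0 ^ 2 + p 1 ^ 2)) * Real.exp (-(lam * t))]

theorem continuous_unperturbedFlow (lam : ℝ) :
    Continuous fun q : ℝ × Space => unperturbedFlow lam q.1 q.2 := by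
  refine continuous_pi fun i => ?_
  fin_cases i <;> simp [unperturbedFlow] <;> fun_prop

theorem hasDerivAt_unperturbedFlow (lam : ℝ) (p : Space) (t : ℝ) :
    HasDerivAt (fun t => unperturbedFlow lam t p) (unperturbedField lam (unperturbedFlow lam t p))
      t := by
  have hc := Real.hasDerivAt_cos t
  have hs := Real.hasDerivAt_sin t
  have he : HasDerivAt (fun t => Real.exp (-(lam * t))) (Real.exp (-(lam * t)) * (-(lam * 1))) t :=
    (((hasDerivAt_id t).const_mul lam).neg).exp
  refine hasDerivAt_pi.2 fun i => ?_
  fin_cases i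
  · refine ((hc.const_mul (p 0)).sub (hs.const_mul (p 1))).congr_deriv ?_
    simp [unperturbedField, unperturbedFlow]
    ring
  · refine ((hs.const_mul (p 0)).add (hc.const_mul (p 1))).congr_deriv ?_
    simp [unperturbedField, unperturbedFlow]
    ring
  · refine ((he.const_mul (p 2 - (p 0 ^ 2 + p 1 ^ 2))).const_add (p 0 ^ 2 + p 1 ^ 2)).congr_deriv ?_
    simp [unperturbedField, unperturbedFlow]
    linear_combination (-lam * (p 0 ^ 2 + p 1 ^ 2)) * Real.sin_sq_add_cos_sq t

/-- The unperturbed solution starting at `p`, on the time interval `[0, T]`, as a path. -/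
noncomputable def unperturbedPath (lam : ℝ) (q : Space × ℝ) : PathSpace := fun i =>
  ⟨fun s => unperturbedFlow lam (q.2 * s) q.1 i, by
    have := (continuous_unperturbedFlow lam).comp
      (show Continuous fun s : unitInterval => (q.2 * (s : ℝ), q.1) by fun_prop)
    exact (continuous_apply i).comp this⟩

@[simp] theorem at'_unperturbedPath (lam : ℝ) (q : Space × ℝ) (s : unitInterval) :
    at' s (unperturbedPath lam q) = unperturbedFlow lam (q.2 * s) q.1 := rfl

theorem continuous_unperturbedPath (lam : ℝ) : Continuous (unperturbedPath lam) := by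
  refine continuous_pi fun i => ?_
  refine ContinuousMap.continuous_of_continuous_uncurry _ ?_
  have := (continuous_unperturbedFlow lam).comp
      (show Continuous fun s : (Space × ℝ) × unitInterval => (s.1.2 * (s.2 : ℝ), s.1.1) by fun_prop)
  exact (continuous_apply i).comp this

theorem isSolutionPath_unperturbedPath (lam : ℝ) (P : Fin 3 → MvPolynomial (Fin 3) ℝ)
    (q : Space × ℝ) : IsSolutionPath lam P (q.1, q.2, 0) (unperturbedPath lam q) := by
  refine ext_at' fun s => ?_
  ext i
  have hd : ∀ x ∈ Set.uIcc (0 : ℝ) s, HasDerivAt (fun x => unperturbedFlow lam (q.2 * x) q.1 i)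
      (q.2 * unperturbedField lam (unperturbedFlow lam (q.2 * x) q.1) i) x := by
    intro x _
    have h1 := (hasDerivAt_pi.1 (hasDerivAt_unperturbedFlow lam q.1 (q.2 * x))) i
    have h2 := h1.comp x ((hasDerivAt_id x).const_mul q.2)
    simpa [mul_comm, Function.comp_def] using h2
  have hcont : Continuous fun x : ℝ =>
      q.2 * unperturbedField lam (unperturbedFlow lam (q.2 * x) q.1) i := by
    have h1 : Continuous fun x : ℝ => unperturbedFlow lam (q.2 * x) q.1 :=
      (continuous_unperturbedFlow lam).comp
        (show Continuous fun s : ℝ => (q.2 * (s : ℝ), q.1) by fun_prop)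
    have h2 : ∀ j, Continuous fun x : ℝ => unperturbedFlow lam (q.2 * x) q.1 j :=
      fun j => (continuous_apply j).comp h1
    have h20 := h2 0
    have h21 := h2 1
    have h22 := h2 2
    fin_cases i <;> simp [unperturbedField] <;> fun_prop
  have hint := intervalIntegral.integral_eq_sub_of_hasDerivAt hd (hcont.intervalIntegrable _ _)
  rw [intervalIntegral.integral_const_mul] at hint
  have hprim : at' s (pathPrimitive (fieldOp lam 0 P (unperturbedPath lam q))) i =
      ∫ x in (0 : ℝ)..s, unperturbedField lam (unperturbedFlow lam (q.2 * x) q.1) i := by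
    change primitive (fieldOp lam 0 P (unperturbedPath lam q) i) s = _
    rw [primitive_apply]
    refine intervalIntegral.integral_congr fun x hx => ?_
    rw [Set.uIcc_of_le s.2.1] at hx
    have hx' : x ∈ Set.Icc (0 : ℝ) 1 := ⟨hx.1, hx.2.trans s.2.2⟩
    rw [Set.IccExtend_of_mem _ _ hx', ← at'_apply, at'_fieldOp]
    simp [perturbedField]
  simp only [map_sub, map_smul, Pi.sub_apply, Pi.smul_apply, smul_eq_mul, hprim, hint,
    at'_constPath, at'_unperturbedPath, map_zero, Pi.zero_apply]
  have : unperturbedFlow lam (q.2 * 0) q.1 i = q.1 i := by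
    fin_cases i <;> simp [unperturbedFlow]
  rw [this]; ring

/-- The solution path depends on the initial point, on the duration and on `ε` in a strictly
differentiable way, near any unperturbed solution. -/
theorem exists_solutionMap (lam : ℝ) (P : Fin 3 → MvPolynomial (Fin 3) ℝ) (p : Space) (T : ℝ) :
    ∃ u : Space × ℝ × ℝ → PathSpace,
      (∃ u' : Space × ℝ × ℝ →L[ℝ] PathSpace, HasStrictFDerivAt u u' (p, T, 0)) ∧
      (∀ᶠ q in 𝓝 (p, T, (0 : ℝ)), IsSolutionPath lam P q (u q)) ∧
      ∀ᶠ q in 𝓝 (p, T), u (q.1, q.2, 0) = unperturbedPath lam q := by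
  -- The solution paths are the zeros of F, the defect in the integral equation rescaled to [0, 1];
  -- the duration becomes an ordinary parameter.
  let F : (Space × ℝ × ℝ) × PathSpace → PathSpace := fun w =>
    w.2 - constPath w.1.1 - (w.1.2.1 : ℝ) • pathPrimitive (fieldOp lam w.1.2.2 P w.2)
  have hF : ContDiff ℝ 1 F := by
    have hp : ContDiff ℝ 1 fun w : (Space × ℝ × ℝ) × PathSpace => w.1.1 := by fun_prop
    have hT : ContDiff ℝ 1 fun w : (Space × ℝ × ℝ) × PathSpace => w.1.2.1 := by fun_prop
    have hε : ContDiff ℝ 1 fun w : (Space × ℝ × ℝ) × PathSpace => w.1.2.2 := by fun_prop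
    have hfield : ContDiff ℝ 1 fun w : (Space × ℝ × ℝ) × PathSpace =>
        fieldOp lam w.1.2.2 P w.2 := by
      refine ((contDiff_unperturbedOp lam).comp contDiff_snd).add
        (hε.smul (contDiff_pi.2 fun i => (contDiff_aeval (P i)).comp contDiff_snd))
    refine (contDiff_snd.sub (constPath.contDiff.comp hp)).sub ?_
    exact hT.smul (pathPrimitive.contDiff.comp hfield)
  let u₀ := unperturbedPath lam (p, T)
  have hF0 : F ((p, T, 0), u₀) = 0 := isSolutionPath_unperturbedPath lam P (p, T)
  let V : PathSpace →L[ℝ] PathSpace := T • pathPrimitive.comp (unperturbedOpDeriv lam u₀)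
  -- At ε = 0 the perturbation drops out of the derivative in the path, leaving the identity minus a
  -- Volterra operator.
  have hpart : fderiv ℝ F ((p, T, 0), u₀) ∘L .inr ℝ (Space × ℝ × ℝ) PathSpace = 1 - V := by
    have h1 := ((hF.differentiable one_ne_zero) ((p, T, 0), u₀)).hasFDerivAt
    have h2 := h1.comp u₀ (hasFDerivAt_prodMk_right (𝕜 := ℝ) (p, T, (0 : ℝ)) u₀)
    have h3 : HasFDerivAt (fun u : PathSpace => F ((p, T, 0), u)) (1 - V) u₀ := by
      have e : (fun u : PathSpace => F ((p, T, 0), u)) = fun u =>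
          u - constPath p - T • pathPrimitive (unperturbedOp lam u) := by
        funext u; simp [F, fieldOp]
      rw [e]
      refine ((hasFDerivAt_id u₀).sub_const _).sub ?_
      exact (pathPrimitive.hasFDerivAt.comp u₀ (hasFDerivAt_unperturbedOp lam u₀)).const_smul T
    exact h2.unique h3
  have hunit : IsUnit (1 - V) := by
    refine isUnit_one_sub_of_volterra (K := |T| * (1 + |lam| * (4 * ‖u₀‖ + 1)))
      fun h C n hC s => ?_
    have hb : ∀ x, ‖at' x (unperturbedOpDeriv lam u₀ h)‖ ≤
        ((1 + |lam| * (4 * ‖u₀‖ + 1)) * C) * (x : ℝ) ^ n := fun x => by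
      refine (norm_at'_unperturbedOpDeriv_le lam u₀ h x).trans ?_
      rw [mul_assoc]
      exact mul_le_mul_of_nonneg_left (hC x) (by positivity)
    have := norm_at'_pathPrimitive_le hb s
    have e : at' s (V h) = T • at' s (pathPrimitive (unperturbedOpDeriv lam u₀ h)) := rfl
    rw [e, norm_smul, Real.norm_eq_abs]
    refine (mul_le_mul_of_nonneg_left this (abs_nonneg T)).trans (le_of_eq ?_)
    ring
  have hinv : (fderiv ℝ F ((p, T, 0), u₀) ∘L .inr ℝ (Space × ℝ × ℝ) PathSpace).IsInvertible := by
    rw [hpart]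
    obtain ⟨e, he⟩ := hunit
    exact ⟨ContinuousLinearEquiv.ofUnit e, he⟩
  have hc : ContDiffAt ℝ 1 F ((p, T, 0), u₀) := hF.contDiffAt
  refine ⟨hc.implicitFunction one_ne_zero hinv,
    ⟨_, hc.hasStrictFDerivAt_implicitFunction one_ne_zero hinv⟩, ?_, ?_⟩
  · have := hc.eventually_apply_implicitFunction one_ne_zero hinv
    rw [hF0] at this
    exact this
  -- Local uniqueness in the implicit function theorem identifies the solution for ε = 0 with the
  -- explicit flow.
  · have h1 := hc.eventually_apply_eq_iff_implicitFunction one_ne_zero hinv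
    rw [hF0] at h1
    have h2 : Tendsto (fun q : Space × ℝ => ((q.1, q.2, (0 : ℝ)), unperturbedPath lam q))
        (𝓝 (p, T)) (𝓝 ((p, T, 0), u₀)) :=
      (Continuous.prodMk (by fun_prop) (continuous_unperturbedPath lam)).tendsto' _ _ rfl
    filter_upwards [h2.eventually h1] with q hq
    exact hq.1 (isSolutionPath_unperturbedPath lam P q)

/-! ### Hyperbolic fixed points and their isolation -/

theorem ContinuousLinearMap.isInvertible_of_injective_of_finrank_eq {E F : Type*}
    [NormedAddCommGroup E] [NormedSpace ℝ E] [FiniteDimensional ℝ E]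
    [NormedAddCommGroup F] [NormedSpace ℝ F] [FiniteDimensional ℝ F]
    (f : E →L[ℝ] F) (hf : ∀ x, f x = 0 → x = 0)
    (hd : Module.finrank ℝ E = Module.finrank ℝ F) : f.IsInvertible := by
  have hinj : Function.Injective (f : E →ₗ[ℝ] F) := (injective_iff_map_eq_zero _).2 hf
  refine ⟨(LinearMap.linearEquivOfInjective (f : E →ₗ[ℝ] F) hinj hd).toContinuousLinearEquiv, ?_⟩
  ext x
  simp

/-- A strictly differentiable function of `(v, ε)` is, uniformly in `ε`, approximated by its
derivative in the first two variables. -/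
theorem HasStrictFDerivAt.eventually_abs_sub_le {a : ℝ × ℝ × ℝ → ℝ} {a' : ℝ × ℝ × ℝ →L[ℝ] ℝ}
    {x : ℝ × ℝ} (ha : HasStrictFDerivAt a a' (x.1, x.2, 0)) {η : ℝ} (hη : 0 < η) :
    ∃ N ∈ 𝓝 x, ∀ᶠ ε in 𝓝 (0 : ℝ), ∀ v ∈ N, ∀ w ∈ N,
      |a (v.1, v.2, ε) - a (w.1, w.2, ε) - (a' (1, 0, 0) * (v.1 - w.1) + a' (0, 1, 0) * (v.2 - w.2))|
        ≤ η * (|v.1 - w.1| + |v.2 - w.2|) := by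
  have h := ha.isLittleO.def hη
  have ht : Tendsto (fun q : (ℝ × ℝ × ℝ) × (ℝ × ℝ × ℝ) => q) (𝓝 ((x.1, x.2, 0), (x.1, x.2, 0)))
      (𝓝 ((x.1, x.2, 0), (x.1, x.2, 0))) := tendsto_id
  -- Strict differentiability controls all pairs near the base point. Pairs with the same ε suffice,
  -- and for them the ε-component of the derivative plays no role.
  have hc : Tendsto (fun q : ((ℝ × ℝ) × (ℝ × ℝ)) × ℝ =>
      (((q.1.1.1, q.1.1.2, q.2), (q.1.2.1, q.1.2.2, q.2)) : (ℝ × ℝ × ℝ) × (ℝ × ℝ × ℝ)))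
      (𝓝 ((x, x), 0)) (𝓝 ((x.1, x.2, 0), (x.1, x.2, 0))) :=
    Continuous.tendsto' (by fun_prop) _ _ rfl
  have h1 := hc.eventually h
  rw [nhds_prod_eq, nhds_prod_eq, eventually_prod_iff] at h1
  obtain ⟨p, hp, q, hq, hpq⟩ := h1
  obtain ⟨N, hN, hN'⟩ := mem_prod_self_iff.1 hp
  refine ⟨N, hN, ?_⟩
  filter_upwards [hq] with ε hε v hv w hw
  have h2 := hpq (@hN' (v, w) ⟨hv, hw⟩) hε
  have e : a' ((v.1, v.2, ε) - (w.1, w.2, ε)) =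
      a' (1, 0, 0) * (v.1 - w.1) + a' (0, 1, 0) * (v.2 - w.2) := by
    have : ((v.1, v.2, ε) - (w.1, w.2, ε) : ℝ × ℝ × ℝ) =
        (v.1 - w.1) • (1, 0, 0) + (v.2 - w.2) • (0, 1, 0) := by simp
    rw [this, map_add, map_smul, map_smul]
    simp [mul_comm]
  rw [e] at h2
  refine h2.trans (mul_le_mul_of_nonneg_left ?_ hη.le)
  simp only [Prod.mk_sub_mk, sub_self, Prod.norm_mk, Real.norm_eq_abs, abs_zero]
  have := abs_nonneg (v.1 - w.1)
  have := abs_nonneg (v.2 - w.2)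
  refine max_le (by linarith) (max_le (by linarith) (by positivity))

/-- A periodic sequence for which the differences to a fixed sequence satisfy an approximately
diagonal linear recursion with multipliers `1 + ε α` and `μ` vanishes. -/
theorem eq_zero_of_periodic_of_recursion {x y : ℕ → ℝ} {n : ℕ} (hn : 0 < n)
    (hx : Function.Periodic x n) (hy : Function.Periodic y n)
    {ε α β μ η : ℝ} (hε : ε ≠ 0) (hεα : |ε * α| ≤ 1) (hμ0 : 0 ≤ μ) (hη : 0 < η)
    (hημ : η ≤ |μ - 1| / 2) (hηα : (|β| + η) * (2 * η) + |μ - 1| * η < |μ - 1| * |α|)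
    (hrx : ∀ i, |x (i + 1) - x i - ε * (α * x i + β * y i)| ≤ |ε| * (η * (|x i| + |y i|)))
    (hry : ∀ i, |y (i + 1) - μ * y i| ≤ η * (|x i| + |y i|)) : ∀ i, x i = 0 ∧ y i = 0 := by
  have hmax : ∀ z : ℕ → ℝ, Function.Periodic z n → ∃ j, ∀ i, |z i| ≤ |z j| := by
    intro z hz
    obtain ⟨j, -, hj⟩ := Finset.exists_max_image (Finset.range n) (fun i => |z i|)
      ⟨0, Finset.mem_range.2 hn⟩
    refine ⟨j, fun i => ?_⟩
    rw [← hz.map_mod_nat i]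
    exact hj _ (Finset.mem_range.2 (Nat.mod_lt _ hn))
  have hpred : ∀ z : ℕ → ℝ, Function.Periodic z n → ∀ j, ∃ i, z (i + 1) = z j := by
    intro z hz j
    refine ⟨j + n - 1, ?_⟩
    rw [show j + n - 1 + 1 = j + n by omega]
    exact hz j
  obtain ⟨j, hj⟩ := hmax x hx
  obtain ⟨k, hk⟩ := hmax y hy
  set X := |x j|
  set Y := |y k|
  have hX : 0 ≤ X := abs_nonneg _
  have hY : 0 ≤ Y := abs_nonneg _
  have hsum : ∀ i, η * (|x i| + |y i|) ≤ η * (X + Y) := fun i =>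
    mul_le_mul_of_nonneg_left (add_le_add (hj i) (hk i)) hη.le
  -- For μ ≥ 1 the successor of a largest term would exceed the maximum, and for μ ≤ 1 its
  -- predecessor would, unless the error makes up for the factor. The same argument applies to x
  -- with multiplier 1 + εα.
  have hYb : |μ - 1| * Y ≤ η * (X + Y) := by
    rcases le_total 1 μ with h | h
    · rw [abs_of_nonneg (by linarith)]
      have h1 := (hry k).trans (hsum k)
      have h2 := hk (k + 1)
      have h3 : |μ * y k| = μ * Y := by rw [abs_mul, abs_of_nonneg hμ0]
      have h4 := abs_sub_abs_le_abs_sub (μ * y k) (y (k + 1))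
      rw [abs_sub_comm] at h4
      linarith
    · rw [abs_of_nonpos (by linarith)]
      obtain ⟨i, hi⟩ := hpred y hy k
      have h1 := (hry i).trans (hsum i)
      rw [hi] at h1
      have h3 : |μ * y i| ≤ μ * Y := by
        rw [abs_mul, abs_of_nonneg hμ0]; exact mul_le_mul_of_nonneg_left (hk i) hμ0
      have h4 := abs_sub_abs_le_abs_sub (y k) (μ * y i)
      linarith
  have hXb : |ε * α| * X ≤ |ε| * (|β| * Y + η * (X + Y)) := by
    have hrem : ∀ i, |x (i + 1) - (1 + ε * α) * x i| ≤ |ε| * (|β| * Y + η * (X + Y)) := by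
      intro i
      have e : x (i + 1) - (1 + ε * α) * x i =
          (x (i + 1) - x i - ε * (α * x i + β * y i)) + ε * (β * y i) := by ring
      rw [e]
      refine (abs_add_le _ _).trans ?_
      have h1 := hrx i
      have h2 : |ε * (β * y i)| ≤ |ε| * (|β| * Y) := by
        rw [abs_mul, abs_mul]
        gcongr
        exact hk i
      have h3 := mul_le_mul_of_nonneg_left (hsum i) (abs_nonneg ε)
      linarith
    have hb := abs_le.1 hεα
    rcases le_total 0 (ε * α) with h | h
    · rw [abs_of_nonneg h]
      have h1 := hrem j
      have h2 := hj (j + 1)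
      have h3 : |(1 + ε * α) * x j| = (1 + ε * α) * X := by
        rw [abs_mul, abs_of_nonneg (by linarith)]
      have h4 := abs_sub_abs_le_abs_sub ((1 + ε * α) * x j) (x (j + 1))
      rw [abs_sub_comm] at h4
      linarith
    · rw [abs_of_nonpos h]
      obtain ⟨i, hi⟩ := hpred x hx j
      have h1 := hrem i
      rw [hi] at h1
      have h3 : |(1 + ε * α) * x i| ≤ (1 + ε * α) * X := by
        rw [abs_mul, abs_of_nonneg (by linarith)]
        exact mul_le_mul_of_nonneg_left (hj i) (by linarith)
      have h4 := abs_sub_abs_le_abs_sub (x j) ((1 + ε * α) * x i)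
      linarith
  rw [abs_mul, mul_assoc] at hXb
  -- The factor |ε| cancels, so the smallness required of η does not depend on ε.
  have hXb' : |α| * X ≤ |β| * Y + η * (X + Y) := le_of_mul_le_mul_left hXb (abs_pos.2 hε)
  have hYX : |μ - 1| * Y ≤ 2 * η * X := by nlinarith
  have hX0 : X = 0 := by
    by_contra hne
    have hXpos : 0 < X := lt_of_le_of_ne hX (Ne.symm hne)
    have h1 := mul_le_mul_of_nonneg_left hXb' (abs_nonneg (μ - 1))
    have h2 := mul_le_mul_of_nonneg_left hYX (add_nonneg (abs_nonneg β) hη.le)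
    have h3 := mul_lt_mul_of_pos_right hηα hXpos
    nlinarith
  have hY0 : Y = 0 := by
    rw [hX0, mul_zero] at hYX
    have : 0 < |μ - 1| := by linarith
    nlinarith
  intro i
  exact ⟨abs_nonpos_iff.1 ((hj i).trans hX0.le), abs_nonpos_iff.1 ((hk i).trans hY0.le)⟩

/-- The maps `(ρ, σ) ↦ (ρ + ε a(ρ, σ, ε), b(ρ, σ, ε))`, where `a` has a simple zero and `b` is
hyperbolic in the second variable, have for small `ε` a fixed point near the zero of `a`, and no
other periodic orbit in a neighbourhood independent of `ε`. -/
theorem exists_fixedPoint_of_hyperbolic {a b : ℝ × ℝ × ℝ → ℝ} {a' b' : ℝ × ℝ × ℝ →L[ℝ] ℝ} {ρ μ : ℝ}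
    (ha : HasStrictFDerivAt a a' (ρ, 0, 0)) (hb : HasStrictFDerivAt b b' (ρ, 0, 0))
    (ha0 : a (ρ, 0, 0) = 0) (hb0 : b (ρ, 0, 0) = 0) (ha1 : a' (1, 0, 0) ≠ 0)
    (hb1 : b' (1, 0, 0) = 0) (hb2 : b' (0, 1, 0) = μ) (hμ0 : 0 ≤ μ) (hμ1 : μ ≠ 1) :
    ∃ w : ℝ → ℝ × ℝ, Tendsto w (𝓝 0) (𝓝 (ρ, 0)) ∧
      (∀ᶠ ε in 𝓝 0, a ((w ε).1, (w ε).2, ε) = 0 ∧ b ((w ε).1, (w ε).2, ε) = (w ε).2) ∧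
      ∃ N ∈ 𝓝 ((ρ, 0) : ℝ × ℝ), ∀ᶠ ε in 𝓝[≠] (0 : ℝ), ∀ (v : ℕ → ℝ × ℝ) (n : ℕ), 0 < n →
        (∀ i, v i ∈ N) → v n = v 0 →
        (∀ i, v (i + 1) = ((v i).1 + ε * a ((v i).1, (v i).2, ε), b ((v i).1, (v i).2, ε))) →
        ∀ i, v i = w ε := by
  -- The first fixed-point equation is divided by ε; otherwise it would be degenerate at ε = 0.
  let H : ℝ × (ℝ × ℝ) → ℝ × ℝ := fun q =>
    (a (q.2.1, q.2.2, q.1), b (q.2.1, q.2.2, q.1) - q.2.2)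
  let σ : ℝ × (ℝ × ℝ) →L[ℝ] ℝ × ℝ × ℝ :=
    ((ContinuousLinearMap.fst ℝ ℝ ℝ).comp (.snd ℝ ℝ (ℝ × ℝ))).prod
      (((ContinuousLinearMap.snd ℝ ℝ ℝ).comp (.snd ℝ ℝ (ℝ × ℝ))).prod (.fst ℝ ℝ (ℝ × ℝ)))
  let s2 : ℝ × (ℝ × ℝ) →L[ℝ] ℝ := (ContinuousLinearMap.snd ℝ ℝ ℝ).comp (.snd ℝ ℝ (ℝ × ℝ))
  have hH : HasStrictFDerivAt H ((a'.comp σ).prod (b'.comp σ - s2)) (0, (ρ, 0)) := by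
    have hσ : HasStrictFDerivAt σ σ (0, (ρ, 0)) := σ.hasStrictFDerivAt
    exact (ha.comp (0, (ρ, 0)) hσ).prodMk ((hb.comp (0, (ρ, 0)) hσ).sub s2.hasStrictFDerivAt)
  have hlin : ∀ (c : ℝ × ℝ × ℝ →L[ℝ] ℝ) (x y : ℝ), c (x, y, 0) = x * c (1, 0, 0) + y * c (0, 1, 0) := by
    intro c x y
    have : ((x, y, 0) : ℝ × ℝ × ℝ) = x • (1, 0, 0) + y • (0, 1, 0) := by simp
    rw [this, map_add, map_smul, map_smul]; rfl
  -- This derivative is triangular because `b' (1, 0, 0) = 0`, with diagonal entries `a' (1, 0, 0)`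
  -- and μ - 1.
  have hinv : (((a'.comp σ).prod (b'.comp σ - s2)) ∘L .inr ℝ ℝ (ℝ × ℝ)).IsInvertible := by
    refine ContinuousLinearMap.isInvertible_of_injective_of_finrank_eq _ ?_ rfl
    rintro ⟨x, y⟩ hxy
    have h1 : a' (x, y, 0) = 0 := congrArg Prod.fst hxy
    have h2 : b' (x, y, 0) - y = 0 := congrArg Prod.snd hxy
    rw [hlin] at h1 h2
    rw [hb1, hb2] at h2
    have hy : y = 0 := by
      have : y * (μ - 1) = 0 := by linarith
      exact (mul_eq_zero.1 this).resolve_right (sub_ne_zero.2 hμ1)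
    rw [hy, zero_mul, add_zero] at h1
    rw [hy, (mul_eq_zero.1 h1).resolve_right ha1]
    rfl
  have hH0 : H (0, (ρ, 0)) = 0 := by simp [H, ha0, hb0]
  have hw := hH.eventually_apply_implicitFunctionOfProdDomain hinv
  have hwt := hH.tendsto_implicitFunctionOfProdDomain hinv
  set w := hH.implicitFunctionOfProdDomain hinv
  rw [hH0] at hw
  have hfix : ∀ᶠ ε in 𝓝 (0 : ℝ),
      a ((w ε).1, (w ε).2, ε) = 0 ∧ b ((w ε).1, (w ε).2, ε) = (w ε).2 := by
    filter_upwards [hw] with ε hε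
    exact ⟨congrArg Prod.fst hε, sub_eq_zero.1 (congrArg Prod.snd hε)⟩
  refine ⟨w, hwt, hfix, ?_⟩
  set α := a' (1, 0, 0)
  set β := a' (0, 1, 0)
  have hm : 0 < |μ - 1| := abs_pos.2 (sub_ne_zero.2 hμ1)
  have hα : 0 < |α| := abs_pos.2 ha1
  obtain ⟨η, hη, hη1, hη2⟩ : ∃ η : ℝ, 0 < η ∧ η ≤ |μ - 1| / 2 ∧
      (|β| + η) * (2 * η) + |μ - 1| * η < |μ - 1| * |α| := by
    have hc : Tendsto (fun η : ℝ => (|β| + η) * (2 * η) + |μ - 1| * η) (𝓝[>] 0) (𝓝 0) :=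
      (Continuous.tendsto' (by fun_prop) 0 0 (by simp)).mono_left nhdsWithin_le_nhds
    have h1 := hc.eventually (gt_mem_nhds (mul_pos hm hα))
    have h2 : ∀ᶠ η in 𝓝[>] (0 : ℝ), η ≤ |μ - 1| / 2 :=
      nhdsWithin_le_nhds (ge_mem_nhds (by positivity))
    obtain ⟨η, ⟨h1, h2⟩, h3⟩ := ((h1.and h2).and self_mem_nhdsWithin).exists
    exact ⟨η, h3, h2, h1⟩
  obtain ⟨N₁, hN₁, h₁⟩ := HasStrictFDerivAt.eventually_abs_sub_le (x := (ρ, 0)) ha hη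
  obtain ⟨N₂, hN₂, h₂⟩ := HasStrictFDerivAt.eventually_abs_sub_le (x := (ρ, 0)) hb hη
  refine ⟨N₁ ∩ N₂, inter_mem hN₁ hN₂, ?_⟩
  have hεα : ∀ᶠ ε in 𝓝 (0 : ℝ), |ε * α| ≤ 1 := by
    have : Tendsto (fun ε : ℝ => |ε * α|) (𝓝 0) (𝓝 0) :=
      Continuous.tendsto' (by fun_prop) _ _ (by simp)
    exact this.eventually (ge_mem_nhds one_pos)
  have hwN := hwt.eventually (inter_mem hN₁ hN₂)
  filter_upwards [nhdsWithin_le_nhds h₁, nhdsWithin_le_nhds h₂, nhdsWithin_le_nhds hfix,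
    nhdsWithin_le_nhds hεα, nhdsWithin_le_nhds hwN, self_mem_nhdsWithin]
    with ε h₁ h₂ hfix hεα hwN hε v n hn hv hvn hrec
  have hper : Function.Periodic v n := by
    intro i
    induction i with
    | zero => simpa using hvn
    | succ i ih => rw [show i + 1 + n = i + n + 1 by ring, hrec, ih, hrec]
  have key := eq_zero_of_periodic_of_recursion (x := fun i => (v i).1 - (w ε).1)
    (y := fun i => (v i).2 - (w ε).2) hn (fun i => by simp [hper i]) (fun i => by simp [hper i])
    (ε := ε) (α := α) (β := β) (μ := μ) hε hεα hμ0 hη hη1 hη2 ?_ ?_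
  · intro i
    exact Prod.ext (sub_eq_zero.1 (key i).1) (sub_eq_zero.1 (key i).2)
  · intro i
    have h := h₁ (v i) (hv i).1 (w ε) hwN.1
    rw [hfix.1, sub_zero] at h
    have e : (v (i + 1)).1 - (w ε).1 - ((v i).1 - (w ε).1) -
        ε * (α * ((v i).1 - (w ε).1) + β * ((v i).2 - (w ε).2)) =
        ε * (a ((v i).1, (v i).2, ε) - (α * ((v i).1 - (w ε).1) + β * ((v i).2 - (w ε).2))) := by
      rw [hrec i]; ring
    simp only [e, abs_mul]
    exact mul_le_mul_of_nonneg_left h (abs_nonneg ε)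
  · intro i
    have h := h₂ (v i) (hv i).2 (w ε) hwN.2
    rw [hfix.2, hb1, hb2, zero_mul, zero_add] at h
    simpa [hrec i] using h

/-! ### Trajectories of the piecewise field near crossing points -/

theorem HasDerivWithinAt.lieDeriv {X : Space → Space} {f : Space → ℝ} {γ : ℝ → Space} {s : Set ℝ}
    {t : ℝ} (h : HasDerivWithinAt γ (X (γ t)) s t) (hf : Differentiable ℝ f) :
    HasDerivWithinAt (fun t => f (γ t)) (_root_.lieDeriv X f (γ t)) s t :=
  (hf (γ t)).hasFDerivAt.comp_hasDerivWithinAt t h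

theorem HasDerivWithinAt.eventually_pos_right {g : ℝ → ℝ} {g' a : ℝ}
    (h : HasDerivWithinAt g g' (Set.Ici a) a) (h0 : g a = 0) (hg' : 0 < g') :
    ∀ᶠ t in 𝓝[>] a, 0 < g t := by
  have h1 := hasDerivWithinAt_iff_tendsto_slope.1 h
  rw [Set.Ici_sdiff_left] at h1
  filter_upwards [h1.eventually (lt_mem_nhds hg'), self_mem_nhdsWithin] with t ht hta
  rw [slope_def_field, h0, sub_zero] at ht
  exact (div_pos_iff_of_pos_right (sub_pos.2 hta)).1 ht

theorem HasDerivWithinAt.eventually_neg_left {g : ℝ → ℝ} {g' a : ℝ}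
    (h : HasDerivWithinAt g g' (Set.Iic a) a) (h0 : g a = 0) (hg' : 0 < g') :
    ∀ᶠ t in 𝓝[<] a, g t < 0 := by
  have h1 := hasDerivWithinAt_iff_tendsto_slope.1 h
  rw [Set.Iic_sdiff_right] at h1
  filter_upwards [h1.eventually (lt_mem_nhds hg'), self_mem_nhdsWithin] with t ht hta
  rw [slope_def_field, h0, sub_zero] at ht
  have hta' : t - a < 0 := sub_neg.2 hta
  rcases div_pos_iff.1 ht with h | h
  · linarith [h.2]
  · exact h.1

/-- Two curves that follow a `C¹` field to the right of a point where they meet agree to the right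
of this point. -/
theorem eventually_eq_right_of_hasDerivWithinAt {X : Space → Space} (hX : ContDiff ℝ 1 X)
    {g h : ℝ → Space} {a : ℝ} (hga : g a = h a)
    (hg : ∀ᶠ t in 𝓝[≥] a, HasDerivWithinAt g (X (g t)) (Set.Ici t) t ∧ ContinuousAt g t)
    (hh : ∀ᶠ t in 𝓝[≥] a, HasDerivWithinAt h (X (h t)) (Set.Ici t) t ∧ ContinuousAt h t) :
    ∀ᶠ t in 𝓝[≥] a, g t = h t := by
  obtain ⟨K, s, hs, hK⟩ := hX.contDiffAt.exists_lipschitzOnWith (x := g a)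
  have ca : ContinuousAt g a := (hg.self_of_nhdsWithin Set.self_mem_Ici).2
  have cb : ContinuousAt h a := (hh.self_of_nhdsWithin Set.self_mem_Ici).2
  have h1 : ∀ᶠ t in 𝓝[≥] a, g t ∈ s := nhdsWithin_le_nhds (ca.eventually hs)
  have h2 : ∀ᶠ t in 𝓝[≥] a, h t ∈ s := nhdsWithin_le_nhds (cb.eventually (hga ▸ hs))
  obtain ⟨b, hb, hall⟩ := (mem_nhdsGE_iff_exists_Icc_subset).1 (((hg.and hh).and h1).and h2)
  refine (mem_nhdsGE_iff_exists_Icc_subset).2 ⟨b, hb, ?_⟩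
  have hI : Set.Ico a b ⊆ Set.Icc a b := Set.Ico_subset_Icc_self
  exact ODE_solution_unique_of_mem_Icc_right (v := fun _ => X) (s := fun _ => s) (K := K)
    (fun _ _ => hK) (fun t ht => (hall ht).1.1.1.2.continuousWithinAt)
    (fun t ht => (hall (hI ht)).1.1.1.1) (fun t ht => (hall (hI ht)).1.2)
    (fun t ht => (hall ht).1.1.2.2.continuousWithinAt)
    (fun t ht => (hall (hI ht)).1.1.2.1) (fun t ht => (hall (hI ht)).2) hga

/-- A curve that follows `X` on `[0, T]` and stays in `f > 0` on `(0, T)`. -/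
structure IsArc (X : Space → Space) (f : Space → ℝ) (T : ℝ) (γ : ℝ → Space) : Prop where
  pos : 0 < T
  deriv : ∀ t ∈ Set.Icc 0 T, HasDerivAt γ (X (γ t)) t
  sign : ∀ t ∈ Set.Ioo 0 T, 0 < f (γ t)

namespace PiecewiseField

/-- The same piecewise smooth field, with the opposite switching function. -/
def swap (Z : PiecewiseField) : PiecewiseField where
  f := fun p => -Z.f p
  Xp := Z.Xm
  Xm := Z.Xp

theorem lieDeriv_neg (X : Space → Space) (f : Space → ℝ) (p : Space) :
    lieDeriv X (fun p => -f p) p = -lieDeriv X f p := by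
  simp [lieDeriv]

variable {Z : PiecewiseField} {γ : ℝ → Space}

theorem crossesUp_swap {p : Space} : Z.swap.CrossesUp p ↔ Z.CrossesDown p := by
  simp only [CrossesUp, CrossesDown, swap, lieDeriv_neg, neg_eq_zero, Left.neg_pos_iff]
  tauto

theorem crossesDown_swap {p : Space} : Z.swap.CrossesDown p ↔ Z.CrossesUp p := by
  simp only [CrossesUp, CrossesDown, swap, lieDeriv_neg, neg_eq_zero, Left.neg_neg_iff]
  tauto

/-- By this symmetry, statements about upward crossings and `Xp` also serve for downward crossings
and `Xm`. -/
theorem IsTrajectory.swap (h : Z.IsTrajectory γ) : Z.swap.IsTrajectory γ where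
  continuous := h.continuous
  pos t ht := h.neg t (neg_pos.1 ht)
  neg t ht := h.pos t (neg_lt_zero.1 ht)
  up t ht := h.down t (crossesUp_swap.1 ht)
  down t ht := h.up t (crossesDown_swap.1 ht)

theorem CrossesUp.not_crossesDown {p : Space} (h : Z.CrossesUp p) : ¬ Z.CrossesDown p :=
  fun h' => lt_asymm h.2.1 h'.2.1

theorem IsTrajectory.eventually_pos_of_crossesUp (h : Z.IsTrajectory γ)
    (hf : Differentiable ℝ Z.f) {t : ℝ} (ht : Z.CrossesUp (γ t)) :
    ∀ᶠ s in 𝓝[>] t, 0 < Z.f (γ s) :=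
  ((h.up t ht).2.lieDeriv hf).eventually_pos_right ht.1 ht.2.1

theorem IsTrajectory.eventually_neg_of_crossesUp (h : Z.IsTrajectory γ)
    (hf : Differentiable ℝ Z.f) {t : ℝ} (ht : Z.CrossesUp (γ t)) :
    ∀ᶠ s in 𝓝[<] t, Z.f (γ s) < 0 :=
  ((h.up t ht).1.lieDeriv hf).eventually_neg_left ht.1 ht.2.2

/-- A trajectory follows the arc of `Xp` that starts where it crosses towards `f > 0`. -/
theorem IsTrajectory.eq_arc_of_crossesUp (h : Z.IsTrajectory γ) (hf : Differentiable ℝ Z.f)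
    (hX : ContDiff ℝ 1 Z.Xp) {t₀ T : ℝ} (ht₀ : Z.CrossesUp (γ t₀)) {g : ℝ → Space}
    (hg : IsArc Z.Xp Z.f T g) (hg0 : g 0 = γ t₀) : ∀ t ∈ Set.Icc 0 T, γ (t₀ + t) = g t := by
  let s : Set ℝ := {t | γ (t₀ + t) - g t = 0}
  have hγc : Continuous fun t => γ (t₀ + t) := h.continuous.comp (by fun_prop)
  have hgc : ContinuousOn g (Set.Icc 0 T) :=
    fun t ht => (hg.deriv t ht).continuousAt.continuousWithinAt
  have hclosed : IsClosed (s ∩ Set.Icc 0 T) := by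
    have := (hγc.continuousOn.sub hgc).preimage_isClosed_of_isClosed isClosed_Icc
      (isClosed_singleton (x := (0 : Space)))
    rwa [Set.inter_comm] at this
  have hshift : ∀ t v A, HasDerivWithinAt γ v (Set.Ici (t₀ + t)) (t₀ + t) → A = Set.Ici t →
      HasDerivWithinAt (fun t => γ (t₀ + t)) v A t := by
    rintro t v A hv rfl
    have := hv.scomp t (((hasDerivAt_id t).const_add t₀).hasDerivWithinAt (s := Set.Ici t))
      (fun x hx => by simpa using hx)
    simpa [Function.comp_def] using this
  -- Continuous induction: the set of agreement is closed, and local uniqueness prolongs it to the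
  -- right of each of its points before T.
  have hsub : Set.Icc 0 T ⊆ s := by
    refine hclosed.Icc_subset_of_forall_exists_gt (by simp [s, hg0]) fun x hx y hy => ?_
    have hx1 : γ (t₀ + x) = g x := sub_eq_zero.1 hx.1
    have hpos : ∀ᶠ t in 𝓝[≥] x,
        HasDerivWithinAt (fun t => γ (t₀ + t)) (Z.Xp (γ (t₀ + t))) (Set.Ici t) t := by
      have hpos' : ∀ t, 0 < Z.f (γ (t₀ + t)) →
          HasDerivWithinAt (fun t => γ (t₀ + t)) (Z.Xp (γ (t₀ + t))) (Set.Ici t) t :=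
        fun t ht => hshift t _ _ (h.pos _ ht).hasDerivWithinAt rfl
      -- At time 0 the curve lies on the switching manifold, and the right velocity comes from the
      -- crossing rule. At later times it agrees with the arc and so lies in f > 0.
      rcases hx.2.1.eq_or_lt with h0 | h0
      · subst h0
        rw [← Set.Ioi_insert, nhdsWithin_insert, eventually_sup]
        refine ⟨?_, ?_⟩
        · rw [eventually_pure]
          refine hshift 0 _ _ ?_ rfl
          rw [add_zero]; exact (h.up t₀ ht₀).2
        · have h1 := h.eventually_pos_of_crossesUp hf ht₀
          have h2 : Tendsto (fun t => t₀ + t) (𝓝[>] 0) (𝓝[>] t₀) := by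
            refine tendsto_nhdsWithin_iff.2 ⟨?_, ?_⟩
            · exact (Continuous.tendsto' (by fun_prop) _ _ (by simp)).mono_left nhdsWithin_le_nhds
            · filter_upwards [self_mem_nhdsWithin] with t ht
              simpa using ht
          exact (h2.eventually h1).mono hpos'
      · have h1 : 0 < Z.f (γ (t₀ + x)) := hx1 ▸ hg.sign x ⟨h0, hx.2.2⟩
        have h2 := (hf.continuous.comp hγc).continuousAt.eventually (lt_mem_nhds h1)
        exact nhdsWithin_le_nhds (h2.mono hpos')
    have hgx : ∀ᶠ t in 𝓝[≥] x, HasDerivWithinAt g (Z.Xp (g t)) (Set.Ici t) t ∧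
        ContinuousAt g t := by
      have : ∀ᶠ t in 𝓝[≥] x, t < T := nhdsWithin_le_nhds (gt_mem_nhds hx.2.2)
      filter_upwards [this, self_mem_nhdsWithin] with t ht1 ht2
      have := hg.deriv t ⟨hx.2.1.trans ht2, ht1.le⟩
      exact ⟨this.hasDerivWithinAt, this.continuousAt⟩
    have heq := eventually_eq_right_of_hasDerivWithinAt hX (g := fun t => γ (t₀ + t)) hx1
      (hpos.mono fun t ht => ⟨ht, hγc.continuousAt⟩) hgx
    have heq' : ∀ᶠ t in 𝓝[>] x, γ (t₀ + t) = g t :=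
      heq.filter_mono (nhdsWithin_mono x Set.Ioi_subset_Ici_self)
    have hy' : ∀ᶠ t in 𝓝[>] x, t ∈ Set.Ioc x y := Ioc_mem_nhdsGT hy
    obtain ⟨t, ht1, ht2⟩ := (heq'.and hy').exists
    exact ⟨t, sub_eq_zero.2 ht1, ht2⟩
  exact fun t ht => sub_eq_zero.1 (hsub ht)

/-- A trajectory follows the arc of `Xm` that starts where it crosses towards `f < 0`. -/
theorem IsTrajectory.eq_arc_of_crossesDown (h : Z.IsTrajectory γ) (hf : Differentiable ℝ Z.f)
    (hX : ContDiff ℝ 1 Z.Xm) {t₀ T : ℝ} (ht₀ : Z.CrossesDown (γ t₀)) {g : ℝ → Space}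
    (hg : IsArc Z.Xm (fun p => -Z.f p) T g) (hg0 : g 0 = γ t₀) :
    ∀ t ∈ Set.Icc 0 T, γ (t₀ + t) = g t :=
  h.swap.eq_arc_of_crossesUp hf.neg hX (crossesUp_swap.2 ht₀) hg hg0

/-- A continuous periodic function that is positive just before each of its zeros and takes
negative values just after them has no zero. -/
theorem _root_.Function.Periodic.ne_zero_of_decreasing_at_zeros {g : ℝ → ℝ} {T : ℝ}
    (hT : 0 < T) (hg : Function.Periodic g T) (hc : Continuous g)
    (hl : ∀ t, g t = 0 → ∀ᶠ s in 𝓝[<] t, 0 < g s)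
    (hr : ∀ t, g t = 0 → ∀ᶠ s in 𝓝[>] t, g s < 0) (t : ℝ) : g t ≠ 0 := by
  intro ht
  obtain ⟨a, ha1, ha2, ha3⟩ : ∃ a, g a < 0 ∧ t < a ∧ a < t + T := by
    have h2 : ∀ᶠ s in 𝓝[>] t, s ∈ Set.Ioo t (t + T) := Ioo_mem_nhdsGT (by linarith)
    obtain ⟨a, h, h'⟩ := ((hr t ht).and h2).exists
    exact ⟨a, h, h'.1, h'.2⟩
  let S : Set ℝ := Set.Icc a (t + T) ∩ g ⁻¹' {0}
  have hS : IsCompact S := isCompact_Icc.inter_right ((isClosed_singleton).preimage hc)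
  have hne : S.Nonempty := ⟨t + T, ⟨ha3.le, le_rfl⟩, by simp [hg t, ht]⟩
  obtain ⟨s, hs, hmin⟩ := hS.exists_isLeast hne
  have has : a < s := lt_of_le_of_ne hs.1.1 (by rintro rfl; exact ha1.ne hs.2)
  have h2 : ∀ᶠ x in 𝓝[<] s, x ∈ Set.Ioo a s := Ioo_mem_nhdsLT has
  obtain ⟨b, hb, hb'⟩ := ((hl s hs.2).and h2).exists
  obtain ⟨c, hc1, hc2⟩ := intermediate_value_Icc hb'.1.le hc.continuousOn ⟨ha1.le, hb.le⟩
  have := hmin ⟨⟨hc1.1, (hc1.2.trans hb'.2.le).trans hs.1.2⟩, hc2⟩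
  linarith [hc1.2, hb'.2]

/-- A curve that always rotates in the positive sense around the third axis and stays away from a
half-plane bounded by this axis is not periodic. -/
theorem _root_.Function.Periodic.false_of_rotation {X : Space → Space} {T : ℝ} (hT : 0 < T)
    (hper : Function.Periodic γ T) (hd : ∀ t, HasDerivAt γ (X (γ t)) t) (c : ℂ)
    (hslit : ∀ t, c * ⟨γ t 0, γ t 1⟩ ∈ Complex.slitPlane)
    (hrot : ∀ t, 0 < γ t 0 * X (γ t) 1 - γ t 1 * X (γ t) 0) : False := by
  let ζ : ℝ → ℂ := fun t => ⟨γ t 0, γ t 1⟩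
  have hζ : ∀ t, HasDerivAt ζ ⟨X (γ t) 0, X (γ t) 1⟩ t := by
    intro t
    have h0 := (hasDerivAt_pi.1 (hd t) 0).ofReal_comp
    have h1 := (hasDerivAt_pi.1 (hd t) 1).ofReal_comp
    have h2 := h0.add (h1.mul_const Complex.I)
    rw [← Complex.mk_eq_add_mul_I] at h2
    refine h2.congr_of_eventuallyEq (Eventually.of_forall fun s => ?_)
    simp [ζ, Complex.mk_eq_add_mul_I]
  have hV : ∀ t, HasDerivAt (fun t => (Complex.log (c * ζ t)).im)
      ((γ t 0 * X (γ t) 1 - γ t 1 * X (γ t) 0) / Complex.normSq (ζ t)) t := by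
    intro t
    have h1 := ((hζ t).const_mul c).clog_real (hslit t)
    have h2 := (Complex.imCLM.hasFDerivAt.comp_hasDerivAt t h1)
    have hne := Complex.slitPlane_ne_zero (hslit t)
    have hc : c ≠ 0 := left_ne_zero_of_mul hne
    refine h2.congr_deriv ?_
    rw [mul_div_mul_left _ _ hc]
    simp only [Complex.imCLM_apply, Complex.div_im, ζ]
    ring
  -- The derivative of the argument is (x y' - y x') / (x² + y²), positive by hypothesis. Off the
  -- slit the argument is single-valued, so it would be both strictly increasing and periodic.
  have hmono : StrictMono fun t => (Complex.log (c * ζ t)).im := by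
    refine strictMono_of_deriv_pos fun t => ?_
    rw [(hV t).deriv]
    refine div_pos (hrot t) (Complex.normSq_pos.2 ?_)
    exact right_ne_zero_of_mul (Complex.slitPlane_ne_zero (hslit t))
  have h := hmono (show (0 : ℝ) < 0 + T by linarith)
  have h' : ζ (0 + T) = ζ 0 := by simp only [ζ, hper 0]
  simp only [h'] at h
  exact lt_irrefl _ h

/-- A periodic trajectory that meets the switching manifold only at crossing points, and that
rotates around the third axis, crosses the switching manifold upwards. -/
theorem IsTrajectory.exists_crossesUp (h : Z.IsTrajectory γ) (hf : Differentiable ℝ Z.f)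
    {T : ℝ} (hT : 0 < T) (hper : Function.Periodic γ T)
    (hcross : ∀ t, Z.f (γ t) = 0 → Z.CrossesUp (γ t) ∨ Z.CrossesDown (γ t))
    (hslitp : ∀ t, Z.f (γ t) < 0 ∨ -Complex.I * ⟨γ t 0, γ t 1⟩ ∈ Complex.slitPlane)
    (hslitm : ∀ t, 0 < Z.f (γ t) ∨ Complex.I * ⟨γ t 0, γ t 1⟩ ∈ Complex.slitPlane)
    (hrotp : ∀ t, 0 < γ t 0 * Z.Xp (γ t) 1 - γ t 1 * Z.Xp (γ t) 0)
    (hrotm : ∀ t, 0 < γ t 0 * Z.Xm (γ t) 1 - γ t 1 * Z.Xm (γ t) 0) :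
    ∃ t, Z.CrossesUp (γ t) := by
  -- With downward crossings only, f could never return to zero along the periodic curve. The curve
  -- would stay in one zone, where rotation and the slit condition forbid periodicity.
  by_contra! hno
  have hdown : ∀ t, Z.f (γ t) = 0 → Z.CrossesDown (γ t) :=
    fun t ht => (hcross t ht).resolve_left (hno t)
  have hc : Continuous fun t => Z.f (γ t) := hf.continuous.comp h.continuous
  have hne := Function.Periodic.ne_zero_of_decreasing_at_zeros hT
    (g := fun t => Z.f (γ t)) (fun t => by simp only [hper t]) hc
    (fun t ht => by
      have := h.swap.eventually_neg_of_crossesUp hf.neg (crossesUp_swap.2 (hdown t ht))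
      exact this.mono fun s hs => neg_lt_zero.1 hs)
    (fun t ht => by
      have := h.swap.eventually_pos_of_crossesUp hf.neg (crossesUp_swap.2 (hdown t ht))
      exact this.mono fun s hs => neg_pos.1 hs)
  have hsign : (∀ t, 0 < Z.f (γ t)) ∨ ∀ t, Z.f (γ t) < 0 := by
    by_contra! hs
    obtain ⟨⟨a, ha⟩, ⟨b, hb⟩⟩ := hs
    obtain ⟨c, hc⟩ := mem_range_of_exists_le_of_exists_ge hc ⟨a, ha⟩ ⟨b, hb⟩
    exact hne c hc
  rcases hsign with hs | hs
  · exact hper.false_of_rotation hT (fun t => h.pos t (hs t)) (-Complex.I)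
      (fun t => (hslitp t).resolve_left (hs t).not_gt) hrotp
  · exact hper.false_of_rotation hT (fun t => h.neg t (hs t)) Complex.I
      (fun t => (hslitm t).resolve_left (hs t).not_gt) hrotm

end PiecewiseField

/-! ### Gluing arcs, and decomposing a periodic trajectory into loops -/

theorem HasDerivWithinAt.of_period {γ : ℝ → Space} {v : Space} {d t : ℝ} {A B : Set ℝ}
    (hd : ∀ t, γ (t + d) = γ t) (h : HasDerivWithinAt γ v A (t + d))
    (hAB : ∀ x ∈ B, x + d ∈ A) : HasDerivWithinAt γ v B t := by
  have h1 := h.scomp t (((hasDerivAt_id t).add_const d).hasDerivWithinAt (s := B)) hAB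
  rw [one_smul] at h1
  refine h1.congr (fun x _ => (hd x).symm) (hd t).symm

namespace PiecewiseField

variable {Z : PiecewiseField}

/-- An arc in `f > 0` and an arc in `f < 0` that close up at crossing points form a crossing
periodic orbit. -/
theorem isCrossingPeriodicOrbit_of_arcs {T₁ T₂ : ℝ} {γ₁ γ₂ : ℝ → Space}
    (h₁ : IsArc Z.Xp Z.f T₁ γ₁) (h₂ : IsArc Z.Xm (fun p => -Z.f p) T₂ γ₂) (h₁₂ : γ₁ T₁ = γ₂ 0)
    (h₂₁ : γ₂ T₂ = γ₁ 0) (hu : Z.CrossesUp (γ₁ 0)) (hd : Z.CrossesDown (γ₂ 0)) :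
    Z.IsCrossingPeriodicOrbit (γ₁ '' Set.Icc 0 T₁ ∪ γ₂ '' Set.Icc 0 T₂) := by
  have hT₁ := h₁.pos
  have hT₂ := h₂.pos
  have hT : 0 < T₁ + T₂ := add_pos hT₁ hT₂
  let γ : ℝ → Space := fun t =>
    if toIcoMod hT 0 t < T₁ then γ₁ (toIcoMod hT 0 t) else γ₂ (toIcoMod hT 0 t - T₁)
  have hper : Function.Periodic γ (T₁ + T₂) := fun t => by
    simp only [γ, toIcoMod_add_right]
  have hmod : ∀ t ∈ Set.Ico 0 (T₁ + T₂), toIcoMod hT 0 t = t := fun t ht =>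
    (toIcoMod_eq_self hT).2 (by simpa using ht)
  have hγ₁ : ∀ t ∈ Set.Icc 0 T₁, γ t = γ₁ t := by
    intro t ht
    have := hmod t ⟨ht.1, by linarith [ht.2]⟩
    rcases ht.2.lt_or_eq with h | h
    · simp only [γ, this, h, if_true]
    · subst h
      simp only [γ, this, lt_irrefl, if_false, sub_self, h₁₂]
  have hγ₂ : ∀ t ∈ Set.Icc T₁ (T₁ + T₂), γ t = γ₂ (t - T₁) := by
    intro t ht
    rcases ht.2.lt_or_eq with h | h
    · simp only [γ, hmod t ⟨hT₁.le.trans ht.1, h⟩, ht.1.not_gt, if_false]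
    · rw [h, add_sub_cancel_left, h₂₁, ← hγ₁ 0 ⟨le_rfl, hT₁.le⟩]
      simpa using hper 0
  have hγ0 : γ 0 = γ₁ 0 := hγ₁ 0 ⟨le_rfl, hT₁.le⟩
  have hγT₁ : γ T₁ = γ₂ 0 := by simpa using hγ₂ T₁ ⟨le_rfl, by linarith⟩
  have hR₁ : ∀ t ∈ Set.Ico 0 T₁, HasDerivWithinAt γ (Z.Xp (γ t)) (Set.Ici t) t := by
    intro t ht
    have hv := hγ₁ t ⟨ht.1, ht.2.le⟩
    rw [hv]
    refine (h₁.deriv t ⟨ht.1, ht.2.le⟩).hasDerivWithinAt.congr_of_eventuallyEq ?_ hv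
    filter_upwards [self_mem_nhdsWithin, nhdsWithin_le_nhds (gt_mem_nhds ht.2)] with s hs hs'
    exact hγ₁ s ⟨ht.1.trans hs, hs'.le⟩
  have hL₁ : ∀ t ∈ Set.Ioc 0 T₁, HasDerivWithinAt γ (Z.Xp (γ t)) (Set.Iic t) t := by
    intro t ht
    have hv := hγ₁ t ⟨ht.1.le, ht.2⟩
    rw [hv]
    refine (h₁.deriv t ⟨ht.1.le, ht.2⟩).hasDerivWithinAt.congr_of_eventuallyEq ?_ hv
    filter_upwards [self_mem_nhdsWithin, nhdsWithin_le_nhds (lt_mem_nhds ht.1)] with s hs hs'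
    exact hγ₁ s ⟨hs'.le, le_trans hs ht.2⟩
  have hshift : ∀ t ∈ Set.Icc T₁ (T₁ + T₂),
      HasDerivAt (fun s => γ₂ (s - T₁)) (Z.Xm (γ₂ (t - T₁))) t := by
    intro t ht
    have := (h₂.deriv (t - T₁) ⟨by linarith [ht.1], by linarith [ht.2]⟩).scomp t
      ((hasDerivAt_id t).sub_const T₁)
    rwa [one_smul] at this
  have hR₂ : ∀ t ∈ Set.Ico T₁ (T₁ + T₂), HasDerivWithinAt γ (Z.Xm (γ t)) (Set.Ici t) t := by
    intro t ht
    have hv := hγ₂ t ⟨ht.1, ht.2.le⟩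
    rw [hv]
    refine (hshift t ⟨ht.1, ht.2.le⟩).hasDerivWithinAt.congr_of_eventuallyEq ?_ hv
    filter_upwards [self_mem_nhdsWithin, nhdsWithin_le_nhds (gt_mem_nhds ht.2)] with s hs hs'
    exact hγ₂ s ⟨ht.1.trans hs, hs'.le⟩
  have hL₂ : ∀ t ∈ Set.Ioc T₁ (T₁ + T₂), HasDerivWithinAt γ (Z.Xm (γ t)) (Set.Iic t) t := by
    intro t ht
    have hv := hγ₂ t ⟨ht.1.le, ht.2⟩
    rw [hv]
    refine (hshift t ⟨ht.1.le, ht.2⟩).hasDerivWithinAt.congr_of_eventuallyEq ?_ hv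
    filter_upwards [self_mem_nhdsWithin, nhdsWithin_le_nhds (lt_mem_nhds ht.1)] with s hs hs'
    exact hγ₂ s ⟨hs'.le, le_trans hs ht.2⟩
  -- By periodicity, the left velocity at time 0 is the one at the end of the second arc.
  have hL0 : HasDerivWithinAt γ (Z.Xm (γ 0)) (Set.Iic 0) 0 := by
    have := hL₂ (0 + (T₁ + T₂)) ⟨by linarith, by linarith⟩
    rw [hper 0] at this
    exact this.of_period hper fun x hx => by simpa using hx
  -- Each time belongs to one of four types: interior of either arc, or one of the two junctions.
  -- The clauses defining a trajectory then follow by excluding the incompatible types.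
  have hbase : ∀ t ∈ Set.Ico 0 (T₁ + T₂), ∃ vl vr,
      HasDerivWithinAt γ vl (Set.Iic t) t ∧ HasDerivWithinAt γ vr (Set.Ici t) t ∧
      ((0 < Z.f (γ t) ∧ vl = Z.Xp (γ t) ∧ vr = Z.Xp (γ t)) ∨
       (Z.f (γ t) < 0 ∧ vl = Z.Xm (γ t) ∧ vr = Z.Xm (γ t)) ∨
       (γ t = γ₁ 0 ∧ Z.CrossesUp (γ t) ∧ vl = Z.Xm (γ t) ∧ vr = Z.Xp (γ t)) ∨
       (Z.CrossesDown (γ t) ∧ vl = Z.Xp (γ t) ∧ vr = Z.Xm (γ t))) := by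
    intro t ht
    rcases ht.1.eq_or_lt with h0 | h0
    · subst h0
      exact ⟨_, _, hL0, hR₁ 0 ⟨le_rfl, hT₁⟩, Or.inr (Or.inr (Or.inl ⟨hγ0, hγ0 ▸ hu, rfl, rfl⟩))⟩
    rcases lt_trichotomy t T₁ with h | h | h
    · refine ⟨_, _, hL₁ t ⟨h0, h.le⟩, hR₁ t ⟨h0.le, h⟩, Or.inl ⟨?_, rfl, rfl⟩⟩
      rw [hγ₁ t ⟨h0.le, h.le⟩]
      exact h₁.sign t ⟨h0, h⟩
    · subst h
      exact ⟨_, _, hL₁ t ⟨h0, le_rfl⟩, hR₂ t ⟨le_rfl, ht.2⟩,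
        Or.inr (Or.inr (Or.inr ⟨hγT₁ ▸ hd, rfl, rfl⟩))⟩
    · refine ⟨_, _, hL₂ t ⟨h, ht.2.le⟩, hR₂ t ⟨h.le, ht.2⟩, Or.inr (Or.inl ⟨?_, rfl, rfl⟩)⟩
      rw [hγ₂ t ⟨h.le, ht.2.le⟩]
      exact neg_pos.1 (h₂.sign (t - T₁) ⟨by linarith, by linarith [ht.2]⟩)
  have hkey : ∀ t, ∃ vl vr,
      HasDerivWithinAt γ vl (Set.Iic t) t ∧ HasDerivWithinAt γ vr (Set.Ici t) t ∧
      ((0 < Z.f (γ t) ∧ vl = Z.Xp (γ t) ∧ vr = Z.Xp (γ t)) ∨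
       (Z.f (γ t) < 0 ∧ vl = Z.Xm (γ t) ∧ vr = Z.Xm (γ t)) ∨
       (γ t = γ₁ 0 ∧ Z.CrossesUp (γ t) ∧ vl = Z.Xm (γ t) ∧ vr = Z.Xp (γ t)) ∨
       (Z.CrossesDown (γ t) ∧ vl = Z.Xp (γ t) ∧ vr = Z.Xm (γ t))) := by
    intro t
    have hd : ∀ s, γ (s + -(toIcoDiv hT 0 t • (T₁ + T₂))) = γ s := by
      intro s
      rw [← sub_eq_add_neg]
      exact hper.sub_zsmul_eq _
    have ht : t + -(toIcoDiv hT 0 t • (T₁ + T₂)) ∈ Set.Ico 0 (T₁ + T₂) := by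
      have := toIcoMod_mem_Ico hT 0 t
      rwa [toIcoMod, sub_eq_add_neg, zero_add] at this
    obtain ⟨vl, vr, hl, hr, h⟩ := hbase _ ht
    rw [hd t] at h
    exact ⟨vl, vr, hl.of_period hd fun x hx => by simpa using hx,
      hr.of_period hd fun x hx => by simpa using hx, h⟩
  have hboth : ∀ {t v}, HasDerivWithinAt γ v (Set.Iic t) t → HasDerivWithinAt γ v (Set.Ici t) t →
      HasDerivAt γ v t := by
    intro t v hl hr
    have := hl.union hr
    rwa [Set.Iic_union_Ici, hasDerivWithinAt_univ] at this
  have htraj : Z.IsTrajectory γ := by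
    refine ⟨?_, ?_, ?_, ?_, ?_⟩
    · refine continuous_iff_continuousAt.2 fun t => ?_
      obtain ⟨vl, vr, hl, hr, -⟩ := hkey t
      exact continuousAt_iff_continuous_left_right.2 ⟨hl.continuousWithinAt, hr.continuousWithinAt⟩
    · intro t ht
      obtain ⟨vl, vr, hl, hr, ⟨-, rfl, rfl⟩ | ⟨h, -⟩ | ⟨-, h, -⟩ | ⟨h, -⟩⟩ := hkey t
      · exact hboth hl hr
      · exact absurd ht h.not_gt
      · exact absurd h.1 ht.ne'
      · exact absurd h.1 ht.ne'
    · intro t ht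
      obtain ⟨vl, vr, hl, hr, ⟨h, -⟩ | ⟨-, rfl, rfl⟩ | ⟨-, h, -⟩ | ⟨h, -⟩⟩ := hkey t
      · exact absurd ht h.not_gt
      · exact hboth hl hr
      · exact absurd h.1 ht.ne
      · exact absurd h.1 ht.ne
    · intro t ht
      obtain ⟨vl, vr, hl, hr, ⟨h, -⟩ | ⟨h, -⟩ | ⟨-, h, rfl, rfl⟩ | ⟨h, -⟩⟩ := hkey t
      · exact absurd ht.1 h.ne'
      · exact absurd ht.1 h.ne
      · exact ⟨hl, hr⟩
      · exact absurd h ht.not_crossesDown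
    · intro t ht
      obtain ⟨vl, vr, hl, hr, ⟨h, -⟩ | ⟨h, -⟩ | ⟨-, h, -⟩ | ⟨h, rfl, rfl⟩⟩ := hkey t
      · exact absurd ht.1 h.ne'
      · exact absurd ht.1 h.ne
      · exact absurd ht h.not_crossesDown
      · exact ⟨hl, hr⟩
  have hrange : Set.range γ = γ₁ '' Set.Icc 0 T₁ ∪ γ₂ '' Set.Icc 0 T₂ := by
    ext p
    constructor
    · rintro ⟨t, rfl⟩
      have hm := toIcoMod_mem_Ico hT 0 t
      rw [zero_add] at hm
      by_cases h : toIcoMod hT 0 t < T₁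
      · exact Or.inl ⟨_, ⟨hm.1, h.le⟩, by simp only [γ, h, if_true]⟩
      · refine Or.inr ⟨toIcoMod hT 0 t - T₁, ⟨by linarith, by linarith [hm.2]⟩, ?_⟩
        simp only [γ, h, if_false]
    · rintro (⟨t, ht, rfl⟩ | ⟨t, ht, rfl⟩)
      · exact ⟨t, hγ₁ t ht⟩
      · refine ⟨t + T₁, ?_⟩
        rw [hγ₂ _ ⟨by linarith [ht.1], by linarith [ht.2]⟩, add_sub_cancel_right]
  rw [← hrange]
  refine ⟨⟨?_, γ, T₁ + T₂, hT, htraj, hper, rfl⟩, ⟨γ 0, ⟨0, rfl⟩, hγ0 ▸ hu.1⟩, ?_⟩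
  · refine ⟨γ 0, ⟨0, rfl⟩, γ (T₁ / 2), ⟨_, rfl⟩, fun h => ?_⟩
    have h1 := h₁.sign (T₁ / 2) ⟨by linarith, by linarith⟩
    rw [← hγ₁ _ ⟨by linarith, by linarith⟩, ← h, hγ0, hu.1] at h1
    exact lt_irrefl _ h1
  · rintro _ ⟨t, rfl⟩ ht
    obtain ⟨vl, vr, hl, hr, ⟨h, -⟩ | ⟨h, -⟩ | ⟨-, h, -⟩ | ⟨h, -⟩⟩ := hkey t
    · exact absurd ht h.ne'
    · exact absurd ht h.ne
    · exact Or.inl h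
    · exact Or.inr h

/-- The two arcs of the trajectory that starts at `p`, crosses the switching manifold downwards and
comes back to it. -/
structure IsReturnLoop (Z : PiecewiseField) (p : Space) (T₁ T₂ : ℝ) (γ₁ γ₂ : ℝ → Space) :
    Prop where
  arc₁ : IsArc Z.Xp Z.f T₁ γ₁
  arc₂ : IsArc Z.Xm (fun p => -Z.f p) T₂ γ₂
  start : γ₁ 0 = p
  joint : γ₁ T₁ = γ₂ 0
  down : Z.CrossesDown (γ₂ 0)
  up : Z.CrossesUp (γ₂ T₂)

/-- The successive upward crossings of a periodic trajectory form a periodic sequence, and its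
orbit is made of the loops between them. -/
theorem IsTrajectory.exists_return_sequence {γ : ℝ → Space} (h : Z.IsTrajectory γ)
    (hf : Differentiable ℝ Z.f) (hXp : ContDiff ℝ 1 Z.Xp) (hXm : ContDiff ℝ 1 Z.Xm)
    {T : ℝ} (hT : 0 < T) (hper : Function.Periodic γ T) {c : ℝ} (hc : 0 < c)
    {T₁ T₂ : Space → ℝ} {γ₁ γ₂ : Space → ℝ → Space}
    (hloop : ∀ t, Z.CrossesUp (γ t) → c ≤ T₁ (γ t) + T₂ (γ t) ∧
      Z.IsReturnLoop (γ t) (T₁ (γ t)) (T₂ (γ t)) (γ₁ (γ t)) (γ₂ (γ t)))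
    (hex : ∃ t, Z.CrossesUp (γ t)) :
    ∃ (v : ℕ → Space) (n : ℕ), 0 < n ∧ v n = v 0 ∧ (∀ i, v i ∈ Set.range γ ∧ Z.CrossesUp (v i)) ∧
      (∀ i, v (i + 1) = γ₂ (v i) (T₂ (v i))) ∧
      Set.range γ =
        ⋃ i, (γ₁ (v i) '' Set.Icc 0 (T₁ (v i)) ∪ γ₂ (v i) '' Set.Icc 0 (T₂ (v i))) := by
  obtain ⟨t₀, ht₀⟩ := hex
  -- Times of the successive upward crossings, each reached from the previous one after the duration
  -- of a loop.
  let τ : ℕ → ℝ := fun n => (fun t => t + (T₁ (γ t) + T₂ (γ t)))^[n] t₀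
  have hτ0 : τ 0 = t₀ := rfl
  have hτs : ∀ n, τ (n + 1) = τ n + (T₁ (γ (τ n)) + T₂ (γ (τ n))) := fun n => by
    simp only [τ, Function.iterate_succ_apply']
  have hfol₁ : ∀ t, Z.CrossesUp (γ t) → ∀ s ∈ Set.Icc 0 (T₁ (γ t)), γ (t + s) = γ₁ (γ t) s :=
    fun t ht => h.eq_arc_of_crossesUp hf hXp ht (hloop t ht).2.arc₁ (hloop t ht).2.start
  have hfol₂ : ∀ t, Z.CrossesUp (γ t) → ∀ s ∈ Set.Icc 0 (T₂ (γ t)),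
      γ (t + T₁ (γ t) + s) = γ₂ (γ t) s := by
    intro t ht
    have hl := (hloop t ht).2
    have hj : γ (t + T₁ (γ t)) = γ₂ (γ t) 0 := by
      rw [hfol₁ t ht _ ⟨hl.arc₁.pos.le, le_rfl⟩, hl.joint]
    exact h.eq_arc_of_crossesDown hf hXm (hj ▸ hl.down) hl.arc₂ hj.symm
  have hup : ∀ n, Z.CrossesUp (γ (τ n)) := by
    intro n
    induction n with
    | zero => exact ht₀
    | succ n ih =>
      have hl := (hloop _ ih).2
      rw [hτs, ← add_assoc, hfol₂ _ ih _ ⟨hl.arc₂.pos.le, le_rfl⟩]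
      exact hl.up
  have hnext : ∀ n, γ (τ (n + 1)) = γ₂ (γ (τ n)) (T₂ (γ (τ n))) := by
    intro n
    rw [hτs, ← add_assoc, hfol₂ _ (hup n) _ ⟨(hloop _ (hup n)).2.arc₂.pos.le, le_rfl⟩]
  -- The lower bound c on loop durations prevents the crossing times from accumulating, so the loops
  -- cover all times after t₀.
  have hgrow : ∀ n : ℕ, t₀ + n * c ≤ τ n := by
    intro n
    induction n with
    | zero => simp [hτ0]
    | succ n ih =>
      have := (hloop _ (hup n)).1
      rw [hτs]; push_cast; linarith
  have hfind : ∀ t, t₀ ≤ t → ∃ n, τ n ≤ t ∧ t < τ (n + 1) := by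
    intro t ht
    have hex : ∃ n, t < τ n := by
      obtain ⟨n, hn⟩ := exists_nat_gt ((t - t₀) / c)
      refine ⟨n, lt_of_lt_of_le ?_ (hgrow n)⟩
      rw [div_lt_iff₀ hc] at hn
      linarith
    classical
    have hn0 : Nat.find hex ≠ 0 := by
      intro h0
      have := Nat.find_spec hex
      rw [h0] at this
      exact absurd ht (not_le.2 this)
    obtain ⟨m, hm⟩ := Nat.exists_eq_succ_of_ne_zero hn0
    refine ⟨m, not_lt.1 (Nat.find_min hex (by omega)), ?_⟩
    have := Nat.find_spec hex
    rwa [hm] at this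
  have hbetween : ∀ n t, τ n ≤ t → t < τ (n + 1) →
      γ t ∈ γ₁ (γ (τ n)) '' Set.Icc 0 (T₁ (γ (τ n))) ∪ γ₂ (γ (τ n)) '' Set.Icc 0 (T₂ (γ (τ n))) ∧
      (Z.CrossesUp (γ t) → t = τ n) := by
    intro n t h1 h2
    rw [hτs] at h2
    have hl := (hloop _ (hup n)).2
    rcases le_or_gt t (τ n + T₁ (γ (τ n))) with h3 | h3
    · have e := hfol₁ _ (hup n) (t - τ n) ⟨by linarith, by linarith⟩
      rw [add_sub_cancel] at e
      refine ⟨Or.inl ⟨t - τ n, ⟨by linarith, by linarith⟩, e.symm⟩, fun hcr => ?_⟩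
      by_contra hne
      have h4 : τ n < t := lt_of_le_of_ne h1 (Ne.symm hne)
      rcases h3.lt_or_eq with h5 | h5
      · have := hl.arc₁.sign (t - τ n) ⟨by linarith, by linarith⟩
        rw [← e, hcr.1] at this
        exact lt_irrefl _ this
      · rw [e, h5, add_sub_cancel_left, hl.joint] at hcr
        exact hcr.not_crossesDown hl.down
    · have e := hfol₂ _ (hup n) (t - (τ n + T₁ (γ (τ n)))) ⟨by linarith, by linarith⟩
      rw [add_sub_cancel] at e
      refine ⟨Or.inr ⟨_, ⟨by linarith, by linarith⟩, e.symm⟩, fun hcr => ?_⟩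
      have := hl.arc₂.sign (t - (τ n + T₁ (γ (τ n)))) ⟨by linarith, by linarith⟩
      rw [← e, hcr.1, neg_zero] at this
      exact absurd this (lt_irrefl _)
  obtain ⟨n, hn1, hn2⟩ := hfind (t₀ + T) (by linarith)
  -- At time t₀ + T there is again an upward crossing, and τ n is the only one from τ n until just
  -- before τ (n + 1).
  have hn : t₀ + T = τ n := (hbetween n _ hn1 hn2).2 (by rw [hper t₀]; exact ht₀)
  refine ⟨fun i => γ (τ i), n, ?_, ?_, fun i => ⟨⟨_, rfl⟩, hup i⟩, hnext, ?_⟩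
  · refine Nat.pos_of_ne_zero ?_
    rintro rfl
    rw [hτ0] at hn
    linarith
  · simp only [← hn, hτ0, hper t₀]
  · ext p
    constructor
    · rintro ⟨t, rfl⟩
      obtain ⟨k, hk⟩ := exists_nat_gt ((t₀ - t) / T)
      rw [div_lt_iff₀ hT] at hk
      have hk' : γ t = γ (t + k * T) := (hper.nat_mul k t).symm
      obtain ⟨m, hm1, hm2⟩ := hfind (t + k * T) (by linarith)
      rw [hk']
      exact Set.mem_iUnion.2 ⟨m, (hbetween m _ hm1 hm2).1⟩
    · rintro ⟨_, ⟨i, rfl⟩, ⟨s, hs, rfl⟩ | ⟨s, hs, rfl⟩⟩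
      · exact ⟨_, hfol₁ _ (hup i) s hs⟩
      · exact ⟨_, hfol₂ _ (hup i) s hs⟩

end PiecewiseField

/-! ### From solution paths to arcs in one zone -/

theorem continuous_unperturbedField (lam : ℝ) : Continuous (unperturbedField lam) := by
  refine continuous_pi fun i => ?_
  fin_cases i <;> simp [unperturbedField] <;> fun_prop

theorem continuous_perturbedField (lam : ℝ) (P : Fin 3 → MvPolynomial (Fin 3) ℝ) :
    Continuous fun q : ℝ × Space => perturbedField lam q.1 P q.2 := by
  refine continuous_pi fun i => ?_
  have h1 := (continuous_apply i).comp ((continuous_unperturbedField lam).comp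
    (continuous_snd (X := ℝ) (Y := Space)))
  have h2 := (MvPolynomial.continuous_eval (P i)).comp (continuous_snd (X := ℝ) (Y := Space))
  exact h1.add (continuous_fst.mul h2)

theorem MvPolynomial.contDiff_eval {n : WithTop ℕ∞} (P : MvPolynomial (Fin 3) ℝ) :
    ContDiff ℝ n fun p : Space => MvPolynomial.eval p P := by
  induction P using MvPolynomial.induction_on with
  | C a => simpa using contDiff_const
  | add p q hp hq => simpa using hp.add hq
  | mul_X p i hp => simpa using hp.mul (contDiff_apply ℝ _ i)

theorem contDiff_perturbedField {n : WithTop ℕ∞} (lam ε : ℝ)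
    (P : Fin 3 → MvPolynomial (Fin 3) ℝ) : ContDiff ℝ n (perturbedField lam ε P) := by
  have h : ∀ i : Fin 3, ContDiff ℝ n fun p : Space => p i := fun i => contDiff_apply ℝ _ i
  refine contDiff_pi.2 fun i => ContDiff.add ?_ (contDiff_const.mul (MvPolynomial.contDiff_eval _))
  fin_cases i
  · exact (h 1).neg
  · exact h 0
  · exact contDiff_const.mul ((((h 0).pow 2).add ((h 1).pow 2)).sub (h 2))

theorem perturbedField_zero (lam : ℝ) (P : Fin 3 → MvPolynomial (Fin 3) ℝ) :
    perturbedField lam 0 P = unperturbedField lam := by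
  funext p i; simp [perturbedField]

theorem continuous_lieDeriv {Y : Type*} [TopologicalSpace Y] {X : Y → Space → Space}
    {f : Space → ℝ} (hf : ContDiff ℝ 1 f) {p : Y → Space} (hp : Continuous p)
    (hX : Continuous fun y => X y (p y)) : Continuous fun y => lieDeriv (X y) f (p y) :=
  ((hf.continuous_fderiv one_ne_zero).comp hp).clm_apply hX

theorem continuous_lieDeriv_perturbedField (lam : ℝ) (P : Fin 3 → MvPolynomial (Fin 3) ℝ)
    {f : Space → ℝ} (hf : ContDiff ℝ 1 f) :
    Continuous fun q : Space × ℝ => lieDeriv (perturbedField lam q.2 P) f q.1 :=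
  continuous_lieDeriv hf continuous_fst
    ((continuous_perturbedField lam P).comp (show Continuous fun q : Space × ℝ => (q.2, q.1) by
      fun_prop))

theorem IsSolutionPath.at'_zero {lam : ℝ} {P : Fin 3 → MvPolynomial (Fin 3) ℝ} {q : Space × ℝ × ℝ}
    {u : PathSpace} (h : IsSolutionPath lam P q u) : at' 0 u = q.1 := by
  have h1 := congrArg (at' 0) h
  ext i
  have h2 := congrFun h1 i
  have h3 : at' 0 (pathPrimitive (fieldOp lam q.2.2 P u)) i = 0 := by
    change primitive (fieldOp lam q.2.2 P u i) 0 = 0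
    rw [primitive_apply]
    exact intervalIntegral.integral_same
  simp only [map_sub, map_smul, Pi.sub_apply, Pi.smul_apply, h3, at'_constPath, map_zero,
    Pi.zero_apply, smul_zero, sub_zero] at h2
  exact sub_eq_zero.1 h2

/-- Extending the integrand by constants beyond [0, 1] makes the derivatives at both ends two-sided,
as `IsArc` demands. Outside [0, 1] the extension need not solve the equation. -/
theorem IsSolutionPath.exists_extension {lam : ℝ} {P : Fin 3 → MvPolynomial (Fin 3) ℝ}
    {q : Space × ℝ × ℝ} {u : PathSpace} (h : IsSolutionPath lam P q u) :
    ∃ σ : ℝ → Space, (∀ s : unitInterval, σ s = at' s u) ∧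
      ∀ s : unitInterval, HasDerivAt σ (q.2.1 • perturbedField lam q.2.2 P (at' s u)) s := by
  refine ⟨fun x i => q.1 i + q.2.1 *
    ∫ y in (0 : ℝ)..x, Set.IccExtend (zero_le_one' ℝ) (fieldOp lam q.2.2 P u i) y, ?_, ?_⟩
  · intro s
    ext i
    have h2 := congrFun (congrArg (at' s) h) i
    have h3 : at' s (pathPrimitive (fieldOp lam q.2.2 P u)) i =
      ∫ y in (0 : ℝ)..s, Set.IccExtend (zero_le_one' ℝ) (fieldOp lam q.2.2 P u i) y := rfl
    simp only [map_sub, map_smul, Pi.sub_apply, Pi.smul_apply, h3, at'_constPath, map_zero,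
      Pi.zero_apply, smul_eq_mul] at h2
    linarith
  · intro s
    refine hasDerivAt_pi.2 fun i => ?_
    have hc := continuous_iccExtend (fieldOp lam q.2.2 P u i)
    have h1 := intervalIntegral.integral_hasDerivAt_right (hc.intervalIntegrable 0 s)
      (hc.stronglyMeasurableAtFilter _ _) hc.continuousAt
    refine ((h1.const_mul q.2.1).const_add (q.1 i)).congr_deriv ?_
    rw [Set.IccExtend_val, ← at'_fieldOp]
    rfl

/-- The solution path in the original time. -/
theorem IsSolutionPath.exists_curve {lam : ℝ} {P : Fin 3 → MvPolynomial (Fin 3) ℝ}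
    {q : Space × ℝ × ℝ} {u : PathSpace} (h : IsSolutionPath lam P q u) (hT : 0 < q.2.1) :
    ∃ γ : ℝ → Space, (∀ t ∈ Set.Icc 0 q.2.1, HasDerivAt γ (perturbedField lam q.2.2 P (γ t)) t) ∧
      (∀ t ∈ Set.Icc 0 q.2.1, ∃ s : unitInterval, t = q.2.1 * s) ∧
      ∀ s : unitInterval, γ (q.2.1 * s) = at' s u := by
  obtain ⟨σ, hσ, hσ'⟩ := h.exists_extension
  have hpar : ∀ t ∈ Set.Icc 0 q.2.1, ∃ s : unitInterval, t = q.2.1 * s := by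
    intro t ht
    refine ⟨⟨t / q.2.1, div_nonneg ht.1 hT.le, (div_le_one hT).2 ht.2⟩, ?_⟩
    field_simp
  have hval : ∀ s : unitInterval, σ (q.2.1 * s / q.2.1) = at' s u := by
    intro s
    rw [mul_div_cancel_left₀ _ hT.ne', hσ]
  refine ⟨fun t => σ (t / q.2.1), ?_, hpar, hval⟩
  intro t ht
  obtain ⟨s, rfl⟩ := hpar t ht
  simp only [hval]
  have h1 := hσ' s
  have e : (s : ℝ) = q.2.1 * s / q.2.1 := (mul_div_cancel_left₀ _ hT.ne').symm
  rw [e] at h1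
  have h2 := h1.scomp (q.2.1 * s) ((hasDerivAt_id (q.2.1 * (s : ℝ))).div_const q.2.1)
  rwa [smul_smul, one_div, inv_mul_cancel₀ hT.ne', one_smul] at h2

/-- A solution path that starts and ends in `f = 0` stays in `f > 0` near its ends, if `f` increases
near the start and decreases near the end. -/
theorem IsSolutionPath.pos_of_lieDeriv {lam : ℝ} {P : Fin 3 → MvPolynomial (Fin 3) ℝ}
    {f : Space → ℝ} (hf : Differentiable ℝ f) {q : Space × ℝ × ℝ} {u : PathSpace}
    (hsol : IsSolutionPath lam P q u) (hT : 0 < q.2.1) (hf0 : f (at' 0 u) = 0)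
    (hf1 : f (at' 1 u) = 0) {a b : unitInterval}
    (ha : ∀ s ≤ a, 0 < lieDeriv (perturbedField lam q.2.2 P) f (at' s u))
    (hb : ∀ s ≥ b, lieDeriv (perturbedField lam q.2.2 P) f (at' s u) < 0)
    (hmid : ∀ s ∈ Set.Icc a b, 0 < f (at' s u)) {s : unitInterval} (hs0 : s ≠ 0) (hs1 : s ≠ 1) :
    0 < f (at' s u) := by
  obtain ⟨σ, hσ, hσ'⟩ := hsol.exists_extension
  have hd : ∀ s : unitInterval, HasDerivAt (fun x => f (σ x))
      (q.2.1 * lieDeriv (perturbedField lam q.2.2 P) f (at' s u)) s := by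
    intro s
    have h := (hf (σ s)).hasFDerivAt.comp_hasDerivAt (s : ℝ) (hσ' s)
    refine h.congr_deriv ?_
    rw [hσ, map_smul]; rfl
  rcases le_total s a with hsa | hsa
  · have hmono : StrictMonoOn (fun x => f (σ x)) (Set.Icc (0 : ℝ) a) := by
      refine strictMonoOn_of_deriv_pos (convex_Icc _ _) ?_ ?_
      · intro x hx
        exact (hd ⟨x, hx.1, hx.2.trans a.2.2⟩).continuousAt.continuousWithinAt
      · intro x hx
        rw [interior_Icc] at hx
        have hx' : x ∈ Set.Icc (0 : ℝ) 1 := ⟨hx.1.le, hx.2.le.trans a.2.2⟩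
        rw [(hd ⟨x, hx'⟩).deriv]
        exact mul_pos hT (ha ⟨x, hx'⟩ hx.2.le)
    have h := hmono ⟨le_rfl, a.2.1⟩ ⟨s.2.1, hsa⟩
      (lt_of_le_of_ne s.2.1 (fun h => hs0 (Subtype.ext h.symm)))
    have h00 := hσ 0
    rw [Set.Icc.coe_zero] at h00
    simp only [hσ, h00, hf0] at h
    exact h
  rcases le_total s b with hsb | hsb
  · exact hmid s ⟨hsa, hsb⟩
  · have hanti : StrictAntiOn (fun x => f (σ x)) (Set.Icc (b : ℝ) 1) := by
      refine strictAntiOn_of_deriv_neg (convex_Icc _ _) ?_ ?_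
      · intro x hx
        exact (hd ⟨x, b.2.1.trans hx.1, hx.2⟩).continuousAt.continuousWithinAt
      · intro x hx
        rw [interior_Icc] at hx
        have hx' : x ∈ Set.Icc (0 : ℝ) 1 := ⟨b.2.1.trans hx.1.le, hx.2.le⟩
        rw [(hd ⟨x, hx'⟩).deriv]
        exact mul_neg_of_pos_of_neg hT (hb ⟨x, hx'⟩ hx.1.le)
    have h := hanti ⟨hsb, s.2.2⟩ ⟨b.2.2, le_rfl⟩
      (lt_of_le_of_ne s.2.2 (fun h => hs1 (Subtype.ext h)))
    have h11 := hσ 1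
    rw [Set.Icc.coe_one] at h11
    simp only [hσ, h11, hf1] at h
    exact h

theorem exists_forall_le_of_eventually_nhds_zero {A : unitInterval → Prop}
    (hA : ∀ᶠ s in 𝓝 0, A s) : ∃ a : unitInterval, 0 < a ∧ ∀ s ≤ a, A s := by
  obtain ⟨δ, hδ, h⟩ := Metric.eventually_nhds_iff.1 hA
  have h0 : 0 < min (δ / 2) 1 := by positivity
  refine ⟨⟨min (δ / 2) 1, h0.le, min_le_right _ _⟩, h0, fun s hs => h ?_⟩
  have hs' : (s : ℝ) ≤ δ / 2 := (show (s : ℝ) ≤ min (δ / 2) 1 from hs).trans (min_le_left _ _)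
  rw [Subtype.dist_eq, Set.Icc.coe_zero, Real.dist_eq, sub_zero, abs_of_nonneg s.2.1]
  linarith

theorem exists_forall_ge_of_eventually_nhds_one {B : unitInterval → Prop}
    (hB : ∀ᶠ s in 𝓝 1, B s) : ∃ b : unitInterval, b < 1 ∧ ∀ s ≥ b, B s := by
  have h1 : ∀ᶠ s : unitInterval in 𝓝 0, B (unitInterval.symm s) := by
    refine Tendsto.eventually (f := unitInterval.symm) ?_ hB
    have := unitInterval.continuous_symm.tendsto 0
    rwa [unitInterval.symm_zero] at this
  obtain ⟨a, ha, h⟩ := exists_forall_le_of_eventually_nhds_zero h1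
  refine ⟨unitInterval.symm a, ?_, fun s hs => ?_⟩
  · rw [← unitInterval.symm_zero]
    exact unitInterval.strictAnti_symm ha
  · have := h (unitInterval.symm s) (by
      rw [← unitInterval.symm_symm a]; exact unitInterval.strictAnti_symm.antitone hs)
    rwa [unitInterval.symm_symm] at this

/-- The solutions near one that goes from the crossing point `at' 0 u₀` to the crossing point
`at' 1 u₀` through `f > 0` stay in `f > 0`, if they start and end in `f = 0`. -/
theorem eventually_pos_of_isSolutionPath {lam : ℝ} {P : Fin 3 → MvPolynomial (Fin 3) ℝ}
    {f : Space → ℝ} (hf : ContDiff ℝ 1 f) {q₀ : Space × ℝ × ℝ} {u₀ : PathSpace} (hT : 0 < q₀.2.1)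
    (h0 : 0 < lieDeriv (perturbedField lam q₀.2.2 P) f (at' 0 u₀))
    (h1 : lieDeriv (perturbedField lam q₀.2.2 P) f (at' 1 u₀) < 0)
    (hpos : ∀ s : unitInterval, s ≠ 0 → s ≠ 1 → 0 < f (at' s u₀)) :
    ∀ᶠ w in 𝓝 (q₀, u₀), IsSolutionPath lam P w.1 w.2 → f (at' 0 w.2) = 0 → f (at' 1 w.2) = 0 →
      ∀ s : unitInterval, s ≠ 0 → s ≠ 1 → 0 < f (at' s w.2) := by
  have hat : Continuous fun v : ((Space × ℝ × ℝ) × PathSpace) × unitInterval =>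
      at' v.2 v.1.2 := continuous_at'.comp (continuous_snd.prodMk (continuous_snd.comp continuous_fst))
  have hL : Continuous fun v : ((Space × ℝ × ℝ) × PathSpace) × unitInterval =>
      lieDeriv (perturbedField lam v.1.1.2.2 P) f (at' v.2 v.1.2) := by
    refine (continuous_lieDeriv_perturbedField lam P hf).comp (hat.prodMk ?_)
    exact continuous_snd.comp (continuous_snd.comp (continuous_fst.comp continuous_fst))
  have e0 : ∀ᶠ v in 𝓝 ((q₀, u₀), (0 : unitInterval)),
      0 < lieDeriv (perturbedField lam v.1.1.2.2 P) f (at' v.2 v.1.2) :=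
    (isOpen_lt continuous_const hL).mem_nhds h0
  have e1 : ∀ᶠ v in 𝓝 ((q₀, u₀), (1 : unitInterval)),
      lieDeriv (perturbedField lam v.1.1.2.2 P) f (at' v.2 v.1.2) < 0 :=
    (isOpen_lt hL continuous_const).mem_nhds h1
  -- Product neighbourhoods provide a and b valid for all nearby solutions at once. Monotonicity of
  -- f handles the two ends, and compactness of `Icc a b` the middle.
  rw [nhds_prod_eq, eventually_prod_iff] at e0 e1
  obtain ⟨A', hA', A, hA, hA2⟩ := e0
  obtain ⟨B', hB', B, hB, hB2⟩ := e1
  obtain ⟨a, ha, hAa⟩ := exists_forall_le_of_eventually_nhds_zero hA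
  obtain ⟨b, hb, hBb⟩ := exists_forall_ge_of_eventually_nhds_one hB
  have hmid : ∀ᶠ w in 𝓝 (q₀, u₀), ∀ s ∈ Set.Icc a b, 0 < f (at' s w.2) := by
    refine isCompact_Icc.eventually_forall_of_forall_eventually fun s hs => ?_
    have hs0 : s ≠ 0 := (lt_of_lt_of_le ha hs.1).ne'
    have hs1 : s ≠ 1 := (lt_of_le_of_lt hs.2 hb).ne
    exact (hf.continuous.comp hat).continuousAt.eventually (lt_mem_nhds (hpos s hs0 hs1))
  have hTe : ∀ᶠ w : (Space × ℝ × ℝ) × PathSpace in 𝓝 (q₀, u₀), 0 < w.1.2.1 :=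
    (continuous_fst.comp (continuous_snd.comp continuous_fst)).continuousAt.eventually
      (lt_mem_nhds hT)
  filter_upwards [hA', hB', hmid, hTe] with w hAw hBw hmid hTw hsol hf0 hf1 s hs0 hs1
  exact hsol.pos_of_lieDeriv (hf.differentiable one_ne_zero) hTw hf0 hf1
    (fun s hs => hA2 hAw (hAa s hs)) (fun s hs => hB2 hBw (hBb s hs)) hmid hs0 hs1

/-! ### Conserved quantities, unperturbed circles and the averaged function -/

/-- The function `2 (x P₁ + y P₂)` along a path. -/
noncomputable def radialOp (P : Fin 3 → MvPolynomial (Fin 3) ℝ) (u : PathSpace) :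
    C(unitInterval, ℝ) :=
  (2 : ℝ) • (u 0 * MvPolynomial.aeval u (P 0) + u 1 * MvPolynomial.aeval u (P 1))

theorem contDiff_radialOp {n : WithTop ℕ∞} (P : Fin 3 → MvPolynomial (Fin 3) ℝ) :
    ContDiff ℝ n (radialOp P) :=
  (((contDiff_apply ℝ _ 0).mul (contDiff_aeval (P 0))).add
    ((contDiff_apply ℝ _ 1).mul (contDiff_aeval (P 1)))).const_smul (2 : ℝ)

/-- The square of the distance to the third axis. -/
def radiusSq (p : Space) : ℝ := p 0 ^ 2 + p 1 ^ 2

/-- The function `x² + y² - z` that vanishes on the invariant paraboloid. -/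
def offset (p : Space) : ℝ := p 0 ^ 2 + p 1 ^ 2 - p 2

/-- The unperturbed field is tangent to the cylinders on which `radiusSq` is constant. The increment
is due to the perturbation alone and carries an exact factor ε. -/
theorem IsSolutionPath.radiusSq_at'_one {lam : ℝ} {P : Fin 3 → MvPolynomial (Fin 3) ℝ}
    {q : Space × ℝ × ℝ} {u : PathSpace} (h : IsSolutionPath lam P q u) :
    radiusSq (at' 1 u) = radiusSq q.1 + q.2.2 * (q.2.1 * primitive (radialOp P u) 1) := by
  obtain ⟨σ, hσ, hσ'⟩ := h.exists_extension
  have hd : ∀ x ∈ Set.uIcc (0 : ℝ) 1, HasDerivAt (fun x => radiusSq (σ x))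
      (q.2.2 * q.2.1 * Set.IccExtend (zero_le_one' ℝ) (radialOp P u) x) x := by
    intro x hx
    rw [Set.uIcc_of_le zero_le_one] at hx
    have h1 := hσ' ⟨x, hx⟩
    have h2 := ((hasDerivAt_pi.1 h1 0).pow 2).add ((hasDerivAt_pi.1 h1 1).pow 2)
    refine h2.congr_deriv ?_
    rw [Set.IccExtend_of_mem _ _ hx]
    have h3 : σ x = at' ⟨x, hx⟩ u := hσ ⟨x, hx⟩
    simp only [h3, radialOp, ContinuousMap.smul_apply, ContinuousMap.add_apply,
      ContinuousMap.mul_apply, aeval_apply, Pi.smul_apply, smul_eq_mul, perturbedField, at'_apply]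
    simp [unperturbedField]
    ring
  have hc := continuous_iccExtend (radialOp P u)
  have hint := intervalIntegral.integral_eq_sub_of_hasDerivAt hd
    ((continuous_const.mul hc).intervalIntegrable _ _)
  rw [intervalIntegral.integral_const_mul] at hint
  have h00 := hσ 0
  have h11 := hσ 1
  rw [Set.Icc.coe_zero] at h00
  rw [Set.Icc.coe_one] at h11
  rw [h00, h11, h.at'_zero] at hint
  rw [primitive_apply, Set.Icc.coe_one]
  linarith

open Real

/-- The point with angle `θ` on the unperturbed orbit of radius `r` on the paraboloid. -/
noncomputable def circlePoint (r θ : ℝ) : Space := ![r * cos θ, r * sin θ, r ^ 2]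

theorem continuous_circlePoint : Continuous fun q : ℝ × ℝ => circlePoint q.1 q.2 := by
  refine continuous_pi fun i => ?_
  fin_cases i <;> simp [circlePoint] <;> fun_prop

theorem radiusSq_circlePoint (r θ : ℝ) : radiusSq (circlePoint r θ) = r ^ 2 := by
  simp only [radiusSq, circlePoint, Matrix.cons_val_zero, Matrix.cons_val_one]
  linear_combination r ^ 2 * sin_sq_add_cos_sq θ

theorem offset_circlePoint (r θ : ℝ) : offset (circlePoint r θ) = 0 := by
  have := radiusSq_circlePoint r θ
  simp only [radiusSq] at this
  simp only [offset, this]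
  simp [circlePoint]

theorem unperturbedFlow_circlePoint (lam t r θ : ℝ) :
    unperturbedFlow lam t (circlePoint r θ) = circlePoint r (θ + t) := by
  have h := radiusSq_circlePoint r θ
  ext i
  fin_cases i
  · simp [unperturbedFlow, circlePoint, cos_add]; ring
  · simp [unperturbedFlow, circlePoint, sin_add]; ring
  · simp only [radiusSq] at h
    simp [unperturbedFlow, h]
    simp [circlePoint]

/-- The offset s satisfies s' = -λs along the unperturbed flow; this is the source of hyperbolicity
transverse to the paraboloid. -/
theorem offset_unperturbedFlow (lam t : ℝ) (p : Space) :
    offset (unperturbedFlow lam t p) = offset p * exp (-(lam * t)) := by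
  simp [offset, unperturbedFlow]
  linear_combination (p 0 ^ 2 + p 1 ^ 2) * sin_sq_add_cos_sq t

theorem hasDerivAt_circlePoint (lam r θ : ℝ) :
    HasDerivAt (circlePoint r) (unperturbedField lam (circlePoint r θ)) θ := by
  have h := hasDerivAt_unperturbedFlow lam (circlePoint r 0) θ
  simpa only [unperturbedFlow_circlePoint, zero_add] using h

theorem hasDerivAt_comp_circlePoint (lam : ℝ) {f : Space → ℝ} (hf : Differentiable ℝ f)
    (r θ c : ℝ) : HasDerivAt (fun t => f (circlePoint r (θ + t * c)))
      (c * lieDeriv (unperturbedField lam) f (circlePoint r θ)) 0 := by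
  have h1 : HasDerivAt (fun t : ℝ => θ + t * c) c 0 := by
    simpa using ((hasDerivAt_id (0 : ℝ)).mul_const c).const_add θ
  have h2 : HasDerivAt (circlePoint r) (unperturbedField lam (circlePoint r θ)) (θ + 0 * c) := by
    rw [zero_mul, add_zero]; exact hasDerivAt_circlePoint lam r θ
  have h3 := h2.scomp (0 : ℝ) h1
  have h4 := (hf _).hasFDerivAt.comp_hasDerivAt (0 : ℝ) h3
  refine h4.congr_deriv ?_
  rw [map_smul]
  simp [lieDeriv]

theorem hasStrictFDerivAt_radiusSq (p : Space) : ∃ D : Space →L[ℝ] ℝ,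
    HasStrictFDerivAt radiusSq D p ∧ ∀ v, D v = 2 * p 0 * v 0 + 2 * p 1 * v 1 := by
  have h : ∀ i : Fin 3, HasStrictFDerivAt (fun p : Space => p i)
      (ContinuousLinearMap.proj (R := ℝ) (φ := fun _ : Fin 3 => ℝ) i) p :=
    fun i => hasStrictFDerivAt_apply i p
  exact ⟨_, ((h 0).pow 2).add ((h 1).pow 2), fun v => by simp⟩

theorem hasStrictFDerivAt_offset (p : Space) : ∃ D : Space →L[ℝ] ℝ,
    HasStrictFDerivAt offset D p ∧ ∀ v, D v = 2 * p 0 * v 0 + 2 * p 1 * v 1 - v 2 := by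
  have h : ∀ i : Fin 3, HasStrictFDerivAt (fun p : Space => p i)
      (ContinuousLinearMap.proj (R := ℝ) (φ := fun _ : Fin 3 => ℝ) i) p :=
    fun i => hasStrictFDerivAt_apply i p
  exact ⟨_, (((h 0).pow 2).add ((h 1).pow 2)).sub (h 2), fun v => by simp⟩

/-- Off the axis, the differentials of `radiusSq`, `offset` and of a function transverse to the
unperturbed field at a point of the paraboloid are independent. -/
theorem eq_zero_of_transverse {lam : ℝ} {f : Space → ℝ} {r θ : ℝ} (hr : 0 < r)
    (hf : lieDeriv (unperturbedField lam) f (circlePoint r θ) ≠ 0) {v : Space}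
    (h1 : 2 * circlePoint r θ 0 * v 0 + 2 * circlePoint r θ 1 * v 1 = 0)
    (h2 : 2 * circlePoint r θ 0 * v 0 + 2 * circlePoint r θ 1 * v 1 - v 2 = 0)
    (h3 : fderiv ℝ f (circlePoint r θ) v = 0) : v = 0 := by
  set p := circlePoint r θ
  have hr2 : p 0 ^ 2 + p 1 ^ 2 = r ^ 2 := radiusSq_circlePoint r θ
  have hp2 : p 2 = r ^ 2 := by simp [p, circlePoint]
  have hr' : 0 < r ^ 2 := by positivity
  -- The common kernel of the first two differentials is spanned by the unperturbed field, and
  -- transversality excludes this direction.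
  have hX : v = ((p 0 * v 1 - p 1 * v 0) / r ^ 2) • unperturbedField lam p := by
    ext i
    fin_cases i
    · simp [unperturbedField]
      field_simp
      linear_combination (-v 0) * hr2 + p 0 / 2 * h1
    · simp [unperturbedField]
      field_simp
      linear_combination (-v 1) * hr2 + p 1 / 2 * h1
    · simp [unperturbedField, hr2, hp2]
      linarith
  rw [hX, map_smul, smul_eq_mul] at h3
  rw [hX, (mul_eq_zero.1 h3).resolve_right hf, zero_smul]

/-- The function `2 (x P₁ + y P₂)`. -/
noncomputable def radialPart (P : Fin 3 → MvPolynomial (Fin 3) ℝ) (p : Space) : ℝ :=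
  2 * (p 0 * MvPolynomial.eval p (P 0) + p 1 * MvPolynomial.eval p (P 1))

/-- The substitution φ = θ + Tx turns the drift along one unperturbed arc into one of the two
integrals of `melnikov`. -/
theorem mul_primitive_radialOp (lam : ℝ) (P : Fin 3 → MvPolynomial (Fin 3) ℝ) (r θ T : ℝ) :
    T * primitive (radialOp P (unperturbedPath lam (circlePoint r θ, T))) 1 =
      ∫ φ in θ..θ + T, radialPart P (circlePoint r φ) := by
  have h1 := intervalIntegral.mul_integral_comp_add_mul (a := 0) (b := 1)
    (f := fun φ => radialPart P (circlePoint r φ)) T θ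
  rw [mul_zero, add_zero, mul_one] at h1
  rw [← h1, primitive_apply, Set.Icc.coe_one]
  congr 1
  refine intervalIntegral.integral_congr fun x hx => ?_
  rw [Set.uIcc_of_le zero_le_one] at hx
  rw [Set.IccExtend_of_mem _ _ hx]
  simp only [radialOp, radialPart, ContinuousMap.smul_apply, ContinuousMap.add_apply,
    ContinuousMap.mul_apply, aeval_apply, smul_eq_mul, at'_unperturbedPath,
    unperturbedFlow_circlePoint]
  rw [← at'_apply, ← at'_apply, at'_unperturbedPath, unperturbedFlow_circlePoint]

/-- The first-order averaged function: the integral of the radial part of the perturbation along the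
unperturbed orbit of radius `r` that crosses the switching manifold at the angles `α`, `π - α`. -/
noncomputable def melnikov (Pp Pm : Fin 3 → MvPolynomial (Fin 3) ℝ) (r α : ℝ) : ℝ :=
  (∫ θ in α..π - α, radialPart Pp (circlePoint r θ)) +
    ∫ θ in π - α..2 * π + α, radialPart Pm (circlePoint r θ)

/-- The orbit of radius `r` crosses `f = 0` upwards at the angle `α` and downwards at the angle
`π - α`. -/
structure IsCrossingCircle (lam : ℝ) (f : Space → ℝ) (r α : ℝ) : Prop where
  r_pos : 0 < r
  nonneg : 0 ≤ α
  lt_half_pi : α < π / 2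
  start : f (circlePoint r α) = 0
  joint : f (circlePoint r (π - α)) = 0
  pos : ∀ θ ∈ Set.Ioo α (π - α), 0 < f (circlePoint r θ)
  neg : ∀ θ ∈ Set.Ioo (π - α) (2 * π + α), f (circlePoint r θ) < 0
  up : 0 < lieDeriv (unperturbedField lam) f (circlePoint r α)
  down : lieDeriv (unperturbedField lam) f (circlePoint r (π - α)) < 0

theorem circlePoint_add_two_pi (r θ : ℝ) : circlePoint r (θ + 2 * π) = circlePoint r θ := by
  simp [circlePoint]

theorem image_curve_eq_range {T : ℝ} (hT : 0 < T) {γ : ℝ → Space} {u : PathSpace}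
    (h1 : ∀ t ∈ Set.Icc 0 T, ∃ s : unitInterval, t = T * s)
    (h2 : ∀ s : unitInterval, γ (T * s) = at' s u) :
    γ '' Set.Icc 0 T = Set.range fun s => at' s u := by
  ext p
  constructor
  · rintro ⟨t, ht, rfl⟩
    obtain ⟨s, rfl⟩ := h1 t ht
    exact ⟨s, (h2 s).symm⟩
  · rintro ⟨s, rfl⟩
    exact ⟨T * s, ⟨mul_nonneg hT.le s.2.1, mul_le_of_le_one_right hT.le s.2.2⟩, h2 s⟩

theorem IsSolutionPath.exists_isArc {lam : ℝ} {P : Fin 3 → MvPolynomial (Fin 3) ℝ}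
    {q : Space × ℝ × ℝ} {u : PathSpace} (h : IsSolutionPath lam P q u) (hT : 0 < q.2.1)
    {f : Space → ℝ} (hf : ∀ s : unitInterval, s ≠ 0 → s ≠ 1 → 0 < f (at' s u)) :
    ∃ γ : ℝ → Space, IsArc (perturbedField lam q.2.2 P) f q.2.1 γ ∧ γ 0 = q.1 ∧
      γ q.2.1 = at' 1 u ∧ γ '' Set.Icc 0 q.2.1 = Set.range fun s => at' s u := by
  obtain ⟨γ, h1, h2, h3⟩ := h.exists_curve hT
  refine ⟨γ, ⟨hT, h1, ?_⟩, ?_, ?_, image_curve_eq_range hT h2 h3⟩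
  · intro t ht
    obtain ⟨s, rfl⟩ := h2 t ⟨ht.1.le, ht.2.le⟩
    rw [h3]
    refine hf s ?_ ?_
    · rintro rfl
      simpa using ht.1
    · rintro rfl
      simpa using ht.2
  · rw [← h.at'_zero, ← h3, Set.Icc.coe_zero, mul_zero]
  · rw [← h3, Set.Icc.coe_one, mul_one]

theorem exists_isReturnLoop {lam ε T₁ T₂ : ℝ} {f : Space → ℝ}
    {Pp Pm : Fin 3 → MvPolynomial (Fin 3) ℝ} {p : Space} {u₁ u₂ : PathSpace}
    (h₁ : IsSolutionPath lam Pp (p, T₁, ε) u₁) (h₂ : IsSolutionPath lam Pm (at' 1 u₁, T₂, ε) u₂)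
    (hT₁ : 0 < T₁) (hT₂ : 0 < T₂)
    (hpos : ∀ s : unitInterval, s ≠ 0 → s ≠ 1 → 0 < f (at' s u₁))
    (hneg : ∀ s : unitInterval, s ≠ 0 → s ≠ 1 → 0 < -f (at' s u₂))
    (hdown : (perturbedSystem lam ε f Pp Pm).CrossesDown (at' 1 u₁))
    (hup : (perturbedSystem lam ε f Pp Pm).CrossesUp (at' 1 u₂)) :
    ∃ γ₁ γ₂ : ℝ → Space, (perturbedSystem lam ε f Pp Pm).IsReturnLoop p T₁ T₂ γ₁ γ₂ ∧
      γ₂ T₂ = at' 1 u₂ ∧ (γ₁ '' Set.Icc 0 T₁ = Set.range fun s => at' s u₁) ∧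
      γ₂ '' Set.Icc 0 T₂ = Set.range fun s => at' s u₂ := by
  obtain ⟨γ₁, a1, a2, a3, a4⟩ := h₁.exists_isArc hT₁ hpos
  obtain ⟨γ₂, b1, b2, b3, b4⟩ := h₂.exists_isArc (f := fun p => -f p) hT₂ hneg
  have e2 : γ₂ 0 = at' 1 u₁ := b2
  have e3 : γ₂ T₂ = at' 1 u₂ := b3
  have e4 : γ₁ T₁ = at' 1 u₁ := a3
  refine ⟨γ₁, γ₂, ⟨a1, b1, a2, e4.trans e2.symm, ?_, ?_⟩, b3, a4, b4⟩
  · rw [e2]; exact hdown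
  · rw [e3]; exact hup

/-! ### The shooting problem and its local coordinates -/

/-- The parameters of the shooting problem: initial point, durations of the two arcs, and `ε`. -/
abbrev ShootingSpace : Type := Space × ℝ × ℝ × ℝ

/-- The parameters of the unperturbed orbit of radius `r` that crosses at the angles `α`,
`π - α`. -/
noncomputable def shootingBase (r α : ℝ) : ShootingSpace :=
  (circlePoint r α, π - 2 * α, π + 2 * α, 0)

/-- The two solution paths as functions of the shooting parameters. -/
structure Shooting (lam : ℝ) (Pp Pm : Fin 3 → MvPolynomial (Fin 3) ℝ) (r α : ℝ) where
  /-- the solution path of the field of `f > 0` -/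
  u₁ : ShootingSpace → PathSpace
  /-- the solution path of the field of `f < 0` -/
  u₂ : ShootingSpace → PathSpace
  /-- the derivative of `u₁` -/
  u₁' : ShootingSpace →L[ℝ] PathSpace
  /-- the derivative of `u₂` -/
  u₂' : ShootingSpace →L[ℝ] PathSpace
  deriv₁ : HasStrictFDerivAt u₁ u₁' (shootingBase r α)
  deriv₂ : HasStrictFDerivAt u₂ u₂' (shootingBase r α)
  sol₁ : ∀ᶠ ξ in 𝓝 (shootingBase r α), IsSolutionPath lam Pp (ξ.1, ξ.2.1, ξ.2.2.2) (u₁ ξ)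
  sol₂ : ∀ᶠ ξ in 𝓝 (shootingBase r α),
    IsSolutionPath lam Pm (at' 1 (u₁ ξ), ξ.2.2.1, ξ.2.2.2) (u₂ ξ)
  flow : ∀ᶠ ξ in 𝓝 (shootingBase r α), ξ.2.2.2 = 0 →
    u₁ ξ = unperturbedPath lam (ξ.1, ξ.2.1) ∧
    u₂ ξ = unperturbedPath lam (at' 1 (u₁ ξ), ξ.2.2.1)

/-- Two solution maps are composed, the second starting where the first path ends. The end points
are not yet required to lie on the switching manifold. -/
theorem exists_shooting (lam : ℝ) (Pp Pm : Fin 3 → MvPolynomial (Fin 3) ℝ) (r α : ℝ) :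
    Nonempty (Shooting lam Pp Pm r α) := by
  obtain ⟨v₁, ⟨v₁', hv₁⟩, hs₁, hf₁⟩ := exists_solutionMap lam Pp (circlePoint r α) (π - 2 * α)
  obtain ⟨v₂, ⟨v₂', hv₂⟩, hs₂, hf₂⟩ :=
    exists_solutionMap lam Pm (circlePoint r (π - α)) (π + 2 * α)
  let a₁ : ShootingSpace →L[ℝ] Space × ℝ × ℝ :=
    (ContinuousLinearMap.fst ℝ _ _).prod
      (((ContinuousLinearMap.fst ℝ _ _).comp (ContinuousLinearMap.snd ℝ _ _)).prod
        ((ContinuousLinearMap.snd ℝ _ _).comp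
          ((ContinuousLinearMap.snd ℝ _ _).comp (ContinuousLinearMap.snd ℝ _ _))))
  let b₂ : ShootingSpace →L[ℝ] ℝ × ℝ :=
    (ContinuousLinearMap.snd ℝ _ _).comp (ContinuousLinearMap.snd ℝ _ _)
  have hu₁ : HasStrictFDerivAt (fun ξ => v₁ (a₁ ξ)) (v₁'.comp a₁) (shootingBase r α) :=
    HasStrictFDerivAt.comp (g := v₁) _ hv₁ a₁.hasStrictFDerivAt
  have hbase₁ : v₁ (a₁ (shootingBase r α)) =
      unperturbedPath lam (circlePoint r α, π - 2 * α) := hf₁.self_of_nhds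
  have hq : at' 1 (v₁ (a₁ (shootingBase r α))) = circlePoint r (π - α) := by
    rw [hbase₁, at'_unperturbedPath, unperturbedFlow_circlePoint]
    congr 1
    simp only [Set.Icc.coe_one]
    ring
  have hq₁ : HasStrictFDerivAt (fun ξ => at' 1 (v₁ (a₁ ξ))) ((at' 1).comp (v₁'.comp a₁))
      (shootingBase r α) := (at' 1).hasStrictFDerivAt.comp _ hu₁
  have ha₂ : HasStrictFDerivAt (fun ξ => (at' 1 (v₁ (a₁ ξ)), b₂ ξ))
      (((at' 1).comp (v₁'.comp a₁)).prod b₂) (shootingBase r α) :=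
    hq₁.prodMk b₂.hasStrictFDerivAt
  have hval : ((at' 1 (v₁ (a₁ (shootingBase r α))), b₂ (shootingBase r α)) : Space × ℝ × ℝ) =
      (circlePoint r (π - α), π + 2 * α, 0) := by rw [hq]; rfl
  have hu₂ : HasStrictFDerivAt (fun ξ => v₂ (at' 1 (v₁ (a₁ ξ)), b₂ ξ))
      (v₂'.comp (((at' 1).comp (v₁'.comp a₁)).prod b₂)) (shootingBase r α) :=
    HasStrictFDerivAt.comp (g := v₂) (f := fun ξ => (at' 1 (v₁ (a₁ ξ)), b₂ ξ)) _
      (hval ▸ hv₂) ha₂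
  have hta₁ : Tendsto a₁ (𝓝 (shootingBase r α)) (𝓝 (circlePoint r α, π - 2 * α, 0)) :=
    a₁.continuous.tendsto' _ _ rfl
  have hta₂ : Tendsto (fun ξ => ((at' 1 (v₁ (a₁ ξ)), b₂ ξ) : Space × ℝ × ℝ))
      (𝓝 (shootingBase r α)) (𝓝 (circlePoint r (π - α), π + 2 * α, 0)) := by
    rw [← hval]; exact ha₂.continuousAt
  refine ⟨⟨_, _, _, _, hu₁, hu₂, hta₁.eventually hs₁, hta₂.eventually hs₂, ?_⟩⟩
  have ht₁ : Tendsto (fun ξ : ShootingSpace => (ξ.1, ξ.2.1)) (𝓝 (shootingBase r α))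
      (𝓝 (circlePoint r α, π - 2 * α)) := Continuous.tendsto' (by fun_prop) _ _ rfl
  have ht₂ : Tendsto (fun ξ : ShootingSpace => (at' 1 (v₁ (a₁ ξ)), ξ.2.2.1))
      (𝓝 (shootingBase r α)) (𝓝 (circlePoint r (π - α), π + 2 * α)) := by
    have : Continuous fun w : Space × ℝ × ℝ => (w.1, w.2.1) := by fun_prop
    exact (this.tendsto _).comp hta₂
  filter_upwards [ht₁.eventually hf₁, ht₂.eventually hf₂] with ξ h1 h2 h3
  refine ⟨?_, ?_⟩
  · rw [← h1, ← h3]; rfl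
  · rw [← h2, ← h3]; rfl

namespace Shooting

variable {lam : ℝ} {f : Space → ℝ} {Pp Pm : Fin 3 → MvPolynomial (Fin 3) ℝ} {r α : ℝ}
  (A : Shooting lam Pp Pm r α)

/-- The point where the first arc ends. -/
noncomputable def q₁ (ξ : ShootingSpace) : Space := at' 1 (A.u₁ ξ)

/-- The point where the second arc ends. -/
noncomputable def q₂ (ξ : ShootingSpace) : Space := at' 1 (A.u₂ ξ)

theorem hasStrictFDerivAt_q₁ :
    HasStrictFDerivAt A.q₁ ((at' 1).comp A.u₁') (shootingBase r α) :=
  (at' 1).hasStrictFDerivAt.comp _ A.deriv₁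

theorem hasStrictFDerivAt_q₂ :
    HasStrictFDerivAt A.q₂ ((at' 1).comp A.u₂') (shootingBase r α) :=
  (at' 1).hasStrictFDerivAt.comp _ A.deriv₂

theorem eventually_q_eq : ∀ᶠ ξ in 𝓝 (shootingBase r α), ξ.2.2.2 = 0 →
    A.q₁ ξ = unperturbedFlow lam ξ.2.1 ξ.1 ∧ A.q₂ ξ = unperturbedFlow lam ξ.2.2.1 (A.q₁ ξ) := by
  filter_upwards [A.flow] with ξ h h0
  obtain ⟨h1, h2⟩ := h h0
  refine ⟨?_, ?_⟩
  · rw [q₁, h1, at'_unperturbedPath, Set.Icc.coe_one, mul_one]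
  · rw [q₂, h2, at'_unperturbedPath, Set.Icc.coe_one, mul_one]; rfl

theorem u₁_base : A.u₁ (shootingBase r α) = unperturbedPath lam (circlePoint r α, π - 2 * α) :=
  (A.flow.self_of_nhds rfl).1

theorem q₁_base : A.q₁ (shootingBase r α) = circlePoint r (π - α) := by
  rw [(A.eventually_q_eq.self_of_nhds rfl).1]
  simp only [shootingBase, unperturbedFlow_circlePoint]
  congr 1; ring

theorem u₂_base : A.u₂ (shootingBase r α) =
    unperturbedPath lam (circlePoint r (π - α), π + 2 * α) := by
  rw [(A.flow.self_of_nhds rfl).2, ← q₁, q₁_base]; rfl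

theorem q₂_base : A.q₂ (shootingBase r α) = circlePoint r α := by
  rw [(A.eventually_q_eq.self_of_nhds rfl).2, q₁_base]
  simp only [shootingBase, unperturbedFlow_circlePoint]
  rw [← circlePoint_add_two_pi r α]
  congr 1; ring

/-- The conserved quantities and `ε`, followed by the values of the switching function at the three
crossing points. -/
noncomputable def chart (f : Space → ℝ) (ξ : ShootingSpace) : (ℝ × ℝ × ℝ) × (ℝ × ℝ × ℝ) :=
  ((radiusSq ξ.1, offset ξ.1, ξ.2.2.2), (f ξ.1, f (A.q₁ ξ), f (A.q₂ ξ)))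

theorem chart_base (h : IsCrossingCircle lam f r α) :
    A.chart f (shootingBase r α) = ((r ^ 2, 0, 0), 0) := by
  have h1 : f (shootingBase r α).1 = 0 := h.start
  have h2 := radiusSq_circlePoint r α
  have h3 := offset_circlePoint r α
  simp only [chart, q₁_base, q₂_base, h.joint, h.start, h1]
  simp only [shootingBase, h2, h3]
  rfl

/-- Both spaces have dimension 6, so injectivity is enough. If R, s, ε and f at the initial point do
not vary to first order, neither does the initial point. Varying the durations then slides the end
points along the circle, transversally to the switching manifold, so the durations cannot vary
either. -/
theorem exists_chart_deriv (hf : ContDiff ℝ 1 f) (h : IsCrossingCircle lam f r α) :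
    ∃ e : ShootingSpace ≃L[ℝ] (ℝ × ℝ × ℝ) × (ℝ × ℝ × ℝ),
      HasStrictFDerivAt (A.chart f) (e : ShootingSpace →L[ℝ] (ℝ × ℝ × ℝ) × (ℝ × ℝ × ℝ))
        (shootingBase r α) := by
  obtain ⟨D₁, hD₁, hD₁'⟩ := hasStrictFDerivAt_radiusSq (circlePoint r α)
  obtain ⟨D₂, hD₂, hD₂'⟩ := hasStrictFDerivAt_offset (circlePoint r α)
  have hfs : ∀ p, HasStrictFDerivAt f (fderiv ℝ f p) p := fun p =>
    hf.contDiffAt.hasStrictFDerivAt one_ne_zero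
  have hfd := hf.differentiable one_ne_zero
  let π₀ : ShootingSpace →L[ℝ] Space := ContinuousLinearMap.fst ℝ _ _
  let πε : ShootingSpace →L[ℝ] ℝ := (ContinuousLinearMap.snd ℝ _ _).comp
    ((ContinuousLinearMap.snd ℝ _ _).comp (ContinuousLinearMap.snd ℝ _ _))
  have hπ₀ : HasStrictFDerivAt (fun ξ : ShootingSpace => ξ.1) π₀ (shootingBase r α) :=
    π₀.hasStrictFDerivAt
  have hπε : HasStrictFDerivAt (fun ξ : ShootingSpace => ξ.2.2.2) πε (shootingBase r α) :=
    πε.hasStrictFDerivAt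
  have e₁ : HasStrictFDerivAt (fun ξ : ShootingSpace => radiusSq ξ.1) (D₁.comp π₀)
      (shootingBase r α) := HasStrictFDerivAt.comp (g := radiusSq) _ hD₁ hπ₀
  have e₂ : HasStrictFDerivAt (fun ξ : ShootingSpace => offset ξ.1) (D₂.comp π₀)
      (shootingBase r α) := HasStrictFDerivAt.comp (g := offset) _ hD₂ hπ₀
  have e₃ : HasStrictFDerivAt (fun ξ : ShootingSpace => f ξ.1)
      ((fderiv ℝ f (circlePoint r α)).comp π₀) (shootingBase r α) :=
    HasStrictFDerivAt.comp (g := f) _ (hfs _) hπ₀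
  have e₄ := HasStrictFDerivAt.comp (g := f) _ (hfs _) A.hasStrictFDerivAt_q₁
  have e₅ := HasStrictFDerivAt.comp (g := f) _ (hfs _) A.hasStrictFDerivAt_q₂
  set G₁ := (fderiv ℝ f (A.q₁ (shootingBase r α))).comp ((at' 1).comp A.u₁')
  set G₂ := (fderiv ℝ f (A.q₂ (shootingBase r α))).comp ((at' 1).comp A.u₂')
  have hK := (e₁.prodMk (e₂.prodMk hπε)).prodMk (e₃.prodMk (e₄.prodMk e₅))
  -- Only directions that change the durations alone are needed. Along them ε = 0 and the end points
  -- are explicit points of the circle; the second one moves with both durations.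
  have hG : ∀ d₁ d₂ : ℝ,
      G₁ (0, d₁, d₂, 0) = d₁ * lieDeriv (unperturbedField lam) f (circlePoint r (π - α)) ∧
      G₂ (0, d₁, d₂, 0) = (d₁ + d₂) * lieDeriv (unperturbedField lam) f (circlePoint r α) := by
    intro d₁ d₂
    have hline : HasDerivAt (fun t : ℝ => shootingBase r α + t • ((0, d₁, d₂, 0) : ShootingSpace))
        (0, d₁, d₂, 0) 0 := by
      have := ((hasDerivAt_id (0 : ℝ)).smul_const ((0, d₁, d₂, 0) : ShootingSpace)).const_add
        (shootingBase r α)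
      rwa [one_smul] at this
    have hb : shootingBase r α = shootingBase r α + (0 : ℝ) • ((0, d₁, d₂, 0) : ShootingSpace) := by
      rw [zero_smul, add_zero]
    have hlt : Tendsto (fun t : ℝ => shootingBase r α + t • ((0, d₁, d₂, 0) : ShootingSpace)) (𝓝 0)
        (𝓝 (shootingBase r α)) := by
      have := hline.continuousAt.tendsto
      rwa [← hb] at this
    have hev : ∀ᶠ t in 𝓝 (0 : ℝ),
        A.q₁ (shootingBase r α + t • ((0, d₁, d₂, 0) : ShootingSpace)) =
          circlePoint r (π - α + t * d₁) ∧
        A.q₂ (shootingBase r α + t • ((0, d₁, d₂, 0) : ShootingSpace)) =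
          circlePoint r (α + t * (d₁ + d₂)) := by
      filter_upwards [hlt.eventually A.eventually_q_eq] with t ht
      obtain ⟨h1, h2⟩ := ht (by simp [shootingBase])
      have h3 : A.q₁ (shootingBase r α + t • ((0, d₁, d₂, 0) : ShootingSpace)) =
          circlePoint r (π - α + t * d₁) := by
        rw [h1]
        simp only [shootingBase, Prod.smul_mk, Prod.mk_add_mk, smul_zero, add_zero, smul_eq_mul,
          unperturbedFlow_circlePoint]
        congr 1; ring
      refine ⟨h3, ?_⟩
      rw [h2, h3]
      simp only [shootingBase, Prod.smul_mk, Prod.mk_add_mk, smul_eq_mul,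
          unperturbedFlow_circlePoint]
      rw [← circlePoint_add_two_pi r (α + _)]
      congr 1; ring
    have c₁ := (hb ▸ e₄.hasFDerivAt).comp_hasDerivAt (0 : ℝ) hline
    have c₂ := (hb ▸ e₅.hasFDerivAt).comp_hasDerivAt (0 : ℝ) hline
    have d₁' := (hasDerivAt_comp_circlePoint lam hfd r (π - α) d₁).congr_of_eventuallyEq
      (f₁ := (f ∘ A.q₁) ∘ fun t : ℝ => shootingBase r α + t • ((0, d₁, d₂, 0) : ShootingSpace))
      (hev.mono fun t ht => by simp only [Function.comp_apply, ht.1])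
    have d₂' := (hasDerivAt_comp_circlePoint lam hfd r α (d₁ + d₂)).congr_of_eventuallyEq
      (f₁ := (f ∘ A.q₂) ∘ fun t : ℝ => shootingBase r α + t • ((0, d₁, d₂, 0) : ShootingSpace))
      (hev.mono fun t ht => by simp only [Function.comp_apply, ht.2])
    exact ⟨c₁.unique d₁', c₂.unique d₂'⟩
  have hinv : (((D₁.comp π₀).prod ((D₂.comp π₀).prod πε)).prod
      (((fderiv ℝ f (circlePoint r α)).comp π₀).prod (G₁.prod G₂))).IsInvertible := by
    refine ContinuousLinearMap.isInvertible_of_injective_of_finrank_eq _ (fun v hv => ?_) (by simp)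
    obtain ⟨δ, d₁, d₂, dε⟩ := v
    simp only [ContinuousLinearMap.prod_apply, Prod.mk_eq_zero] at hv
    obtain ⟨⟨k1, k2, k3⟩, k4, k5, k6⟩ := hv
    have k3' : dε = 0 := k3
    have k1' : D₁ δ = 0 := k1
    have k2' : D₂ δ = 0 := k2
    rw [hD₁'] at k1'
    rw [hD₂'] at k2'
    have hδ : δ = 0 := eq_zero_of_transverse h.r_pos h.up.ne' k1' k2' k4
    subst hδ k3'
    rw [(hG d₁ d₂).1] at k5
    rw [(hG d₁ d₂).2] at k6
    have hd₁ : d₁ = 0 := (mul_eq_zero.1 k5).resolve_right h.down.ne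
    have hd₂ : d₁ + d₂ = 0 := (mul_eq_zero.1 k6).resolve_right h.up.ne'
    rw [hd₁, zero_add] at hd₂
    rw [hd₁, hd₂]
    rfl
  obtain ⟨e, he⟩ := hinv
  refine ⟨e, ?_⟩
  rw [he]
  exact hK

end Shooting

/-! ### Parametrisation of return loops by the conserved quantities -/

namespace Shooting

variable {lam : ℝ} {f : Space → ℝ} {Pp Pm : Fin 3 → MvPolynomial (Fin 3) ℝ} {r α : ℝ}
  (A : Shooting lam Pp Pm r α)

/-- This is the local inverse of the chart restricted to the slice where f vanishes at all three
points. Loops whose arcs start and end on the switching manifold are thus labelled by (R, s, ε). -/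
theorem exists_parametrization (hf : ContDiff ℝ 1 f) (h : IsCrossingCircle lam f r α) :
    ∃ (Ψ : ℝ × ℝ × ℝ → ShootingSpace) (Ψ' : ℝ × ℝ × ℝ →L[ℝ] ShootingSpace),
      HasStrictFDerivAt Ψ Ψ' (r ^ 2, 0, 0) ∧ Ψ (r ^ 2, 0, 0) = shootingBase r α ∧
      (∀ᶠ x in 𝓝 ((r ^ 2, 0, 0) : ℝ × ℝ × ℝ), A.chart f (Ψ x) = (x, 0)) ∧
      ∀ᶠ ξ in 𝓝 (shootingBase r α), (A.chart f ξ).2 = 0 → Ψ (A.chart f ξ).1 = ξ := by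
  obtain ⟨e, he⟩ := A.exists_chart_deriv hf h
  have hb := A.chart_base h
  have h1 := he.to_localInverse
  have h2 := he.eventually_right_inverse
  have h3 := he.eventually_left_inverse
  have h4 := he.localInverse_apply_image
  set J := he.localInverse (A.chart f) e (shootingBase r α)
  rw [hb] at h1 h2 h4
  let ι : ℝ × ℝ × ℝ →L[ℝ] (ℝ × ℝ × ℝ) × (ℝ × ℝ × ℝ) := ContinuousLinearMap.inl ℝ _ _
  have hι : HasStrictFDerivAt (fun x : ℝ × ℝ × ℝ => ((x, 0) : (ℝ × ℝ × ℝ) × (ℝ × ℝ × ℝ))) ι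
    (r ^ 2, 0, 0) := ι.hasStrictFDerivAt
  refine ⟨fun x => J (x, 0), _, HasStrictFDerivAt.comp (g := J) _ h1 hι, h4, ?_, ?_⟩
  · have : Tendsto (fun x : ℝ × ℝ × ℝ => ((x, 0) : (ℝ × ℝ × ℝ) × (ℝ × ℝ × ℝ)))
        (𝓝 (r ^ 2, 0, 0)) (𝓝 ((r ^ 2, 0, 0), 0)) := Continuous.tendsto' (by fun_prop) _ _ rfl
    exact this.eventually h2
  · filter_upwards [h3] with ξ hξ h0
    rw [← h0]
    exact hξ

/-- The point with given values of the conserved quantities is found back by the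
parametrisation. -/
theorem eventually_parametrization_fst (hf : ContDiff ℝ 1 f) (h : IsCrossingCircle lam f r α)
    {Ψ : ℝ × ℝ × ℝ → ShootingSpace} (hΨ : ContinuousAt Ψ (r ^ 2, 0, 0))
    (hΨ0 : Ψ (r ^ 2, 0, 0) = shootingBase r α)
    (hΨe : ∀ᶠ x in 𝓝 ((r ^ 2, 0, 0) : ℝ × ℝ × ℝ), A.chart f (Ψ x) = (x, 0)) :
    ∀ᶠ y : Space × ℝ in 𝓝 (circlePoint r α, 0), f y.1 = 0 →
      (Ψ (radiusSq y.1, offset y.1, y.2)).1 = y.1 := by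
  obtain ⟨D₁, hD₁, hD₁'⟩ := hasStrictFDerivAt_radiusSq (circlePoint r α)
  obtain ⟨D₂, hD₂, hD₂'⟩ := hasStrictFDerivAt_offset (circlePoint r α)
  have hfs : HasStrictFDerivAt f (fderiv ℝ f (circlePoint r α)) (circlePoint r α) :=
    hf.contDiffAt.hasStrictFDerivAt one_ne_zero
  have hinv : (D₁.prod (D₂.prod (fderiv ℝ f (circlePoint r α)))).IsInvertible := by
    refine ContinuousLinearMap.isInvertible_of_injective_of_finrank_eq _ (fun v hv => ?_) (by simp)
    simp only [ContinuousLinearMap.prod_apply, Prod.mk_eq_zero] at hv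
    exact eq_zero_of_transverse h.r_pos h.up.ne' (hD₁' v ▸ hv.1) (hD₂' v ▸ hv.2.1) hv.2.2
  obtain ⟨e, he⟩ := hinv
  have hg := hD₁.prodMk (hD₂.prodMk hfs)
  rw [← he] at hg
  have hleft := hg.eventually_left_inverse
  have hc₁ : Continuous radiusSq := by unfold radiusSq; fun_prop
  have hc₂ : Continuous offset := by unfold offset; fun_prop
  have ht : Tendsto (fun y : Space × ℝ => ((radiusSq y.1, offset y.1, y.2) : ℝ × ℝ × ℝ))
      (𝓝 (circlePoint r α, 0)) (𝓝 (r ^ 2, 0, 0)) := by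
    refine Continuous.tendsto' (by fun_prop) _ _ ?_
    rw [radiusSq_circlePoint, offset_circlePoint]
  have ht1 : Tendsto (fun y : Space × ℝ => y.1) (𝓝 (circlePoint r α, 0))
      (𝓝 (circlePoint r α)) := continuous_fst.tendsto' _ _ rfl
  have ht2 : Tendsto (fun y : Space × ℝ => (Ψ (radiusSq y.1, offset y.1, y.2)).1)
      (𝓝 (circlePoint r α, 0)) (𝓝 (circlePoint r α)) := by
    have h1 := hΨ.tendsto.comp ht
    rw [hΨ0] at h1
    exact (continuous_fst.tendsto _).comp h1
  filter_upwards [ht1.eventually hleft, ht2.eventually hleft, ht.eventually hΨe]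
    with y hy1 hy2 hy3 hy4
  -- Both points have the same values of R, s and f, which are local coordinates near the crossing
  -- point.
  rw [← hy2]
  conv_rhs => rw [← hy1]
  have k1 : radiusSq (Ψ (radiusSq y.1, offset y.1, y.2)).1 = radiusSq y.1 :=
    congrArg (fun z => z.1.1) hy3
  have k2 : offset (Ψ (radiusSq y.1, offset y.1, y.2)).1 = offset y.1 :=
    congrArg (fun z => z.1.2.1) hy3
  have k3 : f (Ψ (radiusSq y.1, offset y.1, y.2)).1 = 0 := congrArg (fun z => z.2.1) hy3
  rw [k1, k2, k3, hy4]

theorem eventually_crossesUp (hf : ContDiff ℝ 1 f) (h : IsCrossingCircle lam f r α) :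
    ∀ᶠ y : Space × ℝ in 𝓝 (circlePoint r α, 0), f y.1 = 0 →
      (perturbedSystem lam y.2 f Pp Pm).CrossesUp y.1 := by
  have hup : ∀ P, 0 < lieDeriv (perturbedField lam 0 P) f (circlePoint r α) := fun P => by
    rw [perturbedField_zero]; exact h.up
  have h1 := (isOpen_lt continuous_const (continuous_lieDeriv_perturbedField lam Pp hf)).mem_nhds
    (x := (circlePoint r α, 0)) (hup Pp)
  have h2 := (isOpen_lt continuous_const (continuous_lieDeriv_perturbedField lam Pm hf)).mem_nhds
    (x := (circlePoint r α, 0)) (hup Pm)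
  filter_upwards [h1, h2] with y h1 h2 h3
  exact ⟨h3, h1, h2⟩

theorem eventually_crossesDown (hf : ContDiff ℝ 1 f) (h : IsCrossingCircle lam f r α) :
    ∀ᶠ y : Space × ℝ in 𝓝 (circlePoint r (π - α), 0), f y.1 = 0 →
      (perturbedSystem lam y.2 f Pp Pm).CrossesDown y.1 := by
  have hdown : ∀ P, lieDeriv (perturbedField lam 0 P) f (circlePoint r (π - α)) < 0 := fun P => by
    rw [perturbedField_zero]; exact h.down
  have h1 := (isOpen_lt (continuous_lieDeriv_perturbedField lam Pp hf) continuous_const).mem_nhds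
    (x := (circlePoint r (π - α), 0)) (hdown Pp)
  have h2 := (isOpen_lt (continuous_lieDeriv_perturbedField lam Pm hf) continuous_const).mem_nhds
    (x := (circlePoint r (π - α), 0)) (hdown Pm)
  filter_upwards [h1, h2] with y h1 h2 h3
  exact ⟨h3, h1, h2⟩

/-- The signs of f along the two arcs and the transversality at the crossings persist near the
circle. The durations add up to 2π there, hence to more than π nearby; this is the uniform lower
bound used to exclude accumulation of crossings. -/
theorem eventually_isReturnLoop (hf : ContDiff ℝ 1 f) (h : IsCrossingCircle lam f r α) :
    ∀ᶠ ξ in 𝓝 (shootingBase r α), f ξ.1 = 0 → f (A.q₁ ξ) = 0 → f (A.q₂ ξ) = 0 →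
      π ≤ ξ.2.1 + ξ.2.2.1 ∧ ∃ γ₁ γ₂ : ℝ → Space,
        (perturbedSystem lam ξ.2.2.2 f Pp Pm).IsReturnLoop ξ.1 ξ.2.1 ξ.2.2.1 γ₁ γ₂ ∧
        γ₂ ξ.2.2.1 = A.q₂ ξ ∧ (γ₁ '' Set.Icc 0 ξ.2.1 = Set.range fun s => at' s (A.u₁ ξ)) ∧
        γ₂ '' Set.Icc 0 ξ.2.2.1 = Set.range fun s => at' s (A.u₂ ξ) := by
  have hα := h.nonneg
  have hα' := h.lt_half_pi
  have hπ := pi_pos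
  have hT₁ : 0 < π - 2 * α := by linarith
  have hT₂ : 0 < π + 2 * α := by linarith
  have p₁ := eventually_pos_of_isSolutionPath (P := Pp) (lam := lam) hf
    (q₀ := (circlePoint r α, π - 2 * α, 0))
    (u₀ := unperturbedPath lam (circlePoint r α, π - 2 * α)) hT₁
    (by
      rw [perturbedField_zero, at'_unperturbedPath, unperturbedFlow_circlePoint]
      simpa using h.up)
    (by
      rw [perturbedField_zero, at'_unperturbedPath, unperturbedFlow_circlePoint]
      have := h.down
      rwa [show π - α = α + (π - 2 * α) * ((1 : unitInterval) : ℝ) by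
        simp only [Set.Icc.coe_one]; ring] at this)
    (by
      intro s hs0 hs1
      rw [at'_unperturbedPath, unperturbedFlow_circlePoint]
      have h0 := unitInterval.pos_iff_ne_zero.2 hs0
      have h1 := unitInterval.lt_one_iff_ne_one.2 hs1
      have h0' : (0 : ℝ) < s := h0
      have h1' : (s : ℝ) < 1 := h1
      exact h.pos _ ⟨by nlinarith, by nlinarith⟩)
  have p₂ := eventually_pos_of_isSolutionPath (P := Pm) (lam := lam) hf.neg
    (q₀ := (circlePoint r (π - α), π + 2 * α, 0))
    (u₀ := unperturbedPath lam (circlePoint r (π - α), π + 2 * α)) hT₂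
    (by
      rw [perturbedField_zero, at'_unperturbedPath, unperturbedFlow_circlePoint,
        PiecewiseField.lieDeriv_neg, neg_pos]
      simpa using h.down)
    (by
      rw [perturbedField_zero, at'_unperturbedPath, unperturbedFlow_circlePoint,
        PiecewiseField.lieDeriv_neg, neg_lt_zero]
      have := h.up
      rw [← circlePoint_add_two_pi] at this
      rwa [show α + 2 * π = π - α + (π + 2 * α) * ((1 : unitInterval) : ℝ) by
        simp only [Set.Icc.coe_one]; ring] at this)
    (by
      intro s hs0 hs1
      rw [at'_unperturbedPath, unperturbedFlow_circlePoint]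
      have h0 := unitInterval.pos_iff_ne_zero.2 hs0
      have h1 := unitInterval.lt_one_iff_ne_one.2 hs1
      have h0' : (0 : ℝ) < s := h0
      have h1' : (s : ℝ) < 1 := h1
      exact neg_pos.2 (h.neg _ ⟨by nlinarith, by nlinarith⟩))
  have cu₁ := A.deriv₁.continuousAt
  have cu₂ := A.deriv₂.continuousAt
  have cq₁ := A.hasStrictFDerivAt_q₁.continuousAt
  have cq₂ := A.hasStrictFDerivAt_q₂.continuousAt
  have cε : ContinuousAt (fun ξ : ShootingSpace => ξ.2.2.2) (shootingBase r α) :=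
    Continuous.continuousAt (by fun_prop)
  have t₁ : Tendsto (fun ξ : ShootingSpace => (((ξ.1, ξ.2.1, ξ.2.2.2) : Space × ℝ × ℝ), A.u₁ ξ))
      (𝓝 (shootingBase r α)) (𝓝 ((circlePoint r α, π - 2 * α, 0),
        unperturbedPath lam (circlePoint r α, π - 2 * α))) := by
    have : ContinuousAt (fun ξ : ShootingSpace => ((ξ.1, ξ.2.1, ξ.2.2.2) : Space × ℝ × ℝ))
      (shootingBase r α) := Continuous.continuousAt (by fun_prop)
    rw [← u₁_base A]
    exact this.prodMk cu₁
  have t₂ : Tendsto (fun ξ : ShootingSpace =>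
      (((A.q₁ ξ, ξ.2.2.1, ξ.2.2.2) : Space × ℝ × ℝ), A.u₂ ξ))
      (𝓝 (shootingBase r α)) (𝓝 ((circlePoint r (π - α), π + 2 * α, 0),
        unperturbedPath lam (circlePoint r (π - α), π + 2 * α))) := by
    have : ContinuousAt (fun ξ : ShootingSpace => ξ.2.2) (shootingBase r α) :=
      Continuous.continuousAt (by fun_prop)
    rw [← u₂_base A, ← q₁_base A]
    exact (cq₁.prodMk this).prodMk cu₂
  have t₃ : Tendsto (fun ξ : ShootingSpace => (A.q₁ ξ, ξ.2.2.2)) (𝓝 (shootingBase r α))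
      (𝓝 (circlePoint r (π - α), 0)) := by
    rw [← q₁_base A]; exact cq₁.prodMk cε
  have t₄ : Tendsto (fun ξ : ShootingSpace => (A.q₂ ξ, ξ.2.2.2)) (𝓝 (shootingBase r α))
      (𝓝 (circlePoint r α, 0)) := by
    rw [← q₂_base A]; exact cq₂.prodMk cε
  have n₁ : ∀ᶠ ξ in 𝓝 (shootingBase r α), 0 < ξ.2.1 :=
    (isOpen_lt continuous_const (by fun_prop)).mem_nhds hT₁
  have n₂ : ∀ᶠ ξ in 𝓝 (shootingBase r α), 0 < ξ.2.2.1 :=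
    (isOpen_lt continuous_const (by fun_prop)).mem_nhds hT₂
  have n₃ : ∀ᶠ ξ in 𝓝 (shootingBase r α), π < ξ.2.1 + ξ.2.2.1 :=
    (isOpen_lt continuous_const (by fun_prop)).mem_nhds
      (show π < π - 2 * α + (π + 2 * α) by linarith)
  filter_upwards [A.sol₁, A.sol₂, t₁.eventually p₁, t₂.eventually p₂,
    t₃.eventually (eventually_crossesDown (Pp := Pp) (Pm := Pm) hf h),
    t₄.eventually (eventually_crossesUp (Pp := Pp) (Pm := Pm) hf h), n₁, n₂, n₃]
    with ξ s₁ s₂ p₁ p₂ hd hu n₁ n₂ n₃ k₀ k₁ k₂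
  refine ⟨n₃.le, exists_isReturnLoop s₁ s₂ n₁ n₂ (p₁ s₁ ?_ k₁) (p₂ s₂ ?_ ?_) (hd k₁) (hu k₂)⟩
  · rw [s₁.at'_zero]; exact k₀
  · rw [s₂.at'_zero]; exact neg_eq_zero.2 k₁
  · exact neg_eq_zero.2 k₂

/-- The increment of `radiusSq` along the two arcs, divided by `ε`. -/
noncomputable def drift (ξ : ShootingSpace) : ℝ :=
  ξ.2.1 * primitive (radialOp Pp (A.u₁ ξ)) 1 + ξ.2.2.1 * primitive (radialOp Pm (A.u₂ ξ)) 1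

theorem eventually_radiusSq_q₂ : ∀ᶠ ξ in 𝓝 (shootingBase r α),
    radiusSq (A.q₂ ξ) = radiusSq ξ.1 + ξ.2.2.2 * A.drift ξ := by
  filter_upwards [A.sol₁, A.sol₂] with ξ s₁ s₂
  have h₁ := s₁.radiusSq_at'_one
  have h₂ := s₂.radiusSq_at'_one
  simp only at h₁ h₂
  rw [q₂, h₂, h₁, drift]
  ring

theorem exists_drift_deriv :
    ∃ D : ShootingSpace →L[ℝ] ℝ, HasStrictFDerivAt A.drift D (shootingBase r α) := by
  let ev : C(unitInterval, ℝ) →L[ℝ] ℝ := (ContinuousMap.evalCLM ℝ 1).comp primitive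
  have hr : ∀ (P : Fin 3 → MvPolynomial (Fin 3) ℝ) (u : PathSpace),
      HasStrictFDerivAt (radialOp P) (fderiv ℝ (radialOp P) u) u := fun P u =>
    (contDiff_radialOp (n := 1) P).contDiffAt.hasStrictFDerivAt one_ne_zero
  have h₁ := ev.hasStrictFDerivAt.comp _ ((hr Pp _).comp _ A.deriv₁)
  have h₂ := ev.hasStrictFDerivAt.comp _ ((hr Pm _).comp _ A.deriv₂)
  let π₁ : ShootingSpace →L[ℝ] ℝ :=
    (ContinuousLinearMap.fst ℝ _ _).comp (ContinuousLinearMap.snd ℝ _ _)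
  let π₂ : ShootingSpace →L[ℝ] ℝ := (ContinuousLinearMap.fst ℝ _ _).comp
    ((ContinuousLinearMap.snd ℝ _ _).comp (ContinuousLinearMap.snd ℝ _ _))
  have c₁ : HasStrictFDerivAt (fun ξ : ShootingSpace => ξ.2.1) π₁ (shootingBase r α) :=
    π₁.hasStrictFDerivAt
  have c₂ : HasStrictFDerivAt (fun ξ : ShootingSpace => ξ.2.2.1) π₂ (shootingBase r α) :=
    π₂.hasStrictFDerivAt
  exact ⟨_, (c₁.mul h₁).add (c₂.mul h₂)⟩

theorem exists_offset_q₂_deriv : ∃ D : ShootingSpace →L[ℝ] ℝ,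
    HasStrictFDerivAt (fun ξ => offset (A.q₂ ξ)) D (shootingBase r α) := by
  obtain ⟨D, hD, -⟩ := hasStrictFDerivAt_offset (A.q₂ (shootingBase r α))
  exact ⟨_, HasStrictFDerivAt.comp (g := offset) _ hD A.hasStrictFDerivAt_q₂⟩

end Shooting

/-! ### Derivatives of the return map at a simple zero -/

/-- The member of index `k` of a one-parameter family of unperturbed crossing orbits is a simple
zero of the averaged function. -/
structure IsSimpleCrossingCircle (lam : ℝ) (f : Space → ℝ)
    (Pp Pm : Fin 3 → MvPolynomial (Fin 3) ℝ) (ρ a : ℝ → ℝ) (k : ℝ) : Prop where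
  circle : IsCrossingCircle lam f (ρ k) (a k)
  start : ∀ᶠ j in 𝓝 k, f (circlePoint (ρ j) (a j)) = 0
  joint : ∀ᶠ j in 𝓝 k, f (circlePoint (ρ j) (π - a j)) = 0
  differentiableAt : DifferentiableAt ℝ ρ k
  continuousAt : ContinuousAt a k
  zero : melnikov Pp Pm (ρ k) (a k) = 0
  simple : ∃ M' ≠ 0, HasDerivAt (fun j => melnikov Pp Pm (ρ j) (a j)) M' k

/-- The difference quotient at 0 is g itself, so continuity of g suffices. It is used with g the
factor by which the offset is multiplied over one loop. -/
theorem hasDerivAt_id_mul_of_continuousAt {g : ℝ → ℝ} (hg : ContinuousAt g 0) :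
    HasDerivAt (fun s => s * g s) (g 0) 0 := by
  rw [hasDerivAt_iff_tendsto_slope]
  refine (hg.tendsto.mono_left nhdsWithin_le_nhds).congr' ?_
  filter_upwards [self_mem_nhdsWithin] with s hs
  rw [slope_def_field, zero_mul, sub_zero, sub_zero, mul_div_cancel_left₀ _ hs]

namespace Shooting

variable {lam : ℝ} {f : Space → ℝ} {Pp Pm : Fin 3 → MvPolynomial (Fin 3) ℝ} {r α : ℝ}

theorem chart_shootingBase (A : Shooting lam Pp Pm r α) {r₁ α₁ : ℝ}
    (hq : A.q₁ (shootingBase r₁ α₁) = unperturbedFlow lam (π - 2 * α₁) (circlePoint r₁ α₁) ∧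
      A.q₂ (shootingBase r₁ α₁) =
        unperturbedFlow lam (π + 2 * α₁) (A.q₁ (shootingBase r₁ α₁)))
    (h₁ : f (circlePoint r₁ α₁) = 0) (h₂ : f (circlePoint r₁ (π - α₁)) = 0) :
    A.chart f (shootingBase r₁ α₁) = ((r₁ ^ 2, 0, 0), 0) := by
  obtain ⟨e1, e2⟩ := hq
  have e1' : A.q₁ (shootingBase r₁ α₁) = circlePoint r₁ (π - α₁) := by
    rw [e1, unperturbedFlow_circlePoint]; congr 1; ring
  have e2' : A.q₂ (shootingBase r₁ α₁) = circlePoint r₁ α₁ := by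
    rw [e2, e1', unperturbedFlow_circlePoint, ← circlePoint_add_two_pi r₁ α₁]; congr 1; ring
  simp only [chart, e1', e2', h₂]
  simp only [shootingBase, h₁, radiusSq_circlePoint, offset_circlePoint]
  rfl

theorem drift_shootingBase (A : Shooting lam Pp Pm r α) {r₁ α₁ : ℝ}
    (hu : A.u₁ (shootingBase r₁ α₁) = unperturbedPath lam (circlePoint r₁ α₁, π - 2 * α₁) ∧
      A.u₂ (shootingBase r₁ α₁) =
        unperturbedPath lam (at' 1 (A.u₁ (shootingBase r₁ α₁)), π + 2 * α₁)) :
    A.drift (shootingBase r₁ α₁) = melnikov Pp Pm r₁ α₁ := by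
  obtain ⟨e1, e2⟩ := hu
  have e3 : at' 1 (A.u₁ (shootingBase r₁ α₁)) = circlePoint r₁ (π - α₁) := by
    rw [e1, at'_unperturbedPath, unperturbedFlow_circlePoint, Set.Icc.coe_one]; congr 1; ring
  rw [drift, e2, e3, e1]
  simp only [shootingBase]
  rw [mul_primitive_radialOp, mul_primitive_radialOp, melnikov]
  congr 2 <;> ring

/-- For ε = 0 and offset 0 the drift along the family of circles is `melnikov` and the returned
offset is 0, which gives the derivatives in the first variable. For ε = 0 and fixed radius, the
offset is multiplied by the exponential of -λ times the total duration, which is 2π on the circle.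
-/
theorem hyperbolic {ρ a : ℝ → ℝ} {k : ℝ} (A : Shooting lam Pp Pm (ρ k) (a k))
    (h : IsSimpleCrossingCircle lam f Pp Pm ρ a k)
    {Ψ : ℝ × ℝ × ℝ → ShootingSpace} (hΨ : ContinuousAt Ψ (ρ k ^ 2, 0, 0))
    (hΨ0 : Ψ (ρ k ^ 2, 0, 0) = shootingBase (ρ k) (a k))
    (hΨe : ∀ᶠ x in 𝓝 ((ρ k ^ 2, 0, 0) : ℝ × ℝ × ℝ), A.chart f (Ψ x) = (x, 0))
    (hΨl : ∀ᶠ ξ in 𝓝 (shootingBase (ρ k) (a k)), (A.chart f ξ).2 = 0 → Ψ (A.chart f ξ).1 = ξ)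
    {a' b' : ℝ × ℝ × ℝ →L[ℝ] ℝ}
    (ha' : HasStrictFDerivAt (fun x => A.drift (Ψ x)) a' (ρ k ^ 2, 0, 0))
    (hb' : HasStrictFDerivAt (fun x => offset (A.q₂ (Ψ x))) b' (ρ k ^ 2, 0, 0)) :
    A.drift (Ψ (ρ k ^ 2, 0, 0)) = 0 ∧ offset (A.q₂ (Ψ (ρ k ^ 2, 0, 0))) = 0 ∧
      a' (1, 0, 0) ≠ 0 ∧ b' (1, 0, 0) = 0 ∧ b' (0, 1, 0) = exp (-(lam * (2 * π))) := by
  obtain ⟨M', hM', hM⟩ := h.simple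
  have hρ := h.differentiableAt.hasDerivAt
  set ρ' := deriv ρ k
  have hbase : Tendsto (fun j => shootingBase (ρ j) (a j)) (𝓝 k)
      (𝓝 (shootingBase (ρ k) (a k))) := by
    have hρc := hρ.continuousAt
    have hac := h.continuousAt
    have hc : ContinuousAt (fun j => circlePoint (ρ j) (a j)) k :=
      ContinuousAt.comp (g := fun q : ℝ × ℝ => circlePoint q.1 q.2)
        continuous_circlePoint.continuousAt (hρc.prodMk hac)
    exact hc.prodMk ((continuousAt_const.sub (continuousAt_const.mul hac)).prodMk
      ((continuousAt_const.add (continuousAt_const.mul hac)).prodMk continuousAt_const))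
  have hΨk : ∀ᶠ j in 𝓝 k, Ψ (ρ j ^ 2, 0, 0) = shootingBase (ρ j) (a j) := by
    filter_upwards [hbase.eventually A.eventually_q_eq, h.start, h.joint, hbase.eventually hΨl]
      with j h1 h2 h3 h4
    have := A.chart_shootingBase (h1 rfl) h2 h3
    rw [this] at h4
    exact h4 rfl
  have hak : (fun j => A.drift (Ψ (ρ j ^ 2, 0, 0))) =ᶠ[𝓝 k] fun j => melnikov Pp Pm (ρ j) (a j) := by
    filter_upwards [hbase.eventually A.flow, hΨk] with j h1 h2
    rw [h2]
    exact A.drift_shootingBase (h1 rfl)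
  have hbk : (fun j => offset (A.q₂ (Ψ (ρ j ^ 2, 0, 0)))) =ᶠ[𝓝 k] fun _ => 0 := by
    filter_upwards [hbase.eventually A.eventually_q_eq, hΨk] with j h1 h2
    obtain ⟨e1, e2⟩ := h1 rfl
    rw [h2, e2, e1]
    simp only [shootingBase, unperturbedFlow_circlePoint, offset_circlePoint]
  have hline : HasDerivAt (fun j => ((ρ j ^ 2, 0, 0) : ℝ × ℝ × ℝ))
      ((2 * ρ k * ρ', 0, 0) : ℝ × ℝ × ℝ) k := by
    have := hρ.fun_pow 2
    refine HasDerivAt.prodMk (this.congr_deriv (by norm_num)) (hasDerivAt_const _ _)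
  have hsm : ((2 * ρ k * ρ', 0, 0) : ℝ × ℝ × ℝ) = (2 * ρ k * ρ') • ((1, 0, 0) : ℝ × ℝ × ℝ) := by
    simp
  have c₁ := HasDerivAt.unique (HasFDerivAt.comp_hasDerivAt
    (f := fun j => ((ρ j ^ 2, 0, 0) : ℝ × ℝ × ℝ)) k ha'.hasFDerivAt hline)
    (hM.congr_of_eventuallyEq hak)
  have c₂ := HasDerivAt.unique (HasFDerivAt.comp_hasDerivAt
    (f := fun j => ((ρ j ^ 2, 0, 0) : ℝ × ℝ × ℝ)) k hb'.hasFDerivAt hline)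
    ((hasDerivAt_const k (0 : ℝ)).congr_of_eventuallyEq hbk)
  rw [hsm, map_smul, smul_eq_mul] at c₁ c₂
  -- Since M' is the product of 2ρρ' and `a' (1, 0, 0)`, its non-vanishing shows that both factors
  -- are nonzero. In particular ρ' ≠ 0, which is what allows division in the equation for b'.
  rw [← c₁] at hM'
  refine ⟨hak.self_of_nhds.trans h.zero, hbk.self_of_nhds, right_ne_zero_of_mul hM',
    (mul_eq_zero.1 c₂).resolve_left (left_ne_zero_of_mul hM'), ?_⟩
  have hl2 : HasDerivAt (fun s : ℝ => ((ρ k ^ 2, s, 0) : ℝ × ℝ × ℝ)) ((0, 1, 0) : ℝ × ℝ × ℝ) 0 :=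
    (hasDerivAt_const _ _).prodMk ((hasDerivAt_id _).prodMk (hasDerivAt_const _ _))
  have hΨc : ContinuousAt (fun s : ℝ => Ψ (ρ k ^ 2, s, 0)) 0 :=
    ContinuousAt.comp (g := Ψ) hΨ hl2.continuousAt
  have hΨt : Tendsto (fun s : ℝ => Ψ (ρ k ^ 2, s, 0)) (𝓝 0) (𝓝 (shootingBase (ρ k) (a k))) := by
    rw [← hΨ0]; exact hΨc
  have hs : (fun s : ℝ => offset (A.q₂ (Ψ (ρ k ^ 2, s, 0)))) =ᶠ[𝓝 0] fun s =>
      s * exp (-(lam * ((Ψ (ρ k ^ 2, s, 0)).2.1 + (Ψ (ρ k ^ 2, s, 0)).2.2.1))) := by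
    have ht : Tendsto (fun s : ℝ => ((ρ k ^ 2, s, 0) : ℝ × ℝ × ℝ)) (𝓝 0) (𝓝 (ρ k ^ 2, 0, 0)) :=
      hl2.continuousAt
    filter_upwards [hΨt.eventually A.eventually_q_eq, ht.eventually hΨe] with s h1 h2
    have h3 : offset (Ψ (ρ k ^ 2, s, 0)).1 = s := congrArg (fun z => z.1.2.1) h2
    have h4 : (Ψ (ρ k ^ 2, s, 0)).2.2.2 = 0 := congrArg (fun z => z.1.2.2) h2
    obtain ⟨e1, e2⟩ := h1 h4
    rw [e2, e1, offset_unperturbedFlow, offset_unperturbedFlow, h3, mul_assoc, ← exp_add]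
    congr 2
    ring
  have hd := hasDerivAt_id_mul_of_continuousAt (g := fun s =>
    exp (-(lam * ((Ψ (ρ k ^ 2, s, 0)).2.1 + (Ψ (ρ k ^ 2, s, 0)).2.2.1))))
    (by
      refine continuous_exp.continuousAt.comp (ContinuousAt.neg (continuousAt_const.mul ?_))
      exact hΨc.snd.fst.add hΨc.snd.snd.fst)
  have := (HasFDerivAt.comp_hasDerivAt (f := fun s : ℝ => ((ρ k ^ 2, s, 0) : ℝ × ℝ × ℝ)) 0
    hb'.hasFDerivAt hl2).unique (hd.congr_of_eventuallyEq hs)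
  rw [this, hΨ0]
  simp only [shootingBase]
  congr 3
  ring

end Shooting

/-! ### Orbits near a crossing circle, and isolation in a tube -/

theorem PathSpace.edist_at'_le (s : unitInterval) (u v : PathSpace) :
    edist (at' s u) (at' s v) ≤ edist u v := by
  refine edist_pi_le_iff.2 fun i => le_trans ?_ (edist_le_pi_edist u v i)
  rw [edist_dist, edist_dist]
  exact ENNReal.ofReal_le_ofReal (ContinuousMap.dist_apply_le_dist s)

namespace IsCrossingCircle

variable {lam : ℝ} {f : Space → ℝ} {r α : ℝ}

theorem _root_.exists_mem_Ico_circlePoint_eq (r α θ : ℝ) :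
    ∃ φ ∈ Set.Ico α (α + 2 * π), circlePoint r θ = circlePoint r φ :=
  Function.Periodic.exists_mem_Ico (fun θ => circlePoint_add_two_pi r θ) two_pi_pos θ α

theorem eq_or_ne_zero (h : IsCrossingCircle lam f r α) (θ : ℝ) :
    circlePoint r θ = circlePoint r α ∨ circlePoint r θ = circlePoint r (π - α) ∨
      f (circlePoint r θ) ≠ 0 := by
  obtain ⟨φ, ⟨h1, h2⟩, h3⟩ := exists_mem_Ico_circlePoint_eq r α θ
  rw [h3]
  rcases h1.eq_or_lt with h4 | h4
  · exact Or.inl (by rw [h4])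
  rcases lt_trichotomy φ (π - α) with h5 | h5 | h5
  · exact Or.inr (Or.inr (h.pos φ ⟨h4, h5⟩).ne')
  · exact Or.inr (Or.inl (by rw [h5]))
  · exact Or.inr (Or.inr (h.neg φ ⟨h5, by linarith⟩).ne)

theorem circlePoint_of_cos_eq_zero {r θ : ℝ} (h : circlePoint r θ 0 = 0) (hr : 0 < r) :
    (circlePoint r θ 1 < 0 ∧ circlePoint r θ = circlePoint r (3 * π / 2)) ∨
      (0 < circlePoint r θ 1 ∧ circlePoint r θ = circlePoint r (π / 2)) := by
  have hc : cos θ = 0 := (mul_eq_zero.1 h).resolve_left hr.ne'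
  have hc' : cos (3 * π / 2) = 0 := by
    rw [show 3 * π / 2 = π / 2 + π by ring, cos_add_pi, cos_pi_div_two, neg_zero]
  have hs' : sin (3 * π / 2) = -1 := by
    rw [show 3 * π / 2 = π / 2 + π by ring, sin_add_pi, sin_pi_div_two]
  have hsq : (sin θ) ^ 2 = 1 := by nlinarith [sin_sq_add_cos_sq θ]
  rcases eq_or_eq_neg_of_sq_eq_sq _ 1 (hsq.trans (one_pow 2).symm) with hs | hs
  · refine Or.inr ⟨?_, ?_⟩
    · simp [circlePoint, hs, hr]
    · simp [circlePoint, hs, hc]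
  · refine Or.inl ⟨?_, ?_⟩
    · simp [circlePoint, hs, hr]
    · simp [circlePoint, hs, hc, hc', hs']

/-- Since 0 ≤ α < π/2, the angle 3π/2 lies in the open arc where f < 0. A curve near the circle that
stays in f > 0 thus misses the half-plane x = 0, y ≤ 0 and cannot rotate fully around the axis. -/
theorem neg_or_slit (h : IsCrossingCircle lam f r α) (θ : ℝ) :
    f (circlePoint r θ) < 0 ∨ 0 < circlePoint r θ 1 ∨ circlePoint r θ 0 ≠ 0 := by
  by_cases hx : circlePoint r θ 0 = 0
  · rcases circlePoint_of_cos_eq_zero hx h.r_pos with ⟨-, h1⟩ | ⟨h1, -⟩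
    · have := h.nonneg
      have := h.lt_half_pi
      rw [h1]
      exact Or.inl (h.neg _ ⟨by linarith, by linarith⟩)
    · exact Or.inr (Or.inl h1)
  · exact Or.inr (Or.inr hx)

theorem pos_or_slit (h : IsCrossingCircle lam f r α) (θ : ℝ) :
    0 < f (circlePoint r θ) ∨ circlePoint r θ 1 < 0 ∨ circlePoint r θ 0 ≠ 0 := by
  by_cases hx : circlePoint r θ 0 = 0
  · rcases circlePoint_of_cos_eq_zero hx h.r_pos with ⟨h1, -⟩ | ⟨-, h1⟩
    · exact Or.inr (Or.inl h1)
    · have := h.nonneg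
      have := h.lt_half_pi
      rw [h1]
      exact Or.inl (h.pos _ ⟨by linarith, by linarith⟩)
  · exact Or.inr (Or.inr hx)

end IsCrossingCircle

theorem rotation_pos {lam r : ℝ} (hr : 0 < r) (P : Fin 3 → MvPolynomial (Fin 3) ℝ) (θ : ℝ) :
    0 < circlePoint r θ 0 * perturbedField lam 0 P (circlePoint r θ) 1 -
      circlePoint r θ 1 * perturbedField lam 0 P (circlePoint r θ) 0 := by
  have : circlePoint r θ 0 * perturbedField lam 0 P (circlePoint r θ) 1 -
      circlePoint r θ 1 * perturbedField lam 0 P (circlePoint r θ) 0 = r ^ 2 := by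
    rw [perturbedField_zero]
    simp [circlePoint, unperturbedField]
    linear_combination r ^ 2 * sin_sq_add_cos_sq θ
  rw [this]
  positivity

theorem neg_I_mul_mem_slitPlane {x y : ℝ} (h : 0 < y ∨ x ≠ 0) :
    -Complex.I * ⟨x, y⟩ ∈ Complex.slitPlane := by
  rw [Complex.mem_slitPlane_iff]
  simpa using h

theorem I_mul_mem_slitPlane {x y : ℝ} (h : y < 0 ∨ x ≠ 0) :
    Complex.I * ⟨x, y⟩ ∈ Complex.slitPlane := by
  rw [Complex.mem_slitPlane_iff]
  simpa using h

namespace Shooting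

variable {lam : ℝ} {f : Space → ℝ} {Pp Pm : Fin 3 → MvPolynomial (Fin 3) ℝ} {r α : ℝ}
  (A : Shooting lam Pp Pm r α)

/-- The union of the two arcs. -/
def orbit (ξ : ShootingSpace) : Set Space :=
  (Set.range fun s => at' s (A.u₁ ξ)) ∪ Set.range fun s => at' s (A.u₂ ξ)

theorem orbit_shootingBase (h : IsCrossingCircle lam f r α) :
    A.orbit (shootingBase r α) = Set.range (circlePoint r) := by
  have hα := h.nonneg
  have hα' := h.lt_half_pi
  rw [orbit, u₁_base, u₂_base]
  simp only [at'_unperturbedPath, unperturbedFlow_circlePoint]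
  ext p
  constructor
  · rintro (⟨s, rfl⟩ | ⟨s, rfl⟩) <;> exact ⟨_, rfl⟩
  · rintro ⟨θ, rfl⟩
    obtain ⟨φ, ⟨h1, h2⟩, h3⟩ := exists_mem_Ico_circlePoint_eq r α θ
    rw [h3]
    rcases le_total φ (π - α) with h4 | h4
    · have hT : 0 < π - 2 * α := by linarith
      refine Or.inl ⟨⟨(φ - α) / (π - 2 * α), div_nonneg (by linarith) hT.le,
        (div_le_one hT).2 (by linarith)⟩, ?_⟩
      simp only [mul_div_cancel₀ _ hT.ne']
      congr 1; ring
    · have hT : 0 < π + 2 * α := by linarith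
      refine Or.inr ⟨⟨(φ - (π - α)) / (π + 2 * α), div_nonneg (by linarith) hT.le,
        (div_le_one hT).2 (by linarith)⟩, ?_⟩
      simp only [mul_div_cancel₀ _ hT.ne']
      congr 1; ring

theorem eventually_isCrossingPeriodicOrbit (hf : ContDiff ℝ 1 f)
    (h : IsCrossingCircle lam f r α) : ∀ᶠ ξ in 𝓝 (shootingBase r α),
      f ξ.1 = 0 → f (A.q₁ ξ) = 0 → f (A.q₂ ξ) = 0 → A.q₂ ξ = ξ.1 →
      (perturbedSystem lam ξ.2.2.2 f Pp Pm).IsCrossingPeriodicOrbit (A.orbit ξ) := by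
  filter_upwards [A.eventually_isReturnLoop hf h] with ξ hξ h0 h1 h2 hc
  obtain ⟨-, γ₁, γ₂, hl, he, i₁, i₂⟩ := hξ h0 h1 h2
  have hcl : γ₂ ξ.2.2.1 = γ₁ 0 := by rw [he, hc, hl.start]
  have := PiecewiseField.isCrossingPeriodicOrbit_of_arcs hl.arc₁ hl.arc₂ hl.joint hcl
    (hcl ▸ hl.up) hl.down
  rwa [i₁, i₂] at this

theorem isCrossingPeriodicOrbit_range (hf : ContDiff ℝ 1 f) (h : IsCrossingCircle lam f r α)
    (Pp Pm : Fin 3 → MvPolynomial (Fin 3) ℝ) :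
    (perturbedSystem lam 0 f Pp Pm).IsCrossingPeriodicOrbit (Set.range (circlePoint r)) := by
  obtain ⟨A⟩ := exists_shooting lam Pp Pm r α
  have := (A.eventually_isCrossingPeriodicOrbit hf h).self_of_nhds
  rw [A.orbit_shootingBase h, q₁_base, q₂_base] at this
  exact this h.start h.joint h.start rfl

theorem tendsto_hausdorffEDist_orbit :
    Tendsto (fun ξ => Metric.hausdorffEDist (A.orbit ξ) (A.orbit (shootingBase r α)))
      (𝓝 (shootingBase r α)) (𝓝 0) := by
  have t₁ := A.deriv₁.continuousAt.tendsto.edist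
    (tendsto_const_nhds (x := A.u₁ (shootingBase r α)))
  have t₂ := A.deriv₂.continuousAt.tendsto.edist
    (tendsto_const_nhds (x := A.u₂ (shootingBase r α)))
  have ht := t₁.max t₂
  rw [edist_self, edist_self, max_self] at ht
  refine tendsto_of_tendsto_of_tendsto_of_le_of_le tendsto_const_nhds ht (fun _ => zero_le)
    fun ξ => Metric.hausdorffEDist_le_of_mem_edist ?_ ?_
  · rintro _ (⟨s, rfl⟩ | ⟨s, rfl⟩)
    · exact ⟨_, Or.inl ⟨s, rfl⟩, (PathSpace.edist_at'_le _ _ _).trans (le_max_left _ _)⟩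
    · exact ⟨_, Or.inr ⟨s, rfl⟩, (PathSpace.edist_at'_le _ _ _).trans (le_max_right _ _)⟩
  · rintro _ (⟨s, rfl⟩ | ⟨s, rfl⟩)
    · refine ⟨_, Or.inl ⟨s, rfl⟩, ?_⟩
      rw [edist_comm]
      exact (PathSpace.edist_at'_le _ _ _).trans (le_max_left _ _)
    · refine ⟨_, Or.inr ⟨s, rfl⟩, ?_⟩
      rw [edist_comm]
      exact (PathSpace.edist_at'_le _ _ _).trans (le_max_right _ _)

/-- Compactness of the parameter interval of each path makes the local conditions hold uniformly
along the orbit. -/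
theorem eventually_forall_mem_orbit {Q : Space × ℝ → Prop}
    (hQ : ∀ p ∈ A.orbit (shootingBase r α), ∀ᶠ y in 𝓝 (p, (0 : ℝ)), Q y) :
    ∀ᶠ ξ in 𝓝 (shootingBase r α), ∀ p ∈ A.orbit ξ, Q (p, ξ.2.2.2) := by
  have key : ∀ u : ShootingSpace → PathSpace, ContinuousAt u (shootingBase r α) →
      (∀ s, at' s (u (shootingBase r α)) ∈ A.orbit (shootingBase r α)) →
      ∀ᶠ ξ in 𝓝 (shootingBase r α), ∀ s ∈ (Set.univ : Set unitInterval),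
        Q (at' s (u ξ), ξ.2.2.2) := by
    intro u hu hmem
    refine isCompact_univ.eventually_forall_of_forall_eventually
      (P := fun ξ s => Q (at' s (u ξ), ξ.2.2.2)) fun s _ => ?_
    have t0 : Tendsto (fun z : ShootingSpace × unitInterval => z.1)
        (𝓝 (shootingBase r α, s)) (𝓝 (shootingBase r α)) := continuous_fst.tendsto' _ _ rfl
    have t1 : Tendsto (fun z : ShootingSpace × unitInterval => z.2)
        (𝓝 (shootingBase r α, s)) (𝓝 s) := continuous_snd.tendsto' _ _ rfl
    have t2 := (continuous_at'.tendsto (s, u (shootingBase r α))).comp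
      (t1.prodMk_nhds (hu.tendsto.comp t0))
    have t3 : Tendsto (fun z : ShootingSpace × unitInterval => z.1.2.2.2)
        (𝓝 (shootingBase r α, s)) (𝓝 0) :=
      (show Continuous fun ξ : ShootingSpace => ξ.2.2.2 by fun_prop).tendsto' _ _ rfl |>.comp t0
    exact (t2.prodMk_nhds t3).eventually (hQ _ (hmem s))
  filter_upwards [key A.u₁ A.deriv₁.continuousAt fun s => Or.inl ⟨s, rfl⟩,
    key A.u₂ A.deriv₂.continuousAt fun s => Or.inr ⟨s, rfl⟩] with ξ h₁ h₂
  rintro _ (⟨s, rfl⟩ | ⟨s, rfl⟩)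
  · exact h₁ s trivial
  · exact h₂ s trivial

end Shooting

/-- The conserved quantities of the point `y.1`, and the value `y.2` of `ε`. -/
def invariants (y : Space × ℝ) : ℝ × ℝ × ℝ := (radiusSq y.1, offset y.1, y.2)

theorem continuous_invariants : Continuous invariants := by
  unfold invariants radiusSq offset; fun_prop

theorem invariants_circlePoint (r θ : ℝ) : invariants (circlePoint r θ, 0) = (r ^ 2, 0, 0) := by
  rw [invariants, radiusSq_circlePoint, offset_circlePoint]

namespace Shooting

variable {lam : ℝ} {f : Space → ℝ} {Pp Pm : Fin 3 → MvPolynomial (Fin 3) ℝ} {r α : ℝ}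
  (A : Shooting lam Pp Pm r α)

/-- The first return to the switching manifold near the point `y.1`, for the system of parameter
`y.2`, is given by the shooting parameters `Ψ`. -/
structure IsReturnPoint (f : Space → ℝ) (Ψ : ℝ × ℝ × ℝ → ShootingSpace) (N : Set (ℝ × ℝ))
    (y : Space × ℝ) : Prop where
  mem : (radiusSq y.1, offset y.1) ∈ N
  fst : f y.1 = 0 → (Ψ (invariants y)).1 = y.1
  loop : π ≤ (Ψ (invariants y)).2.1 + (Ψ (invariants y)).2.2.1 ∧ ∃ γ₁ γ₂ : ℝ → Space,
    (perturbedSystem lam y.2 f Pp Pm).IsReturnLoop (Ψ (invariants y)).1 (Ψ (invariants y)).2.1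
      (Ψ (invariants y)).2.2.1 γ₁ γ₂ ∧
    γ₂ (Ψ (invariants y)).2.2.1 = A.q₂ (Ψ (invariants y)) ∧
    γ₁ '' Set.Icc 0 (Ψ (invariants y)).2.1 ∪ γ₂ '' Set.Icc 0 (Ψ (invariants y)).2.2.1 =
      A.orbit (Ψ (invariants y))
  radiusSq_q₂ : radiusSq (A.q₂ (Ψ (invariants y))) =
    radiusSq y.1 + y.2 * A.drift (Ψ (invariants y))

theorem eventually_isReturnPoint (hf : ContDiff ℝ 1 f) (h : IsCrossingCircle lam f r α)
    {Ψ : ℝ × ℝ × ℝ → ShootingSpace} (hΨ : ContinuousAt Ψ (r ^ 2, 0, 0))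
    (hΨ0 : Ψ (r ^ 2, 0, 0) = shootingBase r α)
    (hΨe : ∀ᶠ x in 𝓝 ((r ^ 2, 0, 0) : ℝ × ℝ × ℝ), A.chart f (Ψ x) = (x, 0))
    {N : Set (ℝ × ℝ)} (hN : N ∈ 𝓝 ((r ^ 2, 0) : ℝ × ℝ)) :
    ∀ᶠ y in 𝓝 (circlePoint r α, (0 : ℝ)), A.IsReturnPoint f Ψ N y := by
  have ht : Tendsto invariants (𝓝 (circlePoint r α, 0)) (𝓝 (r ^ 2, 0, 0)) :=
    continuous_invariants.tendsto' _ _ (invariants_circlePoint r α)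
  have hΨt : Tendsto Ψ (𝓝 (r ^ 2, 0, 0)) (𝓝 (shootingBase r α)) := hΨ0 ▸ hΨ
  have htN : Tendsto (fun x : ℝ × ℝ × ℝ => (x.1, x.2.1)) (𝓝 (r ^ 2, 0, 0)) (𝓝 (r ^ 2, 0)) :=
    Continuous.tendsto' (by fun_prop) _ _ rfl
  filter_upwards [ht.eventually (htN.eventually hN), ht.eventually hΨe,
    A.eventually_parametrization_fst hf h hΨ hΨ0 hΨe,
    ht.eventually (hΨt.eventually (A.eventually_isReturnLoop hf h)),
    ht.eventually (hΨt.eventually A.eventually_radiusSq_q₂)] with y h1 h2 h3 h4 h5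
  have k1 : radiusSq (Ψ (invariants y)).1 = radiusSq y.1 := congrArg (fun z => z.1.1) h2
  have k2 : (Ψ (invariants y)).2.2.2 = y.2 := congrArg (fun z => z.1.2.2) h2
  have k3 : f (Ψ (invariants y)).1 = 0 := congrArg (fun z => z.2.1) h2
  have k4 : f (A.q₁ (Ψ (invariants y))) = 0 := congrArg (fun z => z.2.2.1) h2
  have k5 : f (A.q₂ (Ψ (invariants y))) = 0 := congrArg (fun z => z.2.2.2) h2
  refine ⟨h1, h3, ?_, ?_⟩
  · obtain ⟨l0, γ₁, γ₂, l1, l2, l3, l4⟩ := h4 k3 k4 k5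
    rw [k2] at l1
    exact ⟨l0, γ₁, γ₂, l1, l2, by rw [l3, l4]; rfl⟩
  · rw [← k1, ← k2]; exact h5

/-- The conditions at the point `y.1` that make a periodic orbit of the system of parameter `y.2`
near the unperturbed orbit return to the switching manifold. -/
structure IsTubePoint (f : Space → ℝ) (Ψ : ℝ × ℝ × ℝ → ShootingSpace) (N : Set (ℝ × ℝ))
    (y : Space × ℝ) : Prop where
  cross : f y.1 ≠ 0 ∨
    ((perturbedSystem lam y.2 f Pp Pm).CrossesUp y.1 ∧ A.IsReturnPoint f Ψ N y) ∨
    (perturbedSystem lam y.2 f Pp Pm).CrossesDown y.1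
  slitp : f y.1 < 0 ∨ 0 < y.1 1 ∨ y.1 0 ≠ 0
  slitm : 0 < f y.1 ∨ y.1 1 < 0 ∨ y.1 0 ≠ 0
  rotp : 0 < y.1 0 * perturbedField lam y.2 Pp y.1 1 - y.1 1 * perturbedField lam y.2 Pp y.1 0
  rotm : 0 < y.1 0 * perturbedField lam y.2 Pm y.1 1 - y.1 1 * perturbedField lam y.2 Pm y.1 0

theorem eventually_isTubePoint (hf : ContDiff ℝ 1 f) (h : IsCrossingCircle lam f r α)
    {Ψ : ℝ × ℝ × ℝ → ShootingSpace} (hΨ : ContinuousAt Ψ (r ^ 2, 0, 0))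
    (hΨ0 : Ψ (r ^ 2, 0, 0) = shootingBase r α)
    (hΨe : ∀ᶠ x in 𝓝 ((r ^ 2, 0, 0) : ℝ × ℝ × ℝ), A.chart f (Ψ x) = (x, 0))
    {N : Set (ℝ × ℝ)} (hN : N ∈ 𝓝 ((r ^ 2, 0) : ℝ × ℝ)) {p : Space}
    (hp : p ∈ A.orbit (shootingBase r α)) :
    ∀ᶠ y in 𝓝 (p, (0 : ℝ)), A.IsTubePoint f Ψ N y := by
  rw [A.orbit_shootingBase h] at hp
  obtain ⟨θ, rfl⟩ := hp
  have hfc : Continuous fun y : Space × ℝ => f y.1 := hf.continuous.comp continuous_fst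
  have hc : ∀ i, Continuous fun y : Space × ℝ => y.1 i := fun i => by fun_prop
  have hX : ∀ P i, Continuous fun y : Space × ℝ => perturbedField lam y.2 P y.1 i := fun P i =>
    (continuous_apply i).comp ((continuous_perturbedField lam P).comp continuous_swap)
  have e1 : ∀ᶠ y in 𝓝 (circlePoint r θ, (0 : ℝ)), f y.1 ≠ 0 ∨
      ((perturbedSystem lam y.2 f Pp Pm).CrossesUp y.1 ∧ A.IsReturnPoint f Ψ N y) ∨
      (perturbedSystem lam y.2 f Pp Pm).CrossesDown y.1 := by
    rcases h.eq_or_ne_zero θ with h1 | h1 | h1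
    · rw [h1]
      filter_upwards [A.eventually_isReturnPoint hf h hΨ hΨ0 hΨe hN,
        eventually_crossesUp (Pp := Pp) (Pm := Pm) hf h] with y hy1 hy2
      by_cases h0 : f y.1 = 0
      · exact Or.inr (Or.inl ⟨hy2 h0, hy1⟩)
      · exact Or.inl h0
    · rw [h1]
      filter_upwards [eventually_crossesDown (Pp := Pp) (Pm := Pm) hf h] with y hy2
      by_cases h0 : f y.1 = 0
      · exact Or.inr (Or.inr (hy2 h0))
      · exact Or.inl h0
    · filter_upwards [(isOpen_ne_fun hfc continuous_const).mem_nhds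
        (show (circlePoint r θ, (0 : ℝ)) ∈ {y : Space × ℝ | f y.1 ≠ 0} from h1)] with y hy
      exact Or.inl hy
  have e2 : ∀ᶠ y : Space × ℝ in 𝓝 (circlePoint r θ, (0 : ℝ)),
      f y.1 < 0 ∨ 0 < y.1 1 ∨ y.1 0 ≠ 0 :=
    ((isOpen_lt hfc continuous_const).union ((isOpen_lt continuous_const (hc 1)).union
      (isOpen_ne_fun (hc 0) continuous_const))).mem_nhds (h.neg_or_slit θ)
  have e3 : ∀ᶠ y : Space × ℝ in 𝓝 (circlePoint r θ, (0 : ℝ)),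
      0 < f y.1 ∨ y.1 1 < 0 ∨ y.1 0 ≠ 0 :=
    ((isOpen_lt continuous_const hfc).union ((isOpen_lt (hc 1) continuous_const).union
      (isOpen_ne_fun (hc 0) continuous_const))).mem_nhds (h.pos_or_slit θ)
  have e4 : ∀ P, ∀ᶠ y : Space × ℝ in 𝓝 (circlePoint r θ, (0 : ℝ)),
      0 < y.1 0 * perturbedField lam y.2 P y.1 1 - y.1 1 * perturbedField lam y.2 P y.1 0 :=
    fun P => (isOpen_lt continuous_const (((hc 0).mul (hX P 1)).sub
      ((hc 1).mul (hX P 0)))).mem_nhds (rotation_pos h.r_pos P θ)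
  filter_upwards [e1, e2, e3, e4 Pp, e4 Pm] with y h1 h2 h3 h4 h5
  exact ⟨h1, h2, h3, h4, h5⟩

/-- The upward crossings of a periodic orbit in the tube give a periodic sequence of the return map
in (R, s). By `hw` this sequence is constant, so every loop of the orbit is the same one, whatever
the number of turns in a period. -/
theorem eq_orbit_of_forall_isTubePoint (hf : ContDiff ℝ 1 f)
    {Ψ : ℝ × ℝ × ℝ → ShootingSpace} {N : Set (ℝ × ℝ)} {ε : ℝ} {w : ℝ × ℝ}
    (hw : ∀ (v : ℕ → ℝ × ℝ) (n : ℕ), 0 < n → (∀ i, v i ∈ N) → v n = v 0 →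
        (∀ i, v (i + 1) = ((v i).1 + ε * A.drift (Ψ ((v i).1, (v i).2, ε)),
          offset (A.q₂ (Ψ ((v i).1, (v i).2, ε))))) → ∀ i, v i = w)
    {Γ : Set Space} (hΓ : (perturbedSystem lam ε f Pp Pm).IsPeriodicOrbit Γ)
    (hU : ∀ p ∈ Γ, A.IsTubePoint f Ψ N (p, ε)) : Γ = A.orbit (Ψ (w.1, w.2, ε)) := by
  obtain ⟨-, γ, T, hT, hγ, hper, rfl⟩ := hΓ
  have hU' : ∀ t, A.IsTubePoint f Ψ N (γ t, ε) := fun t => hU _ ⟨t, rfl⟩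
  have hfd : Differentiable ℝ (perturbedSystem lam ε f Pp Pm).f := hf.differentiable one_ne_zero
  have hret : ∀ t, (perturbedSystem lam ε f Pp Pm).CrossesUp (γ t) →
      A.IsReturnPoint f Ψ N (γ t, ε) := by
    intro t ht
    rcases (hU' t).cross with h1 | h1 | h1
    · exact absurd ht.1 h1
    · exact h1.2
    · exact absurd h1 ht.not_crossesDown
  obtain ⟨t₀, ht₀⟩ := hγ.exists_crossesUp hfd hT hper
    (fun t h0 => by
      rcases (hU' t).cross with h1 | h1 | h1
      · exact absurd h0 h1
      · exact Or.inl h1.1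
      · exact Or.inr h1)
    (fun t => (hU' t).slitp.imp id neg_I_mul_mem_slitPlane)
    (fun t => (hU' t).slitm.imp id I_mul_mem_slitPlane)
    (fun t => (hU' t).rotp) (fun t => (hU' t).rotm)
  -- The arcs are chosen for all points at once; where there is no return loop the zero curves are
  -- placeholders.
  have hch : ∀ p : Space, ∃ γ₁ γ₂ : ℝ → Space, A.IsReturnPoint f Ψ N (p, ε) →
      (perturbedSystem lam ε f Pp Pm).IsReturnLoop (Ψ (invariants (p, ε))).1
        (Ψ (invariants (p, ε))).2.1 (Ψ (invariants (p, ε))).2.2.1 γ₁ γ₂ ∧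
      γ₂ (Ψ (invariants (p, ε))).2.2.1 = A.q₂ (Ψ (invariants (p, ε))) ∧
      γ₁ '' Set.Icc 0 (Ψ (invariants (p, ε))).2.1 ∪
        γ₂ '' Set.Icc 0 (Ψ (invariants (p, ε))).2.2.1 = A.orbit (Ψ (invariants (p, ε))) := by
    intro p
    by_cases hp : A.IsReturnPoint f Ψ N (p, ε)
    · obtain ⟨-, γ₁, γ₂, h⟩ := hp.loop
      exact ⟨γ₁, γ₂, fun _ => h⟩
    · exact ⟨0, 0, fun h => absurd h hp⟩
  choose γ₁ γ₂ hl using hch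
  obtain ⟨v, n, hn, hvn, hv, hvs, hrange⟩ := hγ.exists_return_sequence hfd
    (contDiff_perturbedField lam ε Pp) (contDiff_perturbedField lam ε Pm) hT hper pi_pos
    (T₁ := fun p => (Ψ (invariants (p, ε))).2.1) (T₂ := fun p => (Ψ (invariants (p, ε))).2.2.1)
    (γ₁ := γ₁) (γ₂ := γ₂)
    (fun t ht => ⟨(hret t ht).loop.1, by
      have := (hl _ (hret t ht)).1
      rwa [(hret t ht).fst ht.1] at this⟩) ⟨t₀, ht₀⟩
  have hvr : ∀ i, A.IsReturnPoint f Ψ N (v i, ε) := by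
    intro i
    obtain ⟨⟨t, ht⟩, h2⟩ := hv i
    rw [← ht] at h2 ⊢
    exact hret t h2
  have hvw : ∀ i, (radiusSq (v i), offset (v i)) = w := by
    refine hw (fun i => (radiusSq (v i), offset (v i))) n hn (fun i => (hvr i).mem)
      (by simp only [hvn]) fun i => ?_
    have h1 : v (i + 1) = A.q₂ (Ψ (invariants (v i, ε))) := by
      rw [hvs, (hl _ (hvr i)).2.1]
    have h2 := (hvr i).radiusSq_q₂
    simp only [h1, h2]
    rfl
  have hinv : ∀ i, invariants (v i, ε) = (w.1, w.2, ε) := fun i => by rw [← hvw i]; rfl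
  rw [hrange]
  have : ∀ i, γ₁ (v i) '' Set.Icc 0 (Ψ (invariants (v i, ε))).2.1 ∪
      γ₂ (v i) '' Set.Icc 0 (Ψ (invariants (v i, ε))).2.2.1 = A.orbit (Ψ (w.1, w.2, ε)) :=
    fun i => by rw [(hl _ (hvr i)).2.2, hinv]
  simp only [this, Set.iUnion_const]

end Shooting

/-! ### From simple zeros to limit cycles -/

/-- A simple zero of the averaged function gives rise to a limit cycle. -/
theorem IsSimpleCrossingCircle.exists_isLimitCycle {lam : ℝ} (hlam : lam ≠ 0) {f : Space → ℝ}
    (hf : ContDiff ℝ 1 f) {Pp Pm : Fin 3 → MvPolynomial (Fin 3) ℝ} {ρ a : ℝ → ℝ} {k : ℝ}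
    (h : IsSimpleCrossingCircle lam f Pp Pm ρ a k) :
    ∃ C : ℝ → Set Space,
      (∀ᶠ ε in 𝓝[≠] (0 : ℝ), (perturbedSystem lam ε f Pp Pm).IsLimitCycle (C ε)) ∧
      Tendsto (fun ε => Metric.hausdorffEDist (C ε) (Set.range (circlePoint (ρ k)))) (𝓝[≠] 0)
        (𝓝 0) := by
  obtain ⟨A⟩ := exists_shooting lam Pp Pm (ρ k) (a k)
  obtain ⟨Ψ, Ψ', hΨ', hΨ0, hΨe, hΨl⟩ := A.exists_parametrization hf h.circle
  have hΨ := hΨ'.continuousAt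
  obtain ⟨Da, hDa⟩ := A.exists_drift_deriv
  obtain ⟨Db, hDb⟩ := A.exists_offset_q₂_deriv
  rw [← hΨ0] at hDa hDb
  have hDa' := HasStrictFDerivAt.comp (g := A.drift) _ hDa hΨ'
  have hDb' := HasStrictFDerivAt.comp (g := fun ξ => offset (A.q₂ ξ)) _ hDb hΨ'
  obtain ⟨ha0, hb0, ha1, hb1, hb2⟩ := A.hyperbolic h hΨ hΨ0 hΨe hΨl hDa' hDb'
  -- Here λ ≠ 0 enters: the transverse multiplier exp(-2πλ) differs from 1.
  obtain ⟨w, hw, hfix, N, hN, hiso⟩ := exists_fixedPoint_of_hyperbolic hDa' hDb' ha0 hb0 ha1 hb1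
    hb2 (exp_pos _).le (by
      rw [Ne, exp_eq_one_iff, neg_eq_zero]
      exact mul_ne_zero hlam two_pi_pos.ne')
  have hx : Tendsto (fun ε => (((w ε).1, (w ε).2, ε) : ℝ × ℝ × ℝ)) (𝓝 0) (𝓝 (ρ k ^ 2, 0, 0)) :=
    ((continuous_fst.tendsto _).comp hw).prodMk_nhds
      (((continuous_snd.tendsto _).comp hw).prodMk_nhds tendsto_id)
  have hξ : Tendsto (fun ε => Ψ ((w ε).1, (w ε).2, ε)) (𝓝 0) (𝓝 (shootingBase (ρ k) (a k))) := by
    rw [← hΨ0]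
    exact hΨ.tendsto.comp hx
  -- The condition is required in a whole neighbourhood of each point, so that the points satisfying
  -- it form an open set; this set isolates the cycle.
  have htube := A.eventually_forall_mem_orbit
    (Q := fun y => ∀ᶠ y' in 𝓝 y, A.IsTubePoint f Ψ N y')
    (fun p hp => (A.eventually_isTubePoint hf h.circle hΨ hΨ0 hΨe hN hp).eventually_nhds)
  have hq₂t : Tendsto (fun ξ : ShootingSpace => (A.q₂ ξ, ξ.2.2.2))
      (𝓝 (shootingBase (ρ k) (a k))) (𝓝 (circlePoint (ρ k) (a k), 0)) := by
    have h1 := A.hasStrictFDerivAt_q₂.continuousAt.tendsto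
    rw [A.q₂_base] at h1
    exact h1.prodMk_nhds
      ((show Continuous fun ξ : ShootingSpace => ξ.2.2.2 by fun_prop).tendsto' _ _ rfl)
  refine ⟨fun ε => A.orbit (Ψ ((w ε).1, (w ε).2, ε)), ?_, ?_⟩
  · have hev := (hξ.eventually htube).and ((hx.eventually hΨe).and (hfix.and
      ((hξ.eventually (A.eventually_isCrossingPeriodicOrbit hf h.circle)).and
      ((hξ.eventually A.eventually_radiusSq_q₂).and (hξ.eventually (hq₂t.eventually
        (A.eventually_parametrization_fst hf h.circle hΨ hΨ0 hΨe)))))))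
    filter_upwards [hev.filter_mono nhdsWithin_le_nhds, hiso] with ε ⟨h1, h2, ⟨h3, h4⟩, h5, h6, h7⟩
      h8
    set ξ := Ψ ((w ε).1, (w ε).2, ε)
    have k1 : radiusSq ξ.1 = (w ε).1 := congrArg (fun z => z.1.1) h2
    have k3 : ξ.2.2.2 = ε := congrArg (fun z => z.1.2.2) h2
    have k4 : f ξ.1 = 0 := congrArg (fun z => z.2.1) h2
    have k5 : f (A.q₁ ξ) = 0 := congrArg (fun z => z.2.2.1) h2
    have k6 : f (A.q₂ ξ) = 0 := congrArg (fun z => z.2.2.2) h2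
    have h3' : A.drift ξ = 0 := h3
    have h4' : offset (A.q₂ ξ) = (w ε).2 := h4
    -- At a fixed point the final crossing has the same conserved quantities as the initial one. As
    -- both lie on the switching manifold, they coincide.
    have hclose : A.q₂ ξ = ξ.1 := by
      have := h7 k6
      simp only [h6, h4', h3', k1, k3, mul_zero, add_zero] at this
      rw [← this]
    rw [k3] at h1 h5
    refine ⟨h5 k4 k5 k6 hclose, {p | ∀ᶠ y' in 𝓝 (p, ε), A.IsTubePoint f Ψ N y'}, ?_, h1, ?_⟩
    · exact isOpen_setOfPred_eventually_nhds.preimage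
        (show Continuous fun p : Space => (p, ε) by fun_prop)
    · intro Γ hΓ hΓU
      exact A.eq_orbit_of_forall_isTubePoint hf h8 hΓ fun p hp => (hΓU hp).self_of_nhds
  · have := A.tendsto_hausdorffEDist_orbit.comp hξ
    rw [A.orbit_shootingBase h.circle] at this
    exact this.mono_left nhdsWithin_le_nhds

theorem isClosed_range_circlePoint (r : ℝ) : IsClosed (Set.range (circlePoint r)) := by
  have hper : Function.Periodic (circlePoint r) (2 * π) := circlePoint_add_two_pi r
  rw [← hper.image_Icc two_pi_pos 0]
  have hc : Continuous (circlePoint r) :=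
    continuous_circlePoint.comp (continuous_const.prodMk continuous_id)
  exact (isCompact_Icc.image hc).isClosed

theorem range_circlePoint_injective {r s : ℝ} (hr : 0 < r) (hs : 0 < s)
    (h : Set.range (circlePoint r) = Set.range (circlePoint s)) : r = s := by
  obtain ⟨θ, hθ⟩ : circlePoint r 0 ∈ Set.range (circlePoint s) := h ▸ ⟨0, rfl⟩
  have := congrArg radiusSq hθ
  rw [radiusSq_circlePoint, radiusSq_circlePoint] at this
  exact (pow_left_inj₀ hr.le hs.le two_ne_zero).1 this.symm

/-- Distinct closed circles are at positive Hausdorff distance, so the cycles converging to them are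
distinct for small ε. Finiteness of the index set gives a common ε₀. -/
theorem atLeastLimitCyclesBifurcate_of_isSimpleCrossingCircle {lam : ℝ} (hlam : lam ≠ 0)
    {f : Space → ℝ} (hf : ContDiff ℝ 1 f) {Pp Pm : Fin 3 → MvPolynomial (Fin 3) ℝ}
    (hPp : ∀ i, (Pp i).totalDegree ≤ 2) (hPm : ∀ i, (Pm i).totalDegree ≤ 2) {ρ a : ℝ → ℝ} {n : ℕ}
    {k : Fin n → ℝ} (h : ∀ i, IsSimpleCrossingCircle lam f Pp Pm ρ a (k i))
    (hinj : Function.Injective fun i => ρ (k i)) : AtLeastLimitCyclesBifurcate lam f n := by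
  choose C hC hlim using fun i => (h i).exists_isLimitCycle hlam hf
  have hΓ : Function.Injective fun i => Set.range (circlePoint (ρ (k i))) := fun i j hij =>
    hinj (range_circlePoint_injective (h i).circle.r_pos (h j).circle.r_pos hij)
  have hne : ∀ i j, i ≠ j → ∀ᶠ ε in 𝓝[≠] (0 : ℝ), C i ε ≠ C j ε := by
    intro i j hij
    have hpos : 0 < Metric.hausdorffEDist (Set.range (circlePoint (ρ (k i))))
        (Set.range (circlePoint (ρ (k j)))) := by
      rw [pos_iff_ne_zero, Ne, (isClosed_range_circlePoint _).hausdorffEDist_zero_iff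
        (isClosed_range_circlePoint _)]
      exact fun he => hij (hΓ he)
    have ht := (hlim i).add (hlim j)
    rw [add_zero] at ht
    filter_upwards [ht.eventually_lt_const hpos] with ε hε he
    refine absurd hε (not_lt.2 ?_)
    refine (Metric.hausdorffEDist_triangle (t := C i ε)).trans ?_
    rw [Metric.hausdorffEDist_comm (s := Set.range (circlePoint (ρ (k i)))), he]
  have hall : ∀ᶠ ε in 𝓝[≠] (0 : ℝ), (∀ i j, i ≠ j → C i ε ≠ C j ε) ∧
      ∀ i, (perturbedSystem lam ε f Pp Pm).IsLimitCycle (C i ε) := by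
    refine (eventually_all.2 fun i => eventually_all.2 fun j => ?_).and (eventually_all.2 hC)
    by_cases hij : i = j
    · exact Eventually.of_forall fun _ h => absurd hij h
    · exact (hne i j hij).mono fun _ h _ => h
  rw [eventually_nhdsWithin_iff, Metric.eventually_nhds_iff] at hall
  obtain ⟨ε₀, hε₀, hall⟩ := hall
  refine ⟨Pp, Pm, hPp, hPm, _, hΓ, fun i => ⟨
    Shooting.isCrossingPeriodicOrbit_range hf (h i).circle Pp Pm, ?_⟩,
    ε₀, hε₀, fun ε i => C i ε, fun ε h0 h1 => ?_, hlim⟩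
  · rintro _ ⟨θ, rfl⟩
    have h1 := radiusSq_circlePoint (ρ (k i)) θ
    rw [radiusSq] at h1
    rw [paraboloid, Set.mem_ofPred_eq, h1]
    rfl
  · obtain ⟨h2, h3⟩ := hall (y := ε) (by simpa using h1) h0
    exact ⟨fun i j hij => by_contra fun hne => h2 i j hne hij, h3⟩

/-! ### Combinations of independent functions with many simple zeros -/

/-- The evaluation vectors of linearly independent functions span, so values can be prescribed at
suitable points. -/
theorem exists_strictMono_interpolation {n : ℕ} {g : Fin n → ℝ → ℝ} {I : Set ℝ}
    (hind : ∀ c : Fin n → ℝ, (∀ t ∈ I, ∑ i, c i * g i t = 0) → c = 0) :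
    ∃ t : Fin n → ℝ, StrictMono t ∧ (∀ j, t j ∈ I) ∧
      ∀ y : Fin n → ℝ, ∃ c : Fin n → ℝ, ∀ j, ∑ i, c i * g i (t j) = y j := by
  let e : ℝ → Fin n → ℝ := fun t i => g i t
  have hφe : ∀ (φ : (Fin n → ℝ) →ₗ[ℝ] ℝ) t,
      ∑ i, (φ fun j => if i = j then 1 else 0) * g i t = φ (e t) := fun φ t => by
    rw [LinearMap.pi_apply_eq_sum_univ φ (e t)]
    exact Finset.sum_congr rfl fun i _ => by simp only [e, smul_eq_mul, mul_comm]
  -- A nonzero functional vanishing on all evaluation vectors would be a linear relation between the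
  -- functions.
  have hspan : Submodule.span ℝ (e '' I) = ⊤ := by
    by_contra hne
    obtain ⟨φ, hφ, hle⟩ := Submodule.exists_le_ker_of_lt_top _ (lt_top_iff_ne_top.2 hne)
    refine hφ (LinearMap.ext fun v => ?_)
    have h0 := hind (fun i => φ fun j => if i = j then 1 else 0) fun t ht => by
      rw [hφe]
      exact hle (Submodule.subset_span ⟨t, ht, rfl⟩)
    rw [LinearMap.pi_apply_eq_sum_univ]
    refine Finset.sum_eq_zero fun i _ => ?_
    have := congrFun h0 i
    rw [Pi.zero_apply] at this
    rw [this, smul_zero]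
  obtain ⟨v, hv, -, hli⟩ := Submodule.exists_fun_fin_finrank_span_eq ℝ (e '' I)
  have hfr : Module.finrank ℝ (Submodule.span ℝ (e '' I)) = n := by
    rw [hspan, finrank_top, Module.finrank_fin_fun]
  choose τ hτI hτ using hv
  let t₀ : Fin n → ℝ := fun j => τ (Fin.cast hfr.symm j)
  have hli₀ : LinearIndependent ℝ fun j => e (t₀ j) := by
    have := hli.comp _ (finCongr hfr.symm).injective
    rwa [show v ∘ finCongr hfr.symm = fun j => e (t₀ j) from funext fun j => (hτ _).symm] at this
  let σ := Tuple.sort t₀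
  have hli₁ : LinearIndependent ℝ fun j => e (t₀ (σ j)) := hli₀.comp _ σ.injective
  refine ⟨t₀ ∘ σ, (Tuple.monotone_sort t₀).strictMono_of_injective fun i j hij => ?_,
    fun j => hτI _, fun y => ?_⟩
  · exact hli₁.injective (congrArg e hij)
  · let b := basisOfLinearIndependentOfCardEqFinrank' _ hli₁ (by simp)
    refine ⟨fun i => b.constr ℝ y fun j => if i = j then 1 else 0, fun j => ?_⟩
    rw [hφe]
    have h1 : b j = e (t₀ (σ j)) := by simp [b]
    exact h1 ▸ b.constr_basis ℝ y j

/-- Linearly independent functions, one of them positive, have a combination with as many simple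
zeros as there are other functions. -/
theorem exists_simple_zeros {n : ℕ} {g : Fin (n + 1) → ℝ → ℝ} {I : Set ℝ} (hI : I.OrdConnected)
    (hg : ∀ i, ∀ t ∈ I, DifferentiableAt ℝ (g i) t) (hpos : ∀ t ∈ I, 0 < g 0 t)
    (hind : ∀ c : Fin (n + 1) → ℝ, (∀ t ∈ I, ∑ i, c i * g i t = 0) → c = 0) :
    ∃ (c : Fin (n + 1) → ℝ) (k : Fin n → ℝ), StrictMono k ∧ ∀ j, k j ∈ I ∧
      ∑ i, c i * g i (k j) = 0 ∧ ∃ d ≠ 0, HasDerivAt (fun t => ∑ i, c i * g i t) d (k j) := by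
  obtain ⟨t, ht, htI, hint⟩ := exists_strictMono_interpolation hind
  -- Alternating values at n + 1 increasing points force n sign changes.
  obtain ⟨c, hc⟩ := hint fun j => (-1) ^ (j : ℕ)
  let F : ℝ → ℝ := fun t => ∑ i, c i * g i t
  have hF : ∀ x ∈ I, DifferentiableAt ℝ F x := fun x hx =>
    DifferentiableAt.fun_sum fun i _ => (hg i x hx).const_mul (c i)
  let q : ℝ → ℝ := fun x => F x / g 0 x
  have hq : ∀ x ∈ I, DifferentiableAt ℝ q x := fun x hx =>
    (hF x hx).div (hg 0 x hx) (hpos x hx).ne'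
  -- For 0 < w < δ, subtracting w times g 0 leaves the signs at the points t j unchanged.
  obtain ⟨δ, hδ, hδt⟩ : ∃ δ > 0, ∀ j, δ * g 0 (t j) ≤ 1 := by
    have := fun j => hpos _ (htI j)
    refine ⟨Finset.univ.inf' Finset.univ_nonempty fun j => (g 0 (t j))⁻¹, ?_, fun j => ?_⟩
    · exact (Finset.lt_inf'_iff _).2 fun j _ => inv_pos.2 (this j)
    · rw [← le_div_iff₀ (this j), one_div]
      exact Finset.inf'_le _ (Finset.mem_univ j)
  -- By Sard's theorem in dimension one, the critical values of q form a null set, which cannot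
  -- contain the interval (0, δ).
  obtain ⟨w, ⟨hw0, hwδ⟩, hwq⟩ : ∃ w ∈ Set.Ioo 0 δ, ∀ x ∈ I, q x = w → deriv q x ≠ 0 := by
    let K : Set ℝ := {x | x ∈ I ∧ deriv q x = 0}
    have hK : MeasureTheory.volume (q '' K) = 0 :=
      MeasureTheory.addHaar_image_eq_zero_of_det_fderivWithin_eq_zero MeasureTheory.volume
        (f' := fun x => fderiv ℝ q x)
        (fun x hx => (hq x hx.1).hasFDerivAt.hasFDerivWithinAt) fun x hx => by
          have : fderiv ℝ q x = 0 := by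
            ext; simpa using hx.2
          rw [this, ContinuousLinearMap.det, ContinuousLinearMap.toLinearMap_zero, LinearMap.det_zero,
            Module.finrank_self, pow_one]
    by_contra! hno
    have hsub : Set.Ioo 0 δ ⊆ q '' K := fun w hw => by
      obtain ⟨x, hx, h1, h2⟩ := hno w hw
      exact ⟨x, ⟨hx, h2⟩, h1⟩
    have := MeasureTheory.measure_mono_null hsub hK
    rw [Real.volume_Ioo, sub_zero, ENNReal.ofReal_eq_zero] at this
    exact absurd hδ this.not_gt
  let G : ℝ → ℝ := fun x => F x - w * g 0 x
  have hG : ∀ x ∈ I, DifferentiableAt ℝ G x := fun x hx =>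
    (hF x hx).sub ((hg 0 x hx).const_mul w)
  have hwt : ∀ j, 0 < w * g 0 (t j) ∧ w * g 0 (t j) < 1 := fun j =>
    have := hpos _ (htI j)
    ⟨mul_pos hw0 this, lt_of_lt_of_le (mul_lt_mul_of_pos_right hwδ this) (hδt j)⟩
  have hzero : ∀ j : Fin n, ∃ x ∈ Set.Ioo (t j.castSucc) (t j.succ), G x = 0 := by
    intro j
    have hIcc : Set.Icc (t j.castSucc) (t j.succ) ⊆ I := hI.out (htI _) (htI _)
    have hcont : ContinuousOn (fun x => (-1) ^ (j : ℕ) * G x)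
        (Set.Icc (t j.castSucc) (t j.succ)) := fun x hx =>
      ((hG x (hIcc hx)).continuousAt.const_mul _).continuousWithinAt
    have h1 : F (t j.castSucc) = (-1) ^ (j : ℕ) := hc _
    have h2 : F (t j.succ) = -(-1) ^ (j : ℕ) := by
      rw [show F (t j.succ) = (-1) ^ ((j.succ : Fin (n + 1)) : ℕ) from hc _, Fin.val_succ, pow_succ]
      ring
    have h3 := hwt j.castSucc
    have h4 := hwt j.succ
    have hsq := neg_one_pow_eq_or ℝ (j : ℕ)
    obtain ⟨x, hx, hx0⟩ := intermediate_value_Ioo' (ht.monotone j.castSucc_lt_succ.le) hcont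
      (show (0 : ℝ) ∈ _ by
        simp only [Set.mem_Ioo, G, h1, h2]
        rcases hsq with h | h <;> rw [h] <;> constructor <;> linarith)
    exact ⟨x, hx, (mul_eq_zero.1 hx0).resolve_left (pow_ne_zero _ (by norm_num))⟩
  choose k hk hk0 using hzero
  have hkI : ∀ j, k j ∈ I := fun j => hI.out (htI _) (htI _) ⟨(hk j).1.le, (hk j).2.le⟩
  have hsum : ∀ x, ∑ i, (c i - if i = 0 then w else 0) * g i x = G x := fun x => by
    simp only [sub_mul, Finset.sum_sub_distrib, ite_mul, zero_mul, Finset.sum_ite_eq',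
      Finset.mem_univ, if_true, G, F]
  refine ⟨fun i => c i - if i = 0 then w else 0, k, fun i j hij => ?_, fun j => ⟨hkI j, ?_, ?_⟩⟩
  · exact (hk i).2.trans_le ((ht.monotone (Fin.succ_le_castSucc_iff.2 hij)).trans (hk j).1.le)
  · rw [hsum, hk0]
  · have hp := hpos _ (hkI j)
    have hqk : q (k j) = w := by
      rw [div_eq_iff hp.ne']
      exact sub_eq_zero.1 (hk0 j)
    simp only [hsum]
    -- Near the zero, G = g 0 · (q - w), so its derivative there is g 0 times that of q, nonzero
    -- because w is a regular value.
    refine ⟨g 0 (k j) * deriv q (k j), mul_ne_zero hp.ne' (hwq _ (hkI j) hqk), ?_⟩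
    have h1 := ((hg 0 _ (hkI j)).hasDerivAt.mul ((hq _ (hkI j)).hasDerivAt.sub_const w))
    rw [hqk, sub_self, mul_zero, zero_add] at h1
    refine h1.congr_of_eventuallyEq ?_
    filter_upwards [(hg 0 _ (hkI j)).continuousAt.eventually_ne hp.ne'] with x hx
    simp only [Pi.mul_apply, q, G]
    field_simp

/-! ### The perturbations and their averaged function -/

open MvPolynomial in
/-- The perturbation in the zone `f > 0`. -/
noncomputable def upperPerturbation (c : Fin 9 → ℝ) : Fin 3 → MvPolynomial (Fin 3) ℝ :=
  ![X 0 * (C (c 3) + C (c 4) * X 2),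
    (C (c 0) + X 2 * (C (c 1) + C (c 2) * X 2)) + X 1 * (C (c 7) + C (c 8) * X 2), 0]

open MvPolynomial in
/-- The perturbation in the zone `f < 0`. -/
noncomputable def lowerPerturbation (c : Fin 9 → ℝ) : Fin 3 → MvPolynomial (Fin 3) ℝ :=
  ![X 0 * (C (c 5) + C (c 6) * X 2), X 1 * (C (c 5) + C (c 6) * X 2), 0]

open MvPolynomial in
theorem totalDegree_X_mul_affine_le (i j : Fin 3) (a b : ℝ) :
    (X i * (C a + C b * X j) : MvPolynomial (Fin 3) ℝ).totalDegree ≤ 2 := by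
  have h1 : (C b * X j : MvPolynomial (Fin 3) ℝ).totalDegree ≤ 1 :=
    (totalDegree_mul _ _).trans (by rw [totalDegree_C, totalDegree_X])
  have h2 : (C a + C b * X j : MvPolynomial (Fin 3) ℝ).totalDegree ≤ 1 :=
    (totalDegree_add _ _).trans (max_le (by rw [totalDegree_C]; exact zero_le_one) h1)
  refine (totalDegree_mul _ _).trans ?_
  rw [totalDegree_X]
  omega

theorem totalDegree_upperPerturbation_le (c : Fin 9 → ℝ) (i : Fin 3) :
    (upperPerturbation c i).totalDegree ≤ 2 := by
  fin_cases i
  · exact totalDegree_X_mul_affine_le _ _ _ _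
  · refine (MvPolynomial.totalDegree_add _ _).trans (max_le
      ((MvPolynomial.totalDegree_add _ _).trans (max_le ?_ ?_)) ?_)
    · rw [MvPolynomial.totalDegree_C]; exact zero_le_two
    · exact totalDegree_X_mul_affine_le _ _ _ _
    · exact totalDegree_X_mul_affine_le _ _ _ _
  · simp [upperPerturbation]

theorem totalDegree_lowerPerturbation_le (c : Fin 9 → ℝ) (i : Fin 3) :
    (lowerPerturbation c i).totalDegree ≤ 2 := by
  fin_cases i
  · exact totalDegree_X_mul_affine_le _ _ _ _
  · exact totalDegree_X_mul_affine_le _ _ _ _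
  · simp [lowerPerturbation]

/-- The averaged function of the perturbation, divided by `2 r`. -/
noncomputable def averaged (c : Fin 9 → ℝ) (r α : ℝ) : ℝ :=
  2 * cos α * (c 0 + c 1 * r ^ 2 + c 2 * r ^ 4) +
    r * (c 3 + c 4 * r ^ 2) * (π / 2 - α - sin α * cos α) +
    r * (c 5 + c 6 * r ^ 2) * (π + 2 * α) +
    r * (c 7 + c 8 * r ^ 2) * (π / 2 - α + sin α * cos α)

/-- With z = r² the radial parts are combinations of 1, sin θ, cos² θ and sin² θ, integrated by
explicit primitives. The factor r left over in the sin θ term is taken out, so that its coefficient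
becomes a polynomial in r². -/
theorem melnikov_perturbation (c : Fin 9 → ℝ) (r α : ℝ) :
    melnikov (upperPerturbation c) (lowerPerturbation c) r α = 2 * r * averaged c r α := by
  have hp : ∀ θ, radialPart (upperPerturbation c) (circlePoint r θ) =
      2 * r ^ 2 * (c 3 + c 4 * r ^ 2) * cos θ ^ 2 +
        2 * r * (c 0 + c 1 * r ^ 2 + c 2 * r ^ 4) * sin θ +
        2 * r ^ 2 * (c 7 + c 8 * r ^ 2) * sin θ ^ 2 := fun θ => by
    simp [radialPart, upperPerturbation, circlePoint]
    ring
  have hm : ∀ θ, radialPart (lowerPerturbation c) (circlePoint r θ) =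
      2 * r ^ 2 * (c 5 + c 6 * r ^ 2) := fun θ => by
    simp [radialPart, lowerPerturbation, circlePoint]
    linear_combination 2 * r ^ 2 * (c 5 + c 6 * r ^ 2) * sin_sq_add_cos_sq θ
  have h1 : ∀ θ, HasDerivAt (fun θ => r ^ 2 * (c 3 + c 4 * r ^ 2) * (θ + sin θ * cos θ) -
      2 * r * (c 0 + c 1 * r ^ 2 + c 2 * r ^ 4) * cos θ +
      r ^ 2 * (c 7 + c 8 * r ^ 2) * (θ - sin θ * cos θ))
      (radialPart (upperPerturbation c) (circlePoint r θ)) θ := by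
    intro θ
    have hsc := (hasDerivAt_sin θ).mul (hasDerivAt_cos θ)
    refine (((((hasDerivAt_id θ).add hsc).const_mul _).sub ((hasDerivAt_cos θ).const_mul _)).add
      (((hasDerivAt_id θ).sub hsc).const_mul _)).congr_deriv ?_
    rw [hp]
    linear_combination (-(r ^ 2 * (c 3 + c 4 * r ^ 2)) - r ^ 2 * (c 7 + c 8 * r ^ 2)) *
      sin_sq_add_cos_sq θ
  have hi : IntervalIntegrable (fun θ => radialPart (upperPerturbation c) (circlePoint r θ))
      MeasureTheory.volume α (π - α) := by
    simp only [hp]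
    exact Continuous.intervalIntegrable (by fun_prop) _ _
  rw [melnikov, intervalIntegral.integral_eq_sub_of_hasDerivAt (fun θ _ => h1 θ) hi]
  simp only [hm, intervalIntegral.integral_const, sin_pi_sub, cos_pi_sub, smul_eq_mul, averaged]
  ring

theorem sin_lt_sin_of_mem_Ioo {α θ : ℝ} (h1 : -(π / 2) ≤ α) (h : θ ∈ Set.Ioo α (π - α)) :
    sin α < sin θ := by
  rcases le_total θ (π / 2) with h2 | h2
  · exact sin_lt_sin_of_lt_of_le_pi_div_two h1 h2 h.1
  · rw [← sin_pi_sub θ]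
    exact sin_lt_sin_of_lt_of_le_pi_div_two h1 (by linarith) (by linarith [h.2])

theorem sin_lt_sin_of_mem_Ioo' {α θ : ℝ} (h1 : α ≤ π / 2)
    (h : θ ∈ Set.Ioo (π - α) (2 * π + α)) : sin θ < sin α := by
  have := sin_lt_sin_of_mem_Ioo (α := -α) (θ := θ - π) (by linarith)
    ⟨by linarith [h.1], by linarith [h.2]⟩
  rw [sin_neg, sin_sub_pi] at this
  linarith

/-- A switching function that on the circle of radius `r` is a positive multiple of
`sin θ - sin α`. -/
theorem isCrossingCircle_of_eq_mul {lam : ℝ} {f : Space → ℝ} (hf : Differentiable ℝ f) {r α : ℝ}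
    (hr : 0 < r) (h0 : 0 ≤ α) (h1 : α < π / 2) {m : ℝ → ℝ} (hm : Differentiable ℝ m)
    (hm0 : ∀ θ, 0 < m θ) (h : ∀ θ, f (circlePoint r θ) = m θ * (sin θ - sin α)) :
    IsCrossingCircle lam f r α := by
  -- At a crossing angle the factor sin θ - sin α vanishes, and only m(θ) cos θ survives in the
  -- derivative. The sign of cos θ separates upward from downward crossings.
  have hd : ∀ θ, sin θ = sin α →
      lieDeriv (unperturbedField lam) f (circlePoint r θ) = m θ * cos θ := by
    intro θ hθ
    have d1 := (hf (circlePoint r θ)).hasFDerivAt.comp_hasDerivAt θ (hasDerivAt_circlePoint lam r θ)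
    have d2 := (hm θ).hasDerivAt.mul ((hasDerivAt_sin θ).sub_const (sin α))
    rw [hθ, sub_self, mul_zero, zero_add] at d2
    exact d1.unique (d2.congr_of_eventuallyEq (Eventually.of_forall h))
  have hc : 0 < cos α := cos_pos_of_mem_Ioo ⟨by linarith [pi_pos], h1⟩
  refine ⟨hr, h0, h1, by rw [h, sub_self, mul_zero], by rw [h, sin_pi_sub, sub_self, mul_zero],
    fun θ hθ => ?_, fun θ hθ => ?_, ?_, ?_⟩
  · rw [h]
    exact mul_pos (hm0 θ) (sub_pos.2 (sin_lt_sin_of_mem_Ioo (by linarith [pi_pos]) hθ))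
  · rw [h]
    exact mul_neg_of_pos_of_neg (hm0 θ) (sub_neg.2 (sin_lt_sin_of_mem_Ioo' h1.le hθ))
  · rw [hd α rfl]
    exact mul_pos (hm0 α) hc
  · rw [hd (π - α) (sin_pi_sub α), cos_pi_sub]
    exact mul_neg_of_pos_of_neg (hm0 _) (neg_neg_of_pos hc)

/-- Simple zeros of the averaged function along a family of crossing circles. -/
theorem atLeastLimitCyclesBifurcate_of_averaged {lam : ℝ} (hlam : lam ≠ 0)
    {f : Space → ℝ} (hf : ContDiff ℝ 1 f) {ρ a : ℝ → ℝ} {I : Set ℝ} (hI : IsOpen I)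
    (hρ : ∀ k ∈ I, DifferentiableAt ℝ ρ k) (ha : ContinuousOn a I)
    (hcircle : ∀ k ∈ I, IsCrossingCircle lam f (ρ k) (a k)) (hinj : Set.InjOn ρ I)
    (c : Fin 9 → ℝ) {n : ℕ} {k : Fin n → ℝ} (hk : StrictMono k)
    (hz : ∀ j, k j ∈ I ∧ averaged c (ρ (k j)) (a (k j)) = 0 ∧
      ∃ d ≠ 0, HasDerivAt (fun t => averaged c (ρ t) (a t)) d (k j)) :
    AtLeastLimitCyclesBifurcate lam f n := by
  refine atLeastLimitCyclesBifurcate_of_isSimpleCrossingCircle hlam hf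
    (totalDegree_upperPerturbation_le c) (totalDegree_lowerPerturbation_le c) (ρ := ρ) (a := a)
    (k := k) (fun j => ?_) fun i j hij => hk.injective (hinj (hz i).1 (hz j).1 hij)
  obtain ⟨hkI, hz0, d, hd, hder⟩ := hz j
  have hnhds : I ∈ 𝓝 (k j) := hI.mem_nhds hkI
  have hr := (hcircle _ hkI).r_pos
  refine ⟨hcircle _ hkI, ?_, ?_, hρ _ hkI, ha.continuousAt hnhds, ?_, 2 * ρ (k j) * d,
    mul_ne_zero (by positivity) hd, ?_⟩
  · filter_upwards [hnhds] with t ht using (hcircle t ht).start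
  · filter_upwards [hnhds] with t ht using (hcircle t ht).joint
  · rw [melnikov_perturbation, hz0, mul_zero]
  · simp only [melnikov_perturbation]
    have := ((hρ _ hkI).hasDerivAt.const_mul 2).mul hder
    rw [hz0, mul_zero, zero_add] at this
    exact this

/-! ### The plane y = 0 -/

/-- All circles cross at the angles 0 and π, and the averaged function is a quartic in r. The
coefficients are those of (r-1)(r-2)(r-3)(r-4) = r⁴ - 10r³ + 35r² - 50r + 24: even powers, halved,
come from the zone y > 0, and odd powers, divided by π, from y < 0. -/
theorem atLeastLimitCyclesBifurcate_y {lam : ℝ} (hlam : lam ≠ 0) :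
    AtLeastLimitCyclesBifurcate lam (fun p => p 1) 4 := by
  have hf : ContDiff ℝ 1 fun p : Space => p 1 := contDiff_apply ℝ ℝ (1 : Fin 3)
  have hav : (fun t => averaged ![12, 35 / 2, 1 / 2, 0, 0, -50 / π, -10 / π, 0, 0] t 0) =
      fun t => (t - 1) * (t - 2) * ((t - 3) * (t - 4)) := by
    funext t
    simp [averaged]
    field_simp
    ring
  have hder : ∀ t, HasDerivAt (fun t : ℝ => (t - 1) * (t - 2) * ((t - 3) * (t - 4)))
      ((1 * (t - 2) + (t - 1) * 1) * ((t - 3) * (t - 4)) +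
        (t - 1) * (t - 2) * (1 * (t - 4) + (t - 3) * 1)) t := fun t =>
    (((hasDerivAt_id t).sub_const 1).mul ((hasDerivAt_id t).sub_const 2)).mul
      (((hasDerivAt_id t).sub_const 3).mul ((hasDerivAt_id t).sub_const 4))
  refine atLeastLimitCyclesBifurcate_of_averaged hlam hf (ρ := fun t => t) (a := fun _ => 0)
    (I := Set.Ioi 0) isOpen_Ioi (fun _ _ => differentiableAt_id) continuousOn_const
    (fun t ht => ?_) (fun _ _ _ _ h => h) _ (k := fun j : Fin 4 => (j : ℝ) + 1)
    (fun i j hij => ?_) fun j => ⟨?_, (congrFun hav _).trans ?_, ?_⟩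
  · refine isCrossingCircle_of_eq_mul (hf.differentiable one_ne_zero) ht le_rfl pi_div_two_pos
      (m := fun _ => t) (by fun_prop) (fun _ => ht) fun θ => ?_
    simp [circlePoint]
  · have : (i : ℝ) < j := by exact_mod_cast hij
    linarith
  · exact Set.mem_Ioi.2 (by positivity)
  · fin_cases j <;> norm_num
  · refine ⟨_, ?_, hav ▸ hder _⟩
    fin_cases j <;> norm_num

/-! ### The plane y = z -/

/-- By analyticity the relation holds on all of ℝ. Subtracting its translate by the common period
leaves 2πB = 0. -/
theorem eq_zero_of_add_mul_eq_zero {A B : ℝ → ℝ} (hA : AnalyticOnNhd ℝ A Set.univ)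
    (hB : AnalyticOnNhd ℝ B Set.univ) (pA : Function.Periodic A (2 * π))
    (pB : Function.Periodic B (2 * π)) (h : ∀ t ∈ Set.Ioo 0 (π / 2), A t + t * B t = 0) (t : ℝ) :
    A t = 0 ∧ B t = 0 := by
  have hall : (fun t => A t + t * B t) = fun _ => 0 := by
    have hq : π / 4 ∈ Set.Ioo 0 (π / 2) := ⟨by positivity, by linarith [pi_pos]⟩
    refine AnalyticOnNhd.eq_of_eventuallyEq (z₀ := π / 4)
      (hA.add (analyticOnNhd_id.mul hB)) analyticOnNhd_const ?_
    filter_upwards [isOpen_Ioo.mem_nhds hq] with t ht using h t ht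
  have h1 : A t + t * B t = 0 := congrFun hall t
  have h2 : A (t + 2 * π) + (t + 2 * π) * B (t + 2 * π) = 0 := congrFun hall (t + 2 * π)
  rw [pA, pB] at h2
  have h3 : B t = 0 := by
    have : 2 * π * B t = 0 := by linarith
    exact (mul_eq_zero.1 this).resolve_left two_pi_pos.ne'
  exact ⟨by rw [h3] at h1; linarith, h3⟩

/-- The coefficient of t and the periodic remainder vanish separately; values at a few angles then
determine the constants. Setting c 7 = c 8 = 0 is necessary: for r = sin t their functions are the
sums of those of c 1 and c 3, and of c 2 and c 4. -/
theorem averaged_sin_eq_zero {c : Fin 9 → ℝ} (h7 : c 7 = 0) (h8 : c 8 = 0)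
    (h : ∀ t ∈ Set.Ioo 0 (π / 2), averaged c (sin t) t = 0) (i : Fin 9) : c i = 0 := by
  have key := fun t => eq_zero_of_add_mul_eq_zero
    (A := fun t => 2 * cos t * (c 0 + c 1 * sin t ^ 2 + c 2 * sin t ^ 4) +
      sin t * (c 3 + c 4 * sin t ^ 2) * (π / 2 - sin t * cos t) +
      sin t * (c 5 + c 6 * sin t ^ 2) * π)
    (B := fun t => sin t * ((2 * c 5 - c 3) + (2 * c 6 - c 4) * sin t ^ 2))
    (fun t _ => by fun_prop) (fun t _ => by fun_prop)
    (fun t => by simp) (fun t => by simp)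
    (fun t ht => by
      rw [← h t ht, averaged, h7, h8]
      ring) t
  have B1 := (key (π / 2)).2
  have B2 := (key (π / 6)).2
  have A1 := (key (π / 2)).1
  have A2 := (key (π / 6)).1
  -- Reflection in π/2 changes the sign of cos only. Adding this relation to the one at π/6 removes
  -- every term odd in cos.
  have A3 := (key (π - π / 6)).1
  have A4 := (key 0).1
  have A5 := (key (π / 4)).1
  simp only [sin_pi_div_two, sin_pi_div_six, cos_pi_div_two, cos_pi_div_six, sin_pi_sub,
    cos_pi_sub, sin_zero, cos_zero, sin_pi_div_four, cos_pi_div_four] at B1 B2 A1 A2 A3 A4 A5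
  have e4 : c 4 = 2 * c 6 := by linarith
  have e3 : c 3 = 2 * c 5 := by linarith
  have hπ := pi_pos.ne'
  have f1 : π * (c 5 + c 6) = 0 := by rw [e3, e4] at A1; linarith
  have f2 : π * (c 5 + c 6 / 4) = 0 := by rw [e3, e4] at A2 A3; linarith
  have f1' := (mul_eq_zero.1 f1).resolve_left hπ
  have f2' := (mul_eq_zero.1 f2).resolve_left hπ
  have e5 : c 5 = 0 := by linarith
  have e6 : c 6 = 0 := by linarith
  have e3' : c 3 = 0 := by linarith
  have e4' : c 4 = 0 := by linarith
  have e0 : c 0 = 0 := by linarith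
  simp only [e0, e3', e4', e5, e6, zero_mul, mul_zero, add_zero, zero_add] at A2 A5
  have g1 : c 1 * (1 / 4) + c 2 * (1 / 16) = 0 := by
    have h3 : (0 : ℝ) < √3 := by positivity
    have : √3 * (c 1 * (1 / 4) + c 2 * (1 / 16)) = 0 := by linarith
    exact (mul_eq_zero.1 this).resolve_left h3.ne'
  have g2 : c 1 * (1 / 2) + c 2 * (1 / 4) = 0 := by
    have h2 : (0 : ℝ) < √2 := by positivity
    have hs : √2 ^ 2 = 2 := sq_sqrt zero_le_two
    have : √2 * (c 1 * (1 / 2) + c 2 * (1 / 4)) = 0 := by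
      have e : (√2 / 2) ^ 2 = 1 / 2 := by rw [div_pow, hs]; norm_num
      have e' : (√2 / 2) ^ 4 = 1 / 4 := by
        rw [show (√2 / 2) ^ 4 = ((√2 / 2) ^ 2) ^ 2 by ring, e]; norm_num
      rw [e, e'] at A5
      linarith
    exact (mul_eq_zero.1 this).resolve_left h2.ne'
  have e1 : c 1 = 0 := by linarith
  have e2 : c 2 = 0 := by linarith
  fin_cases i <;> assumption

/-- On the circle of radius r, y - z = r (sin θ - r), so the crossing angle t satisfies r = sin t.
Seven independent functions yield six simple zeros. -/
theorem atLeastLimitCyclesBifurcate_y_sub_z {lam : ℝ} (hlam : lam ≠ 0) :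
    AtLeastLimitCyclesBifurcate lam (fun p => p 1 - p 2) 6 := by
  have hf : ContDiff ℝ 1 fun p : Space => p 1 - p 2 :=
    (contDiff_apply ℝ ℝ (1 : Fin 3)).sub (contDiff_apply ℝ ℝ (2 : Fin 3))
  have hsum : ∀ (c : Fin 7 → ℝ) t, ∑ i, c i * (![fun t => 2 * cos t,
      fun t => 2 * cos t * sin t ^ 2, fun t => 2 * cos t * sin t ^ 4,
      fun t => sin t * (π / 2 - t - sin t * cos t),
      fun t => sin t ^ 3 * (π / 2 - t - sin t * cos t),
      fun t => sin t * (π + 2 * t), fun t => sin t ^ 3 * (π + 2 * t)] : Fin 7 → ℝ → ℝ) i t =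
      averaged ![c 0, c 1, c 2, c 3, c 4, c 5, c 6, 0, 0] (sin t) t := fun c t => by
    simp [Fin.sum_univ_seven, averaged]
    ring
  have hcos : ∀ t ∈ Set.Ioo 0 (π / 2), 0 < cos t := fun t ht =>
    cos_pos_of_mem_Ioo ⟨by linarith [pi_pos, ht.1], ht.2⟩
  have hsin : ∀ t ∈ Set.Ioo 0 (π / 2), 0 < sin t := fun t ht =>
    sin_pos_of_pos_of_lt_pi ht.1 (by linarith [pi_pos, ht.2])
  obtain ⟨c, k, hk, hz⟩ := exists_simple_zeros (n := 6) (I := Set.Ioo 0 (π / 2))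
    (g := ![fun t => 2 * cos t,
      fun t => 2 * cos t * sin t ^ 2, fun t => 2 * cos t * sin t ^ 4,
      fun t => sin t * (π / 2 - t - sin t * cos t),
      fun t => sin t ^ 3 * (π / 2 - t - sin t * cos t),
      fun t => sin t * (π + 2 * t), fun t => sin t ^ 3 * (π + 2 * t)]) Set.ordConnected_Ioo
    (fun i t _ => by fin_cases i <;> simp <;> fun_prop)
    (fun t ht => mul_pos two_pos (hcos t ht))
    (fun c hc => by
      simp only [hsum] at hc
      have h0 := averaged_sin_eq_zero (c := ![c 0, c 1, c 2, c 3, c 4, c 5, c 6, 0, 0]) rfl rfl hc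
      funext i
      have := h0 (Fin.castLE (by norm_num) i)
      fin_cases i <;> exact this)
  simp only [hsum] at hz
  refine atLeastLimitCyclesBifurcate_of_averaged hlam hf (ρ := sin) (a := fun t => t) isOpen_Ioo
    (fun t _ => differentiable_sin t) continuousOn_id (fun t ht => ?_) ?_ _ hk hz
  · refine isCrossingCircle_of_eq_mul (hf.differentiable one_ne_zero) (hsin t ht) ht.1.le ht.2
      (m := fun _ => sin t) (by fun_prop) (fun _ => hsin t ht) fun θ => ?_
    simp [circlePoint]
    ring
  · exact injOn_sin.mono (Set.Ioo_subset_Icc_self.trans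
      (Set.Icc_subset_Icc_left (by linarith [pi_pos])))

/-! ### The cylinder y = x² -/

/-- Multiplication by cos⁷ t clears the denominators and leaves trigonometric polynomials A + tB.
These vanish separately, and splitting A by its parity in cos gives enough relations for all nine
coefficients to vanish. -/
theorem averaged_sin_div_cos_sq_eq_zero {c : Fin 9 → ℝ}
    (h : ∀ t ∈ Set.Ioo 0 (π / 2), averaged c (sin t / cos t ^ 2) t = 0) (i : Fin 9) : c i = 0 := by
  have r2 : (√2 / 2) ^ 2 = 1 / 2 := by rw [div_pow, sq_sqrt zero_le_two]; norm_num
  have r2' : (√2 / 2) ^ 4 = 1 / 4 := by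
    rw [show (√2 / 2) ^ 4 = ((√2 / 2) ^ 2) ^ 2 by ring, r2]; norm_num
  have r3 : (√3 / 2) ^ 2 = 3 / 4 := by rw [div_pow, sq_sqrt zero_le_three]; norm_num
  have r3' : (√3 / 2) ^ 4 = 9 / 16 := by
    rw [show (√3 / 2) ^ 4 = ((√3 / 2) ^ 2) ^ 2 by ring, r3]; norm_num
  have key := fun t => eq_zero_of_add_mul_eq_zero
    (A := fun t => 2 * (c 0 * cos t ^ 8 + c 1 * sin t ^ 2 * cos t ^ 4 + c 2 * sin t ^ 4) +
      (c 3 * sin t * cos t ^ 5 + c 4 * sin t ^ 3 * cos t) * (π / 2 - sin t * cos t) +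
      (c 5 * sin t * cos t ^ 5 + c 6 * sin t ^ 3 * cos t) * π +
      (c 7 * sin t * cos t ^ 5 + c 8 * sin t ^ 3 * cos t) * (π / 2 + sin t * cos t))
    (B := fun t => sin t * cos t * ((2 * c 5 - c 3 - c 7) * cos t ^ 4 +
      (2 * c 6 - c 4 - c 8) * sin t ^ 2))
    (fun t _ => by fun_prop) (fun t _ => by fun_prop)
    (fun t => by simp) (fun t => by simp)
    (fun t ht => by
      have hc : cos t ≠ 0 := (cos_pos_of_mem_Ioo ⟨by linarith [pi_pos, ht.1], ht.2⟩).ne'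
      have := h t ht
      rw [averaged] at this
      field_simp at this
      linear_combination this / 2) t
  have hpq : ∀ p q : ℝ, (∀ t, sin t * cos t * (p * cos t ^ 4 + q * sin t ^ 2) = 0) →
      p = 0 ∧ q = 0 := by
    intro p q hpq
    have h1 := hpq (π / 4)
    have h2 := hpq (π / 6)
    simp only [sin_pi_div_four, cos_pi_div_four, sin_pi_div_six, cos_pi_div_six] at h1 h2
    have h1' := (mul_eq_zero.1 h1).resolve_left (by positivity)
    have h2' := (mul_eq_zero.1 h2).resolve_left (by positivity)
    rw [r2, r2'] at h1'
    rw [r3'] at h2'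
    constructor <;> linarith
  obtain ⟨p1, p2⟩ := hpq _ _ fun t => (key t).2
  -- The difference of the relations at t and π - t isolates the part of A odd in cos, which has the
  -- same shape as B; their sum gives the even part below.
  obtain ⟨p3, p4⟩ := hpq (c 3 + 2 * c 5 + c 7) (c 4 + 2 * c 6 + c 8) fun t => by
    have h1 := (key t).1
    have h2 := (key (π - t)).1
    simp only [sin_pi_sub, cos_pi_sub] at h2
    have : π * (sin t * cos t * ((c 3 + 2 * c 5 + c 7) * cos t ^ 4 +
        (c 4 + 2 * c 6 + c 8) * sin t ^ 2)) = 0 := by linear_combination h1 - h2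
    exact (mul_eq_zero.1 this).resolve_left pi_pos.ne'
  have heven : ∀ t, 2 * (c 0 * cos t ^ 8 + c 1 * sin t ^ 2 * cos t ^ 4 + c 2 * sin t ^ 4) =
      sin t ^ 2 * cos t ^ 2 * ((c 3 - c 7) * cos t ^ 4 + (c 4 - c 8) * sin t ^ 2) := fun t => by
    have h1 := (key t).1
    have h2 := (key (π - t)).1
    simp only [sin_pi_sub, cos_pi_sub] at h2
    linear_combination (h1 + h2) / 2
  have E0 := heven 0
  have E1 := heven (π / 2)
  have E2 := heven (π / 4)
  have E3 := heven (π / 6)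
  have E4 := heven (π / 3)
  simp only [sin_pi_div_two, cos_pi_div_two, sin_zero, cos_zero] at E0 E1
  have e0 : c 0 = 0 := by linarith
  have e2 : c 2 = 0 := by linarith
  simp only [sin_pi_div_four, cos_pi_div_four, sin_pi_div_six, cos_pi_div_six, sin_pi_div_three,
    cos_pi_div_three, e0, e2, r2, r2', r3, r3'] at E2 E3 E4
  have e3 : c 3 - c 7 = 0 := by linarith
  have e4 : c 4 - c 8 = 0 := by linarith
  have e1 : c 1 = 0 := by linarith
  have e5 : c 5 = 0 := by linarith
  have e6 : c 6 = 0 := by linarith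
  have e7 : c 7 = 0 := by linarith
  have e8 : c 8 = 0 := by linarith
  have e3' : c 3 = 0 := by linarith
  have e4' : c 4 = 0 := by linarith
  fin_cases i <;> assumption

/-- On the circle of radius r the crossing condition is sin t = r cos² t. All nine functions are now
independent, which yields eight simple zeros. -/
theorem atLeastLimitCyclesBifurcate_y_sub_sq {lam : ℝ} (hlam : lam ≠ 0) :
    AtLeastLimitCyclesBifurcate lam (fun p => p 1 - p 0 ^ 2) 8 := by
  have hf : ContDiff ℝ 1 fun p : Space => p 1 - p 0 ^ 2 :=
    (contDiff_apply ℝ ℝ (1 : Fin 3)).sub ((contDiff_apply ℝ ℝ (0 : Fin 3)).pow 2)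
  have hsum : ∀ (c : Fin 9 → ℝ) t, ∑ i, c i * averaged (Pi.single i 1) (sin t / cos t ^ 2) t =
      averaged c (sin t / cos t ^ 2) t := fun c t => by
    rw [Fin.sum_univ_succ, Fin.sum_univ_eight]
    simp [averaged]
    ring
  have hcos : ∀ t ∈ Set.Ioo 0 (π / 2), 0 < cos t := fun t ht =>
    cos_pos_of_mem_Ioo ⟨by linarith [pi_pos, ht.1], ht.2⟩
  have hsin : ∀ t ∈ Set.Ioo 0 (π / 2), 0 < sin t := fun t ht =>
    sin_pos_of_pos_of_lt_pi ht.1 (by linarith [pi_pos, ht.2])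
  have hρ : ∀ t ∈ Set.Ioo 0 (π / 2), DifferentiableAt ℝ (fun t => sin t / cos t ^ 2) t :=
    fun t ht => (differentiable_sin t).fun_div ((differentiable_cos t).fun_pow 2)
      (pow_ne_zero 2 (hcos t ht).ne')
  obtain ⟨c, k, hk, hz⟩ := exists_simple_zeros (n := 8) (I := Set.Ioo 0 (π / 2))
    (g := fun i t => averaged (Pi.single i 1) (sin t / cos t ^ 2) t) Set.ordConnected_Ioo
    (fun i t ht => by
      have := hρ t ht
      unfold averaged
      fun_prop)
    (fun t ht => by
      have := hcos t ht
      simp [averaged]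
      exact this)
    (fun c hc => by
      simp only [hsum] at hc
      exact funext (averaged_sin_div_cos_sq_eq_zero hc))
  simp only [hsum] at hz
  refine atLeastLimitCyclesBifurcate_of_averaged hlam hf (ρ := fun t => sin t / cos t ^ 2)
    (a := fun t => t) isOpen_Ioo hρ continuousOn_id (fun t ht => ?_) ?_ _ hk hz
  · have hs := hsin t ht
    have hc := hcos t ht
    refine isCrossingCircle_of_eq_mul (hf.differentiable one_ne_zero) (by positivity) ht.1.le ht.2
      -- As a quadratic in sin θ, r sin θ - r² cos² θ has roots sin t and -1/sin t. The second lies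
      -- outside [-1, 1], so the cofactor of sin θ - sin t is positive.
      (m := fun θ => sin t / cos t ^ 4 * (1 + sin t * sin θ)) (by fun_prop) (fun θ => ?_)
      fun θ => ?_
    · have h1 : sin t < 1 := by nlinarith [sin_sq_add_cos_sq t]
      have : 0 < 1 + sin t * sin θ := by nlinarith [neg_one_le_sin θ]
      positivity
    · simp [circlePoint]
      field_simp
      rw [cos_sq' θ, cos_sq' t]
      ring
  · intro x hx y hy hxy
    have hcx := hcos x hx
    have hcy := hcos y hy
    have hsx := hsin x hx
    have hsy := hsin y hy
    have h1 : (sin x - sin y) * (1 + sin x * sin y) = 0 := by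
      simp only at hxy
      rw [div_eq_div_iff (by positivity) (by positivity), cos_sq' x, cos_sq' y] at hxy
      linear_combination hxy
    have h2 := (mul_eq_zero.1 h1).resolve_right (by positivity)
    exact injOn_sin ⟨by linarith [pi_pos, hx.1], hx.2.le⟩ ⟨by linarith [pi_pos, hy.1], hy.2.le⟩
      (sub_eq_zero.1 h2)

theorem theorem4 (lam : ℝ) (hlam : lam ≠ 0) :
    AtLeastLimitCyclesBifurcate lam (fun p => p 1) 4 ∧
    AtLeastLimitCyclesBifurcate lam (fun p => p 1 - p 2) 6 ∧
    AtLeastLimitCyclesBifurcate lam (fun p => p 1 - p 0 ^ 2) 8 :=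
  ⟨atLeastLimitCyclesBifurcate_y hlam, atLeastLimitCyclesBifurcate_y_sub_z hlam,
    atLeastLimitCyclesBifurcate_y_sub_sq hlam⟩
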